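/- **Setting.** Let $d,r,m\in\mathbb N$, let $E$ be a complex Hilbert space, and let $\mathcal B$ be the Banach space of trace class operators on $\mathbb C^d\otimes E$ with the trace norm. Let $\Omega=(\Omega_1,\dots,\Omega_r)$ have positive, rationally independent entries. A function $t\mapsto A_t$ is called *quasiperiodic* if $A_t=\hat A(\Omega_1t,\dots,\Omega_rt)$ for a continuous function $\hat A$ on the torus $(\mathbb R/2\pi\mathbb Z)^r$; it is then defined for all real $t$. A linear equation $\dot x=A_tx$ on $[0,\infty)$ is called *Lyapunov–Perron reducible* if there are a quasiperiodic family $P_t$ of invertible linear maps with $P_0=I$ and a constant linear map $X$ such that the substitution $x=P_ty$ turns it into $\dot y=Xy$. Let $H_t\in M_d$ be quasiperiodic and Hermitian, and suppose that the Schrödinger equation $\dot\psi=-iH_t\psi$ is reducible in the sense that its evolution operator is $u_t=p_te^{-it\bar H}$, $t\ge0$, with $p_t$ quasiperiodic and unitary, $p_0=I$, and $\bar H$ Hermitian, with eigenvalues $\epsilon_k$ and spectral decomposition $\bar H=\sum_k\epsilon_kP_k$. Suppose that no two Bohr quasi-frequencies $\omega_1,\omega_2\in\{\epsilon_k-\epsilon_l\}$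 satisfy $\omega_1-\omega_2=n\cdot\Omega$ with $n\in\mathbb Z^r\setminus\{0\}$. Let $H_E$ be a bounded self-adjoint operator on $E$, let $\omega_E$ be a density operator on $E$ with $[H_E,\omega_E]=0$, and let $H_{\rm int}=\sum_{\mu=1}^mS_\mu\otimes R_\mu$ be self-adjoint, with $S_\mu\in M_d$, $R_\mu$ bounded and $\operatorname{tr}(\omega_ER_\mu)=0$. Suppose that all the functions $f_{\mu\nu}(t)=\operatorname{tr}(e^{itH_E}R_\mu^*e^{-itH_E}R_\nu\omega_E)$ are integrable on $[0,\infty)$. On $\mathcal B$ put $\mathcal P_0a=(\operatorname{tr}_Ea)\otimes\omega_E$, $\mathcal P_1=\mathrm{id}-\mathcal P_0$, $A=-i[H_{\rm int},\cdot]$, $A_{ij}=\mathcal P_iA\mathcal P_j$, $Z_t=-i[H_t\otimes I+I\otimes H_E,\cdot]$, $\bar Z=-i[\bar H\otimes I+I\otimes H_E,\cdot]$, $U_t(a)=(p_t\otimes I)\,e^{t\bar Z}(a)\,(p_t^*\otimes I)$ and $U_{t,s}=U_tU_s^{-1}$. For $\lambda>0$ let $$\tilde K^\lambda_t=\int_0^\infty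 (U_{x+\lambda^{-2}t,\lambda^{-2}t})^{-1}A_{01}U_{x+\lambda^{-2}t,\lambda^{-2}t}A_{10}\,dx,\qquad K=\lim_{\delta\to\infty}\frac1{2\delta}\int_{-\delta}^{\delta}U_{\lambda^{-2}t}^{-1}\tilde K^\lambda_tU_{\lambda^{-2}t}\,dt ,$$ let $W_t$, $t\ge0$, be a solution, continuous in $t$ with values in the bounded operators on $\mathcal B$, of $W_t=\mathcal P_0U_t+\int_0^tU_tKU_s^{-1}W_s\,ds$, and define the weak-coupling reduced dynamics $\Lambda_t$ on $M_d$ by $W_t(v_0)=\Lambda_t(\rho_0)\otimes\omega_E$ for $v_0\in\mathcal B$, where $\rho_0\otimes\omega_E=\mathcal P_0(v_0)$. Let $h_{\mu\nu}(\omega)=\int_{-\infty}^\infty f_{\mu\nu}(x)e^{-i\omega x}dx$, let $\zeta_{\mu\nu}$ be defined by $\int_0^\infty f_{\mu\nu}(x)e^{-i\omega x}dx=\frac12h_{\mu\nu}(\omega)+i\zeta_{\mu\nu}(\omega)$, let $\hat S_{\mu,n}$, $n\in\mathbb Z^r$, be the Fourier coefficients of the quasiperiodic function $p_t^*S_\mu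 p_t$, let $S_{\mu n\omega}=\sum_{\epsilon_k-\epsilon_l=\omega}P_k\hat S_{\mu,n}P_l$, and put $$\Delta H=\sum_{\mu,\nu}\sum_{n\in\mathbb Z^r}\sum_\omega\zeta_{\mu\nu}(\omega+n\cdot\Omega)\,S_{\mu n\omega}^*S_{\nu n\omega},$$ $$\bar D(\rho)=\sum_{\mu,\nu}\sum_{n\in\mathbb Z^r}\sum_\omega h_{\mu\nu}(\omega+n\cdot\Omega)\Big(S_{\nu n\omega}\rho S_{\mu n\omega}^*-\tfrac12\{S_{\mu n\omega}^*S_{\nu n\omega},\rho\}\Big),$$ $\Sigma_t(\rho)=p_t\rho p_t^*$, $X=-i[\bar H+\Delta H,\cdot]+\bar D$ and $L_t=-i[H_t+\Sigma_t(\Delta H),\cdot]+\Sigma_t\bar D\Sigma_t^{-1}$. **Theorem.** $U_t$ is the principal fundamental solution of $\dot x=Z_tx$ on $[0,\infty)$. The integrals and the limit which define $K$ exist, $K$ does not depend on $\lambda$, such $W_t$ and $\Lambda_t$ exist, and $\Lambda_t$ is unique. The functions $f_{\mu\nu}$ are integrable on $\mathbb R$, the matrices $[h_{\mu\nu}(\omega)]$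 are positive semidefinite, the matrices $[\zeta_{\mu\nu}(\omega)]$ and $\Delta H$ are Hermitian, and the series for $\Delta H$ and $\bar D$ converge. The function $t\mapsto\Lambda_t$, $t\ge0$, is uniformly continuous and differentiable; every $\Lambda_t$ is completely positive and trace preserving on $M_d$, and $\Lambda$ is CP-divisible: there are completely positive maps $\Lambda_{t,s}$, $0\le s\le t$, with $\Lambda_t=\Lambda_{t,s}\Lambda_s$, $\Lambda_{t,t}=\mathrm{id}$ and $\Lambda_{t,u}\Lambda_{u,s}=\Lambda_{t,s}$ for $s\le u\le t$. One has $\Lambda_0=\mathrm{id}$, and $\rho_t=\Lambda_t(\rho_0)$ satisfies the Markovian master equation $\dot\rho_t=L_t(\rho_t)$, where $t\mapsto L_t$ is quasiperiodic and every $L_t$ is a Lindbladian in standard (Gorini–Kossakowski–Lindblad–Sudarshan) form. This equation is Lyapunov–Perron reducible, and $\Lambda_t=\Sigma_te^{tX}$ for all $t\ge0$, with $\Sigma_t$ quasiperiodic. -/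

import Mathlib

open scoped Matrix.Norms.L2Operator MatrixOrder ComplexOrder CStarAlgebra ENNReal

noncomputable section

namespace OpenQuantum

theorem norm_sum_rankOne_le {H : Type*} [NormedAddCommGroup H] [InnerProductSpace ℂ H]
    {n : ℕ} {e f : Fin n → H} (he : Orthonormal ℂ e)
    (hf : Orthonormal ℂ f) : ‖∑ i, InnerProductSpace.rankOne ℂ (e i) (f i)‖ ≤ 1 := by
  refine ContinuousLinearMap.opNorm_le_bound _ zero_le_one fun z => ?_
  rw [one_mul, sum_apply]
  simp only [InnerProductSpace.rankOne_apply]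
  rw [← sq_le_sq₀ (norm_nonneg _) (norm_nonneg _)]
  have h1 : ‖∑ i, inner ℂ (f i) z • e i‖ ^ 2 = ∑ i, ‖inner ℂ (f i) z‖ ^ 2 := by
    have h := he.inner_sum (fun i => inner ℂ (f i) z) (fun i => inner ℂ (f i) z) Finset.univ
    rw [inner_self_eq_norm_sq_to_K] at h
    simp only [Complex.conj_mul'] at h
    have h' := congrArg Complex.re h
    norm_cast at h'
  rw [h1]
  exact hf.sum_inner_products_le z

section TraceClass

variable {H : Type*} [NormedAddCommGroup H] [InnerProductSpace ℂ H] [CompleteSpace H]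
variable {G : Type*} [NormedAddCommGroup G] [InnerProductSpace ℂ G] [CompleteSpace G]

variable (H) in
/-- Index set of a fixed orthonormal basis of `H`. -/
def stdIndex : Set H := (exists_hilbertBasis ℂ H).choose

variable (H) in
/-- A fixed orthonormal basis of `H`. -/
def stdBasis : HilbertBasis (stdIndex H) ℂ H := (exists_hilbertBasis ℂ H).choose_spec.choose

/-- The trace norm `‖T‖₁ = tr √(T† T)`, with values in `[0, ∞]`. -/
def traceNorm (T : H →L[ℂ] H) : ℝ≥0∞ :=
  ∑' i, ENNReal.ofReal (inner ℂ (stdBasis H i) (CFC.abs T (stdBasis H i))).re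

theorem exists_approx_polar (T : H →L[ℂ] H) {ε : ℝ} (hε : 0 < ε) :
    ∃ V : H →L[ℂ] H, ‖V‖ ≤ 1 ∧ ‖T - V * CFC.abs T‖ ≤ ε ∧ ‖star V * T - CFC.abs T‖ ≤ ε := by
  set a := CFC.abs T with ha
  have ha0 : 0 ≤ a := CFC.abs_nonneg T
  have hsa : IsSelfAdjoint a := ha0.isSelfAdjoint
  have haa : a * a = star T * T := CFC.abs_mul_abs T
  have hspec : ∀ x ∈ spectrum ℝ a, 0 ≤ x := fun x hx => spectrum_nonneg_of_nonneg ha0 hx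
  have hc : ContinuousOn (fun x : ℝ => (x + ε)⁻¹) (spectrum ℝ a) :=
    ContinuousOn.inv₀ (by fun_prop) (fun x hx => by have := hspec x hx; positivity)
  set r := cfc (fun x : ℝ => (x + ε)⁻¹) a with hr
  have hrs : star r = r := (cfc_predicate (R := ℝ) (fun x : ℝ => (x + ε)⁻¹) a).star_eq
  have hcid : ContinuousOn (fun x : ℝ => x) (spectrum ℝ a) := continuousOn_id
  have hid : cfc (fun x : ℝ => x) a = a := cfc_id' ℝ a
  have har : a * r = cfc (fun x : ℝ => x * (x + ε)⁻¹) a := by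
    rw [cfc_mul _ _ a hcid hc, hid]
  have hra : r * a = cfc (fun x : ℝ => (x + ε)⁻¹ * x) a := by
    rw [cfc_mul _ _ a hc hcid, hid]
  have key : ∀ q : H →L[ℂ] H, ‖T * q‖ = ‖a * q‖ := by
    intro q
    have h1 : star (T * q) * (T * q) = star (a * q) * (a * q) := by
      simp only [star_mul, hsa.star_eq, mul_assoc]
      rw [← mul_assoc (star T), ← haa, mul_assoc]
    have h2 := CStarRing.norm_star_mul_self (x := T * q)
    have h3 := CStarRing.norm_star_mul_self (x := a * q)
    rw [h1, h3] at h2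
    exact (mul_self_inj (norm_nonneg _) (norm_nonneg _)).1 h2.symm
  refine ⟨T * r, ?_, ?_, ?_⟩
  · rw [key, har]
    refine norm_cfc_le zero_le_one fun x hx => ?_
    have := hspec x hx
    rw [Real.norm_of_nonneg (by positivity), ← div_eq_mul_inv]
    exact (div_le_one (by positivity)).2 (by linarith)
  · have h1 : T - T * r * a = T * (1 - r * a) := by rw [mul_sub, mul_one, mul_assoc]
    have h2 : a * (1 - r * a) = cfc (fun x : ℝ => x * (1 - (x + ε)⁻¹ * x)) a := by
      rw [cfc_mul _ _ a hcid (by fun_prop), cfc_sub _ _ a (by fun_prop) (by fun_prop), hid,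
        ← hra, cfc_const_one ℝ a]
    rw [h1, key, h2]
    refine norm_cfc_le hε.le fun x hx => ?_
    have h0 := hspec x hx
    have : x * (1 - (x + ε)⁻¹ * x) = x * ε / (x + ε) := by
      have : x + ε ≠ 0 := by positivity
      field_simp
      ring
    rw [this, Real.norm_of_nonneg (by positivity)]
    rw [div_le_iff₀ (by positivity)]
    nlinarith
  · have h1 : star (T * r) * T - a = cfc (fun x : ℝ => (x + ε)⁻¹ * x * x - x) a := by
      rw [cfc_sub _ _ a (by fun_prop) (by fun_prop), cfc_mul _ _ a (by fun_prop) (by fun_prop),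
        hid, ← hra, star_mul, hrs, mul_assoc, ← haa, mul_assoc]
    rw [h1]
    refine norm_cfc_le hε.le fun x hx => ?_
    have h0 := hspec x hx
    have : (x + ε)⁻¹ * x * x - x = - (x * ε / (x + ε)) := by
      have : x + ε ≠ 0 := by positivity
      field_simp
      ring
    rw [this, norm_neg, Real.norm_of_nonneg (by positivity)]
    rw [div_le_iff₀ (by positivity)]
    nlinarith

theorem enorm_sum_inner_le (T : H →L[ℂ] H) {n : ℕ} (x y : Fin n → H) :
    ‖∑ i, inner ℂ (x i) (T (y i))‖ₑ
      ≤ ‖∑ i, InnerProductSpace.rankOne ℂ (y i) (x i)‖ₑ * traceNorm T := by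
  set F := ∑ i, InnerProductSpace.rankOne ℂ (y i) (x i) with hF
  set a := CFC.abs T with ha
  have ha0 : 0 ≤ a := CFC.abs_nonneg T
  set S := CFC.sqrt a with hS
  have hSS : S * S = a := CFC.sqrt_mul_sqrt_self a ha0
  have hSa : ∀ u v : H, inner ℂ (S u) v = inner ℂ u (S v) :=
    fun u v => ((CFC.sqrt_nonneg a).isSelfAdjoint.isSymmetric u v)
  have step : ∀ V : H →L[ℂ] H, ‖V‖ ≤ 1 →
      ‖∑ i, inner ℂ (x i) (V (a (y i)))‖ₑ ≤ ‖F‖ₑ * traceNorm T := by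
    intro V hV
    have e1 : ∀ i, inner ℂ (x i) (V (a (y i))) = inner ℂ (S (star V (x i))) (S (y i)) := by
      intro i
      rw [hSa, ContinuousLinearMap.star_eq_adjoint, ContinuousLinearMap.adjoint_inner_left, ← hSS]
      rfl
    have hs : HasSum (fun j => ∑ i, inner ℂ (S (star V (x i))) (stdBasis H j) *
        inner ℂ (stdBasis H j) (S (y i))) (∑ i, inner ℂ (x i) (V (a (y i)))) := by
      simp_rw [e1]
      exact hasSum_sum fun i _ => (stdBasis H).hasSum_inner_mul_inner _ _
    have e2 : ∀ j, ∑ i, inner ℂ (S (star V (x i))) (stdBasis H j) *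
        inner ℂ (stdBasis H j) (S (y i))
          = inner ℂ (S (stdBasis H j)) (F (V (S (stdBasis H j)))) := by
      intro j
      rw [hF, sum_apply, inner_sum]
      refine Finset.sum_congr rfl fun i _ => ?_
      rw [InnerProductSpace.rankOne_apply, inner_smul_right, hSa, hSa,
        ContinuousLinearMap.star_eq_adjoint, ContinuousLinearMap.adjoint_inner_left]
    rw [← hs.tsum_eq, traceNorm, ← ENNReal.tsum_mul_left]
    refine enorm_tsum_le_tsum_enorm.trans (ENNReal.tsum_le_tsum fun j => ?_)
    rw [e2, ← ha, ← hSS, mul_apply_eq_comp, ← hSa, inner_self_eq_norm_sq_to_K]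
    set w := S (stdBasis H j)
    have h1 : ‖inner ℂ w (F (V w))‖ ≤ ‖F‖ * ‖w‖ ^ 2 := by
      calc ‖inner ℂ w (F (V w))‖ ≤ ‖w‖ * ‖F (V w)‖ := norm_inner_le_norm _ _
        _ ≤ ‖w‖ * (‖F‖ * (‖V‖ * ‖w‖)) := by
          gcongr
          exact (F.le_opNorm _).trans (by gcongr; exact V.le_opNorm _)
        _ ≤ ‖w‖ * (‖F‖ * (1 * ‖w‖)) := by gcongr
        _ = ‖F‖ * ‖w‖ ^ 2 := by ring
    have h2 : (((‖w‖ : ℝ) : ℂ) ^ 2).re = ‖w‖ ^ 2 := by norm_cast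
    rw [← ofReal_norm, ← ofReal_norm, ← ENNReal.ofReal_mul (norm_nonneg _)]
    refine ENNReal.ofReal_le_ofReal (h1.trans (le_of_eq ?_))
    rw [← h2]; rfl
  set C : ℝ := ∑ i, ‖x i‖ * ‖y i‖ with hC
  have hC0 : 0 ≤ C := Finset.sum_nonneg fun i _ => by positivity
  refine ENNReal.le_of_forall_pos_le_add fun δ hδ _ => ?_
  obtain ⟨V, hV, hV2, -⟩ := exists_approx_polar T (ε := δ / (C + 1)) (by positivity)
  have e : ∑ i, inner ℂ (x i) (T (y i)) = ∑ i, inner ℂ (x i) (V (a (y i)))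
      + ∑ i, inner ℂ (x i) ((T - V * a) (y i)) := by
    rw [← Finset.sum_add_distrib]
    refine Finset.sum_congr rfl fun i _ => ?_
    rw [sub_apply, inner_sub_right, mul_apply_eq_comp]
    ring
  rw [e]
  refine (enorm_add_le _ _).trans (add_le_add (step V hV) ?_)
  rw [← ofReal_norm]
  refine ENNReal.ofReal_le_of_le_toReal ?_
  calc ‖∑ i, inner ℂ (x i) ((T - V * a) (y i))‖
      ≤ ∑ i, ‖x i‖ * (δ / (C + 1) * ‖y i‖) := by
        refine (norm_sum_le _ _).trans (Finset.sum_le_sum fun i _ => ?_)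
        refine (norm_inner_le_norm _ _).trans ?_
        gcongr
        exact ((T - V * a).le_opNorm _).trans (by gcongr)
    _ = δ / (C + 1) * C := by
        rw [hC, Finset.mul_sum]
        exact Finset.sum_congr rfl fun i _ => by ring
    _ ≤ δ := by
        rw [div_mul_eq_mul_div, div_le_iff₀ (by positivity)]
        have : (0 : ℝ) ≤ δ := δ.2
        nlinarith
    _ = _ := by simp

/-- The trace norm is dual to the operator norm on operators of finite rank. -/
theorem traceNorm_le_of (T : H →L[ℂ] H) (c : ℝ≥0∞)
    (h : ∀ (n : ℕ) (x y : Fin n → H), ‖∑ i, InnerProductSpace.rankOne ℂ (y i) (x i)‖ ≤ 1 →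
      ‖∑ i, inner ℂ (x i) (T (y i))‖ₑ ≤ c) : traceNorm T ≤ c := by
  rw [traceNorm, ENNReal.tsum_eq_iSup_sum]
  refine iSup_le fun J => ?_
  set a := CFC.abs T with ha
  have ha0 : 0 ≤ a := CFC.abs_nonneg T
  let e : Fin J.card → H := fun i => stdBasis H (J.equivFin.symm i)
  have he : Orthonormal ℂ e := (stdBasis H).orthonormal.comp _
    (Subtype.val_injective.comp J.equivFin.symm.injective)
  have hpos : ∀ z : H, 0 ≤ (inner ℂ z (a z)).re := fun z =>
    ((ContinuousLinearMap.nonneg_iff_isPositive a).1 ha0).re_inner_nonneg_right z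
  have hsum : ∑ j ∈ J, ENNReal.ofReal (inner ℂ (stdBasis H j) (a (stdBasis H j))).re
      = ENNReal.ofReal (∑ i, (inner ℂ (e i) (a (e i))).re) := by
    rw [ENNReal.ofReal_sum_of_nonneg (fun i _ => hpos _), ← Finset.sum_coe_sort J]
    exact (Equiv.sum_comp J.equivFin.symm (fun j : J =>
      ENNReal.ofReal (inner ℂ (stdBasis H j) (a (stdBasis H j))).re)).symm
  rw [hsum]
  refine ENNReal.le_of_forall_pos_le_add fun δ hδ _ => ?_
  obtain ⟨V, hV, -, hV2⟩ := exists_approx_polar T (ε := δ / (J.card + 1)) (by positivity)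
  have hn : ‖∑ i, InnerProductSpace.rankOne ℂ (e i) (V (e i))‖ ≤ 1 := by
    have : ∑ i, InnerProductSpace.rankOne ℂ (e i) (V (e i))
        = (∑ i, InnerProductSpace.rankOne ℂ (e i) (e i)) ∘L star V := by
      ext z
      simp [ContinuousLinearMap.star_eq_adjoint, ContinuousLinearMap.adjoint_inner_right]
    rw [this]
    refine (ContinuousLinearMap.opNorm_comp_le _ _).trans ?_
    rw [norm_star]
    exact mul_le_one₀ (norm_sum_rankOne_le he he) (norm_nonneg _) hV
  have hc := h _ _ _ hn
  have hle : ∑ i, (inner ℂ (e i) (a (e i))).re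
      ≤ ‖∑ i, inner ℂ (V (e i)) (T (e i))‖ + δ := by
    have e1 : ∀ i, inner ℂ (V (e i)) (T (e i)) = inner ℂ (e i) (a (e i))
        + inner ℂ (e i) ((star V * T - a) (e i)) := by
      intro i
      rw [sub_apply, inner_sub_right, mul_apply_eq_comp,
        ContinuousLinearMap.star_eq_adjoint, ContinuousLinearMap.adjoint_inner_right]
      ring
    have e2 : ∑ i, (inner ℂ (e i) (a (e i))).re = (∑ i, inner ℂ (V (e i)) (T (e i))).re
        - ∑ i, (inner ℂ (e i) ((star V * T - a) (e i))).re := by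
      simp only [Complex.re_sum, e1, Complex.add_re, Finset.sum_add_distrib]
      ring
    have e3 : ∀ i, |(inner ℂ (e i) ((star V * T - a) (e i))).re| ≤ δ / (J.card + 1) := by
      intro i
      refine (Complex.abs_re_le_norm _).trans ((norm_inner_le_norm _ _).trans ?_)
      have := (star V * T - a).le_opNorm (e i)
      rw [he.1 i, mul_one] at this
      rw [he.1 i, one_mul]
      exact this.trans hV2
    have e4 : |∑ i, (inner ℂ (e i) ((star V * T - a) (e i))).re| ≤ δ := by
      refine (Finset.abs_sum_le_sum_abs _ _).trans ((Finset.sum_le_sum fun i _ => e3 i).trans ?_)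
      rw [Finset.sum_const, Finset.card_univ, Fintype.card_fin, nsmul_eq_mul,
        mul_div_assoc', div_le_iff₀ (by positivity)]
      have : (0 : ℝ) ≤ δ := δ.2
      nlinarith
    have e5 := Complex.re_le_norm (∑ i, inner ℂ (V (e i)) (T (e i)))
    have e6 := abs_le.1 e4
    linarith [e6.1]
  calc ENNReal.ofReal (∑ i, (inner ℂ (e i) (a (e i))).re)
      ≤ ENNReal.ofReal (‖∑ i, inner ℂ (V (e i)) (T (e i))‖ + δ) := ENNReal.ofReal_le_ofReal hle
    _ ≤ ‖∑ i, inner ℂ (V (e i)) (T (e i))‖ₑ + δ := by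
        rw [ENNReal.ofReal_add (norm_nonneg _) δ.coe_nonneg, ofReal_norm, ENNReal.ofReal_coe_nnreal]
    _ ≤ c + δ := by gcongr

theorem traceNorm_add_le (S T : H →L[ℂ] H) : traceNorm (S + T) ≤ traceNorm S + traceNorm T := by
  refine traceNorm_le_of _ _ fun n x y hxy => ?_
  have hF : ‖∑ i, InnerProductSpace.rankOne ℂ (y i) (x i)‖ₑ ≤ 1 := by
    rw [← ofReal_norm]; exact ENNReal.ofReal_le_one.2 hxy
  simp only [add_apply, inner_add_right, Finset.sum_add_distrib]
  refine (enorm_add_le _ _).trans (add_le_add ?_ ?_)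
  · exact (enorm_sum_inner_le S x y).trans (mul_le_of_le_one_left' hF)
  · exact (enorm_sum_inner_le T x y).trans (mul_le_of_le_one_left' hF)

theorem traceNorm_comp_le (B : H →L[ℂ] G) (T : H →L[ℂ] H) (C : G →L[ℂ] H) :
    traceNorm (B ∘L T ∘L C) ≤ ‖B‖ₑ * ‖C‖ₑ * traceNorm T := by
  refine traceNorm_le_of _ _ fun n x y hxy => ?_
  have e : ∀ i, inner ℂ (x i) ((B ∘L T ∘L C) (y i))
      = inner ℂ (ContinuousLinearMap.adjoint B (x i)) (T (C (y i))) := fun i => by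
    rw [ContinuousLinearMap.adjoint_inner_left]; rfl
  simp_rw [e]
  refine (enorm_sum_inner_le T _ _).trans ?_
  gcongr
  have e2 : ∑ i, InnerProductSpace.rankOne ℂ (C (y i)) (ContinuousLinearMap.adjoint B (x i))
      = C ∘L (∑ i, InnerProductSpace.rankOne ℂ (y i) (x i)) ∘L B := by
    ext z
    simp [ContinuousLinearMap.adjoint_inner_left, map_sum]
  rw [e2, ← ofReal_norm, ← ofReal_norm, ← ofReal_norm, ← ENNReal.ofReal_mul (norm_nonneg _)]
  refine ENNReal.ofReal_le_ofReal ?_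
  calc _ ≤ ‖C‖ * (‖∑ i, InnerProductSpace.rankOne ℂ (y i) (x i)‖ * ‖B‖) :=
        (ContinuousLinearMap.opNorm_comp_le _ _).trans
          (by gcongr; exact ContinuousLinearMap.opNorm_comp_le _ _)
    _ ≤ ‖C‖ * (1 * ‖B‖) := by gcongr
    _ = ‖B‖ * ‖C‖ := by ring

theorem traceNorm_smul_le (c : ℂ) (T : H →L[ℂ] H) : traceNorm (c • T) ≤ ‖c‖ₑ * traceNorm T := by
  refine traceNorm_le_of _ _ fun n x y hxy => ?_
  have hF : ‖∑ i, InnerProductSpace.rankOne ℂ (y i) (x i)‖ₑ ≤ 1 := by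
    rw [← ofReal_norm]; exact ENNReal.ofReal_le_one.2 hxy
  simp only [smul_apply, inner_smul_right, ← Finset.mul_sum, enorm_mul]
  gcongr
  exact (enorm_sum_inner_le T x y).trans (mul_le_of_le_one_left' hF)

theorem traceNorm_zero : traceNorm (0 : H →L[ℂ] H) = 0 := by simp [traceNorm]

theorem enorm_le_traceNorm (T : H →L[ℂ] H) : ‖T‖ₑ ≤ traceNorm T := by
  by_cases hT : traceNorm T = ∞
  · simp [hT]
  have hb : ‖T‖ ≤ (traceNorm T).toReal := by
    refine ContinuousLinearMap.opNorm_le_bound _ ENNReal.toReal_nonneg fun z => ?_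
    have h := enorm_sum_inner_le T (n := 1) (fun _ => T z) (fun _ => z)
    simp only [Finset.univ_unique, Finset.sum_const, Finset.card_singleton, one_smul] at h
    rw [← ENNReal.ofReal_toReal hT, ← ofReal_norm, ← ofReal_norm,
      ← ENNReal.ofReal_mul (norm_nonneg _), InnerProductSpace.norm_rankOne] at h
    have h2 := (ENNReal.ofReal_le_ofReal_iff (by positivity)).1 h
    rw [inner_self_eq_norm_sq_to_K] at h2
    have h3 : ‖((‖T z‖ : ℝ) : ℂ) ^ 2‖ = ‖T z‖ ^ 2 := by simp
    change ‖((‖T z‖ : ℝ) : ℂ) ^ 2‖ ≤ _ at h2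
    rw [h3] at h2
    rcases eq_or_lt_of_le (norm_nonneg (T z)) with h0 | h0
    · rw [← h0]; positivity
    · nlinarith
  rw [← ofReal_norm]
  exact ENNReal.ofReal_le_of_le_toReal hb

variable (H) in
/-- Trace class operators, as a subspace of the bounded operators. -/
def traceClassSubmodule : Submodule ℂ (H →L[ℂ] H) where
  carrier := {T | traceNorm T < ∞}
  add_mem' hS hT := (traceNorm_add_le _ _).trans_lt (ENNReal.add_lt_top.2 ⟨hS, hT⟩)
  zero_mem' := by simp [traceNorm_zero]
  smul_mem' c T hT := (traceNorm_smul_le c T).trans_lt (ENNReal.mul_lt_top (by simp) hT)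

variable (H) in
/-- The Banach space of trace class operators on `H`, with the trace norm. -/
def TraceClass : Type _ := traceClassSubmodule H

namespace TraceClass

instance : AddCommGroup (TraceClass H) := inferInstanceAs (AddCommGroup (traceClassSubmodule H))
instance : Module ℂ (TraceClass H) := inferInstanceAs (Module ℂ (traceClassSubmodule H))

/-- The underlying bounded operator. -/
def val (T : TraceClass H) : H →L[ℂ] H := Subtype.val T

theorem traceNorm_lt_top (T : TraceClass H) : traceNorm T.val < ∞ := Subtype.property T

theorem ext {S T : TraceClass H} (h : S.val = T.val) : S = T := Subtype.ext h

/-- A bounded operator of finite trace norm, as a trace class operator. -/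
def ofCLM (T : H →L[ℂ] H) (hT : traceNorm T < ∞) : TraceClass H := ⟨T, hT⟩

theorem val_ofCLM (T : H →L[ℂ] H) (hT : traceNorm T < ∞) : (ofCLM T hT).val = T := rfl
theorem val_add (S T : TraceClass H) : (S + T).val = S.val + T.val := rfl
theorem val_sub (S T : TraceClass H) : (S - T).val = S.val - T.val := rfl
theorem val_neg (T : TraceClass H) : (-T).val = -T.val := rfl
theorem val_smul (c : ℂ) (T : TraceClass H) : (c • T).val = c • T.val := rfl
theorem val_zero : (0 : TraceClass H).val = 0 := rfl

instance : NormedAddCommGroup (TraceClass H) :=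
  AddGroupNorm.toNormedAddCommGroup
    { toFun := fun T => (traceNorm T.val).toReal
      map_zero' := by simp [val_zero, traceNorm_zero]
      add_le' := fun S T => by
        rw [← ENNReal.toReal_add S.traceNorm_lt_top.ne T.traceNorm_lt_top.ne]
        exact ENNReal.toReal_mono
          (ENNReal.add_lt_top.2 ⟨S.traceNorm_lt_top, T.traceNorm_lt_top⟩).ne
          (traceNorm_add_le _ _)
      neg' := fun T => by
        have h : ∀ S : H →L[ℂ] H, traceNorm (-S) ≤ traceNorm S := fun S => by
          simpa using traceNorm_smul_le (-1) S
        rw [val_neg, le_antisymm (h T.val) (by simpa using h (-T.val))]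
      eq_zero_of_map_eq_zero' := fun T hT => by
        have h0 : traceNorm T.val = 0 := by
          rcases (ENNReal.toReal_eq_zero_iff _).1 hT with h | h
          · exact h
          · exact absurd h T.traceNorm_lt_top.ne
        have h1 := enorm_le_traceNorm T.val
        rw [h0, nonpos_iff_eq_zero, enorm_eq_zero] at h1
        exact TraceClass.ext h1 }

theorem norm_def (T : TraceClass H) : ‖T‖ = (traceNorm T.val).toReal := rfl

instance : NormedSpace ℂ (TraceClass H) where
  norm_smul_le c T := by
    rw [norm_def, norm_def, val_smul, ← toReal_enorm, ← ENNReal.toReal_mul]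
    exact ENNReal.toReal_mono (ENNReal.mul_lt_top (by simp) T.traceNorm_lt_top).ne
      (traceNorm_smul_le c T.val)

theorem norm_val_le (T : TraceClass H) : ‖T.val‖ ≤ ‖T‖ := by
  rw [norm_def, ← toReal_enorm]
  exact ENNReal.toReal_mono T.traceNorm_lt_top.ne (enorm_le_traceNorm _)

theorem norm_sum_inner_le (T : TraceClass H) {n : ℕ} (x y : Fin n → H)
    (hxy : ‖∑ i, InnerProductSpace.rankOne ℂ (y i) (x i)‖ ≤ 1) :
    ‖∑ i, inner ℂ (x i) (T.val (y i))‖ ≤ ‖T‖ := by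
  have hF : ‖∑ i, InnerProductSpace.rankOne ℂ (y i) (x i)‖ₑ ≤ 1 := by
    rw [← ofReal_norm]; exact ENNReal.ofReal_le_one.2 hxy
  rw [norm_def, ← toReal_enorm]
  exact ENNReal.toReal_mono T.traceNorm_lt_top.ne
    ((enorm_sum_inner_le T.val x y).trans (mul_le_of_le_one_left' hF))

instance : CompleteSpace (TraceClass H) := by
  refine Metric.complete_of_cauchySeq_tendsto fun u hu => ?_
  have hv : CauchySeq fun n => (u n).val := by
    refine Metric.cauchySeq_iff.2 fun ε hε => ?_
    obtain ⟨N, hN⟩ := Metric.cauchySeq_iff.1 hu ε hε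
    refine ⟨N, fun m hm n hn => lt_of_le_of_lt ?_ (hN m hm n hn)⟩
    rw [dist_eq_norm, dist_eq_norm, ← val_sub]
    exact norm_val_le _
  obtain ⟨T, hT⟩ := cauchySeq_tendsto_of_complete hv
  have key : ∀ ε > 0, ∃ N, ∀ n ≥ N, traceNorm (T - (u n).val) ≤ ENNReal.ofReal ε := by
    intro ε hε
    obtain ⟨N, hN⟩ := Metric.cauchySeq_iff.1 hu ε hε
    refine ⟨N, fun n hn => traceNorm_le_of _ _ fun k x y hxy => ?_⟩
    rw [← ofReal_norm]
    refine ENNReal.ofReal_le_ofReal ?_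
    have hlim : Filter.Tendsto (fun m => ‖∑ i, inner ℂ (x i) ((u m - u n).val (y i))‖)
        Filter.atTop (nhds ‖∑ i, inner ℂ (x i) ((T - (u n).val) (y i))‖) := by
      refine Filter.Tendsto.norm (tendsto_finsetSum _ fun i _ => ?_)
      refine Filter.Tendsto.inner tendsto_const_nhds ?_
      simp only [val_sub]
      exact (ContinuousLinearMap.apply ℂ H (y i)).continuous.tendsto _ |>.comp
        (hT.sub tendsto_const_nhds)
    refine le_of_tendsto hlim (Filter.eventually_atTop.2 ⟨N, fun m hm => ?_⟩)
    refine (norm_sum_inner_le _ x y hxy).trans ?_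
    rw [← dist_eq_norm]
    exact (hN m hm n hn).le
  have hfin : traceNorm T < ∞ := by
    obtain ⟨N, hN⟩ := key 1 one_pos
    have h := traceNorm_add_le (T - (u N).val) (u N).val
    rw [sub_add_cancel] at h
    exact h.trans_lt (ENNReal.add_lt_top.2
      ⟨(hN N le_rfl).trans_lt ENNReal.ofReal_lt_top, (u N).traceNorm_lt_top⟩)
  refine ⟨ofCLM T hfin, Metric.tendsto_atTop.2 fun ε hε => ?_⟩
  obtain ⟨N, hN⟩ := key (ε / 2) (by positivity)
  refine ⟨N, fun n hn => ?_⟩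
  rw [dist_comm, dist_eq_norm, norm_def, val_sub, val_ofCLM]
  refine lt_of_le_of_lt (ENNReal.toReal_mono ENNReal.ofReal_ne_top (hN n hn)) ?_
  rw [ENNReal.toReal_ofReal (by positivity)]
  linarith

/-- The bounded map `T ↦ B T C` between spaces of trace class operators. -/
def sandwich (B : H →L[ℂ] G) (C : G →L[ℂ] H) : TraceClass H →L[ℂ] TraceClass G :=
  LinearMap.mkContinuous
    { toFun := fun T => ofCLM (B ∘L T.val ∘L C) ((traceNorm_comp_le B T.val C).trans_lt
        (ENNReal.mul_lt_top (ENNReal.mul_lt_top (by simp) (by simp)) T.traceNorm_lt_top))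
      map_add' := fun S T => TraceClass.ext (by
        simp only [val_add, val_ofCLM, ContinuousLinearMap.add_comp, ContinuousLinearMap.comp_add])
      map_smul' := fun c T => TraceClass.ext (by
        simp only [val_smul, val_ofCLM, ContinuousLinearMap.smul_comp,
          ContinuousLinearMap.comp_smul, RingHom.id_apply]) }
    (‖B‖ * ‖C‖) (fun T => by
      rw [norm_def, norm_def, ← toReal_enorm, ← toReal_enorm, ← ENNReal.toReal_mul,
        ← ENNReal.toReal_mul]
      exact ENNReal.toReal_mono
        (ENNReal.mul_lt_top (ENNReal.mul_lt_top (by simp) (by simp)) T.traceNorm_lt_top).ne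
        (traceNorm_comp_le B T.val C))

theorem val_sandwich (B : H →L[ℂ] G) (C : G →L[ℂ] H) (T : TraceClass H) :
    (sandwich B C T).val = B ∘L T.val ∘L C := rfl

theorem sum_norm_inner_le (T : TraceClass H) (J : Finset (stdIndex H)) :
    ∑ j ∈ J, ‖inner ℂ (stdBasis H j) (T.val (stdBasis H j))‖ ≤ ‖T‖ := by
  let e : Fin J.card → H := fun i => stdBasis H (J.equivFin.symm i)
  have he : Orthonormal ℂ e := (stdBasis H).orthonormal.comp _
    (Subtype.val_injective.comp J.equivFin.symm.injective)
  have hph : ∀ z : ℂ, ∃ c : ℂ, ‖c‖ = 1 ∧ c * z = ‖z‖ := fun z => by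
    by_cases hz : z = 0
    · exact ⟨1, by simp [hz]⟩
    · have hz' : (‖z‖ : ℂ) ≠ 0 := by simpa using hz
      refine ⟨‖z‖ / z, by simp [hz], by field_simp⟩
  choose c hc1 hc2 using hph
  let w : Fin J.card → ℂ := fun i => c (inner ℂ (e i) (T.val (e i)))
  have hf : Orthonormal ℂ (fun i => w i • e i) := by
    constructor
    · intro i; rw [norm_smul, he.1 i, hc1, mul_one]
    · intro i j hij
      simp [inner_smul_left, inner_smul_right, he.2 hij]
  have h := norm_sum_inner_le T e (fun i => w i • e i) (norm_sum_rankOne_le hf he)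
  have h2 : ∑ i, inner ℂ (e i) (T.val (w i • e i))
      = ((∑ i, ‖inner ℂ (e i) (T.val (e i))‖ : ℝ) : ℂ) := by
    push_cast
    refine Finset.sum_congr rfl fun i _ => ?_
    rw [map_smul, inner_smul_right, hc2]
  rw [h2, Complex.norm_real, Real.norm_of_nonneg (Finset.sum_nonneg fun i _ => norm_nonneg _)] at h
  refine le_of_eq_of_le ?_ h
  rw [← Finset.sum_coe_sort J]
  exact (Equiv.sum_comp J.equivFin.symm (fun j : J =>
    ‖inner ℂ (stdBasis H j) (T.val (stdBasis H j))‖)).symm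

theorem summable_norm_inner (T : TraceClass H) :
    Summable fun j => ‖inner ℂ (stdBasis H j) (T.val (stdBasis H j))‖ :=
  summable_of_sum_le (fun _ => norm_nonneg _) T.sum_norm_inner_le

theorem summable_inner (T : TraceClass H) :
    Summable fun j => inner ℂ (stdBasis H j) (T.val (stdBasis H j)) :=
  T.summable_norm_inner.of_norm

/-- The trace `tr T = ∑ⱼ ⟨bⱼ, T bⱼ⟩`, a bounded functional on the trace class. -/
def trace : TraceClass H →L[ℂ] ℂ :=
  LinearMap.mkContinuous
    { toFun := fun T => ∑' j, inner ℂ (stdBasis H j) (T.val (stdBasis H j))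
      map_add' := fun S T => by
        simp only [val_add, add_apply, inner_add_right]
        exact S.summable_inner.tsum_add T.summable_inner
      map_smul' := fun c T => by
        simp only [val_smul, smul_apply, inner_smul_right, tsum_mul_left,
          RingHom.id_apply, smul_eq_mul] }
    1 (fun T => by
      rw [one_mul]
      exact (norm_tsum_le_tsum_norm T.summable_norm_inner).trans
        (T.summable_norm_inner.tsum_le_of_sum_le T.sum_norm_inner_le))

/-- The commutator `T ↦ X T - T X` with a bounded operator `X`. -/
def commutator (X : H →L[ℂ] H) : TraceClass H →L[ℂ] TraceClass H :=
  sandwich X 1 - sandwich 1 X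

end TraceClass

end TraceClass

/-! ### Matrices and maps on matrices

Matrices carry the operator norm induced by the Euclidean norm, and their usual Loewner order. -/

/-- The algebra `M_d` of complex `d × d` matrices. -/
abbrev Mat (d : ℕ) : Type := Matrix (Fin d) (Fin d) ℂ

/-- Linear maps on `M_d`, with their operator norm. -/
abbrev SuperOp (d : ℕ) : Type := Mat d →L[ℂ] Mat d

/-- The map `ρ ↦ A ρ B`. -/
def mulBoth {d : ℕ} (A B : Mat d) : SuperOp d := ContinuousLinearMap.mulLeftRight ℂ (Mat d) A B

/-- The derivation `[A, ·] : ρ ↦ A ρ - ρ A`. -/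
def adMap {d : ℕ} (A : Mat d) : SuperOp d := mulBoth A 1 - mulBoth 1 A

/-- The map `ρ ↦ A ρ B† - (1/2) {B† A, ρ}`. -/
def dissipator {d : ℕ} (A B : Mat d) : SuperOp d :=
  mulBoth A B.conjTranspose - (1 / 2 : ℂ) •
    (mulBoth (B.conjTranspose * A) 1 + mulBoth 1 (B.conjTranspose * A))

/-- Complete positivity of a map on `M_d`. -/
def IsCompletelyPositive {d : ℕ} (Φ : SuperOp d) : Prop :=
  ∃ Ψ : Mat d →CP Mat d, ∀ ρ, Ψ ρ = Φ ρ

/-- Trace preservation. -/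
def IsTracePreserving {d : ℕ} (Φ : SuperOp d) : Prop :=
  ∀ ρ, (Φ ρ).trace = ρ.trace

/-- CP-divisibility of a one-parameter family: there is a two-parameter family of completely
positive propagators, subject to the Chapman-Kolmogorov identities. -/
def IsCPDivisible {d : ℕ} (Λ : ℝ → SuperOp d) : Prop :=
  ∃ Φ : ℝ → ℝ → SuperOp d,
    (∀ t, 0 ≤ t → Φ t t = 1) ∧
    (∀ s u t, 0 ≤ s → s ≤ u → u ≤ t → Φ t u ∘L Φ u s = Φ t s) ∧
    ∀ s t, 0 ≤ s → s ≤ t → Λ t = Φ t s ∘L Λ s ∧ IsCompletelyPositive (Φ t s)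

/-- The standard (Gorini-Kossakowski-Lindblad-Sudarshan) form of a generator:
`L ρ = -i [H, ρ] + ∑ₐ (Vₐ ρ Vₐ† - (1/2) {Vₐ† Vₐ, ρ})` with `H` Hermitian. -/
def IsLindbladian {d : ℕ} (L : SuperOp d) : Prop :=
  ∃ (H : Mat d) (k : ℕ) (V : Fin k → Mat d), H.IsHermitian ∧
    L = (-Complex.I) • adMap H + ∑ a, dissipator (V a) (V a)

/-! ### Quasiperiodicity and reducibility -/

/-- The torus winding `t ↦ (Ω₁ t, …, Ω_r t)`. Angles are measured in full turns: the angle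
`θ ∈ ℝ / 2πℤ` corresponds to the point `θ / 2π` of `ℝ / ℤ`. -/
def winding {r : ℕ} (Ω : Fin r → ℝ) (t : ℝ) : UnitAddTorus (Fin r) :=
  fun j => ((Ω j * t / (2 * Real.pi) : ℝ) : UnitAddCircle)

/-- The number `n · Ω`. -/
def dotFreq {r : ℕ} (Ω : Fin r → ℝ) (n : Fin r → ℤ) : ℝ := ∑ j, (n j : ℝ) * Ω j

/-- Quasiperiodicity with frequency vector `Ω`: composition of a continuous function on the torus
with the winding. -/
def IsQuasiperiodic {r : ℕ} {X : Type*} [TopologicalSpace X] (Ω : Fin r → ℝ) (A : ℝ → X) : Prop :=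
  ∃ Ahat : UnitAddTorus (Fin r) → X, Continuous Ahat ∧ ∀ t, A t = Ahat (winding Ω t)

/-- `x` is a solution on `[0, ∞)` of the linear equation `x' = A_t x`. -/
def IsSolution {V : Type*} [NormedAddCommGroup V] [NormedSpace ℂ V]
    (A : ℝ → V →L[ℂ] V) (x : ℝ → V) : Prop :=
  ∀ t, 0 ≤ t → HasDerivWithinAt x (A t (x t)) (Set.Ici 0) t

/-- Lyapunov-Perron reducibility of `x' = A_t x`: a quasiperiodic linear invertible change of
variables `x = P_t y`, with `P_0 = I`, reduces it to an equation `y' = X y` with constant `X`. -/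
def IsReducible {r : ℕ} {V : Type*} [NormedAddCommGroup V] [NormedSpace ℂ V]
    (Ω : Fin r → ℝ) (A : ℝ → V →L[ℂ] V) : Prop :=
  ∃ (P : ℝ → V →L[ℂ] V) (X : V →L[ℂ] V),
    IsQuasiperiodic Ω P ∧ P 0 = 1 ∧ (∀ t, IsUnit (P t)) ∧
    ∀ y : ℝ → V, IsSolution (fun _ => X) y ↔ IsSolution A (fun t => P t (y t))

/-! ### The compound system -/

section Compound

variable {d : ℕ} {E : Type*} [NormedAddCommGroup E] [InnerProductSpace ℂ E] [CompleteSpace E]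

/-- The Hilbert space `ℂ^d ⊗ E`, as the Hilbert sum of `d` copies of `E`: the vector `e_i ⊗ x`
is `x` in the `i`-th summand. -/
abbrev Compound (d : ℕ) (E : Type*) [NormedAddCommGroup E] [InnerProductSpace ℂ E] : Type _ :=
  PiLp 2 (fun _ : Fin d => E)

/-- The isometry `x ↦ e_i ⊗ x`. -/
def incl (i : Fin d) : E →L[ℂ] Compound d E :=
  (PiLp.continuousLinearEquiv 2 ℂ (fun _ : Fin d => E)).symm.toContinuousLinearMap ∘L
    ContinuousLinearMap.single ℂ (fun _ : Fin d => E) i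

/-- The adjoint of `x ↦ e_i ⊗ x`. -/
def comp (i : Fin d) : Compound d E →L[ℂ] E := PiLp.proj 2 (fun _ : Fin d => E) i

/-- The bounded operator `S ⊗ R` on `ℂ^d ⊗ E`. -/
def tensorOp (S : Mat d) (R : E →L[ℂ] E) : Compound d E →L[ℂ] Compound d E :=
  ∑ i, ∑ j, S i j • (incl i ∘L R ∘L comp j)

/-- The map `ρ ↦ ρ ⊗ T` into the trace class of `ℂ^d ⊗ E`, for `T` of trace class on `E`. -/
def tensorState (T : TraceClass E) : Mat d →L[ℂ] TraceClass (Compound d E) :=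
  LinearMap.toContinuousLinearMap
    (∑ i, ∑ j, (Matrix.entryLinearMap ℂ ℂ i j).smulRight
      (TraceClass.sandwich (incl i) (comp j) T))

/-- The partial trace over `E`: its `(i, j)` entry is the trace of the `(i, j)` block. -/
def partialTrace : TraceClass (Compound d E) →L[ℂ] Mat d :=
  ∑ i, ∑ j, (TraceClass.trace ∘L TraceClass.sandwich (comp i) (incl j)).smulRight
    (Matrix.single i j (1 : ℂ))

end Compound

/-! ### The model -/

/-- The data of the model: a `d`-dimensional system with quasiperiodic Hamiltonian, coupled to an
environment with Hilbert space `E`. -/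
structure OpenSystem (r d m : ℕ) (E : Type*) [NormedAddCommGroup E] [InnerProductSpace ℂ E]
    [CompleteSpace E] where
  /-- the vector of frequencies -/
  Ω : Fin r → ℝ
  /-- the function on the torus which gives the system Hamiltonian -/
  Hhat : UnitAddTorus (Fin r) → Mat d
  /-- the function on the torus which gives the quasiperiodic factor of the unitary evolution -/
  phat : UnitAddTorus (Fin r) → Mat d
  /-- the averaged Hamiltonian -/
  Hbar : Mat d
  /-- the averaged Hamiltonian is Hermitian -/
  hermitian_Hbar : Hbar.IsHermitian
  /-- the Hamiltonian of the environment -/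
  HE : E →L[ℂ] E
  /-- the constant state of the environment -/
  ωE : TraceClass E
  /-- the system parts of the interaction -/
  S : Fin m → Mat d
  /-- the environment parts of the interaction -/
  R : Fin m → E →L[ℂ] E

namespace OpenSystem

section

variable {r d m : ℕ} {E : Type*} [NormedAddCommGroup E] [InnerProductSpace ℂ E] [CompleteSpace E]
variable (M : OpenSystem r d m E)

/-- The system Hamiltonian `H_t`. -/
def H (t : ℝ) : Mat d := M.Hhat (winding M.Ω t)

/-- The quasiperiodic factor `p_t`. -/
def p (t : ℝ) : Mat d := M.phat (winding M.Ω t)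

/-- The evolution operator `u_t = p_t e^{-i t H̄}` of the Schroedinger equation. -/
def u (t : ℝ) : Mat d := M.p t * NormedSpace.exp ((-(Complex.I * t)) • M.Hbar)

/-- The unitary group `e^{-i t H_E}` of the environment. -/
def envU (t : ℝ) : E →L[ℂ] E := NormedSpace.exp ((-(Complex.I * t)) • M.HE)

/-- The interaction Hamiltonian `∑ S_μ ⊗ R_μ`. -/
def Hint : Compound d E →L[ℂ] Compound d E := ∑ μ, tensorOp (M.S μ) (M.R μ)

/-- The free Hamiltonian `H_t ⊗ I + I ⊗ H_E`. -/
def Hfree (t : ℝ) : Compound d E →L[ℂ] Compound d E :=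
  tensorOp (M.H t) 1 + tensorOp 1 M.HE

/-- The auto-correlation functions
`f_{μν}(t) = tr (e^{i t H_E} R_μ† e^{-i t H_E} R_ν ω_E)`. -/
def f (μ ν : Fin m) (t : ℝ) : ℂ :=
  TraceClass.trace (TraceClass.sandwich
    (M.envU (-t) ∘L ContinuousLinearMap.adjoint (M.R μ) ∘L M.envU t ∘L M.R ν) 1 M.ωE)

/-- The quasienergies, i.e. the eigenvalues of `H̄`, with multiplicity. -/
def ε (k : Fin d) : ℝ := M.hermitian_Hbar.eigenvalues k

/-- Mutually orthogonal rank one spectral projections, `H̄ = ∑ ε_k P_k`. -/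
def spectralProj (k : Fin d) : Mat d :=
  (M.hermitian_Hbar.eigenvectorUnitary : Mat d) * Matrix.single k k 1 *
    (M.hermitian_Hbar.eigenvectorUnitary : Mat d).conjTranspose

/-- The Bohr quasi-frequencies, i.e. the spectrum of `[H̄, ·]`. -/
def bohr : Finset ℝ := Finset.univ.image fun kl : Fin d × Fin d => M.ε kl.1 - M.ε kl.2

/-- The standing assumptions of the model. -/
structure Assumptions : Prop where
  /-- frequencies are positive -/
  freq_pos : ∀ j, 0 < M.Ω j
  /-- frequencies are rationally independent -/
  freq_indep : ∀ n : Fin r → ℤ, dotFreq M.Ω n = 0 → n = 0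
  /-- the system Hamiltonian is quasiperiodic -/
  continuous_Hhat : Continuous M.Hhat
  /-- the system Hamiltonian is Hermitian -/
  hermitian_H : ∀ t, (M.H t).IsHermitian
  /-- `p_t` is quasiperiodic -/
  continuous_phat : Continuous M.phat
  /-- `p_t` is unitary -/
  unitary_p : ∀ t, M.p t ∈ Matrix.unitaryGroup (Fin d) ℂ
  /-- `p_0 = I` -/
  p_zero : M.p 0 = 1
  /-- reducibility of the Schroedinger equation: `u_t = p_t e^{-i t H̄}` solves it -/
  schroedinger : ∀ t, 0 ≤ t → HasDerivWithinAt M.u ((-Complex.I) • (M.H t * M.u t)) (Set.Ici 0) t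
  /-- two Bohr quasi-frequencies never differ by `n · Ω` with `n ≠ 0` -/
  congruence_free : ∀ w₁ ∈ M.bohr, ∀ w₂ ∈ M.bohr, ∀ n : Fin r → ℤ,
    w₁ - w₂ = dotFreq M.Ω n → n = 0
  /-- the environment Hamiltonian is self-adjoint -/
  selfAdjoint_HE : IsSelfAdjoint M.HE
  /-- `ω_E` is a density operator -/
  positive_ωE : M.ωE.val.IsPositive
  /-- `ω_E` is a density operator -/
  trace_ωE : TraceClass.trace M.ωE = 1
  /-- `ω_E` is stationary -/
  commute_ωE : Commute M.HE M.ωE.val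
  /-- the interaction Hamiltonian is self-adjoint -/
  selfAdjoint_Hint : IsSelfAdjoint M.Hint
  /-- `tr (ω_E R_μ) = 0` -/
  mean_zero : ∀ μ, TraceClass.trace (TraceClass.sandwich 1 (M.R μ) M.ωE) = 0
  /-- the auto-correlation functions are integrable on the half-line -/
  integrable_f : ∀ μ ν, MeasureTheory.IntegrableOn (M.f μ ν) (Set.Ioi 0)

/-! #### The weak coupling limit -/

/-- The projection `𝒫₀ a = (tr_E a) ⊗ ω_E`. -/
def P₀ : TraceClass (Compound d E) →L[ℂ] TraceClass (Compound d E) :=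
  tensorState M.ωE ∘L partialTrace

/-- The complementary projection `𝒫₁ = id - 𝒫₀`. -/
def P₁ : TraceClass (Compound d E) →L[ℂ] TraceClass (Compound d E) := 1 - M.P₀

/-- The derivation `Z_t = -i [H_t ⊗ I + I ⊗ H_E, ·]`. -/
def Z (t : ℝ) : TraceClass (Compound d E) →L[ℂ] TraceClass (Compound d E) :=
  (-Complex.I) • TraceClass.commutator (M.Hfree t)

/-- The derivation `A = -i [H_int, ·]`. -/
def A : TraceClass (Compound d E) →L[ℂ] TraceClass (Compound d E) :=
  (-Complex.I) • TraceClass.commutator M.Hint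

/-- `A₀₁ = 𝒫₀ A 𝒫₁`. -/
def A₀₁ : TraceClass (Compound d E) →L[ℂ] TraceClass (Compound d E) := M.P₀ ∘L M.A ∘L M.P₁

/-- `A₁₀ = 𝒫₁ A 𝒫₀`. -/
def A₁₀ : TraceClass (Compound d E) →L[ℂ] TraceClass (Compound d E) := M.P₁ ∘L M.A ∘L M.P₀

/-- `P_t a = (p_t ⊗ I) a (p_t† ⊗ I)`. -/
def P (t : ℝ) : TraceClass (Compound d E) →L[ℂ] TraceClass (Compound d E) :=
  TraceClass.sandwich (tensorOp (M.p t) 1) (tensorOp (M.p t).conjTranspose 1)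

/-- `Z̄ = -i [H̄ ⊗ I + I ⊗ H_E, ·]`. -/
def Zbar : TraceClass (Compound d E) →L[ℂ] TraceClass (Compound d E) :=
  (-Complex.I) • TraceClass.commutator (tensorOp M.Hbar 1 + tensorOp 1 M.HE)

/-- The free evolution `U_t = P_t e^{t Z̄}`, at all real times. -/
def U (t : ℝ) : TraceClass (Compound d E) →L[ℂ] TraceClass (Compound d E) :=
  M.P t ∘L NormedSpace.exp ((t : ℂ) • M.Zbar)

/-- The free propagator `U_{t,s} = U_t U_s⁻¹`. -/
def Uprop (t s : ℝ) : TraceClass (Compound d E) →L[ℂ] TraceClass (Compound d E) :=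
  M.U t ∘L (M.U s).inverse

/-- The integrand `x ↦ U_{x+s,s}⁻¹ A₀₁ U_{x+s,s} A₁₀`. -/
def kernel (s x : ℝ) : TraceClass (Compound d E) →L[ℂ] TraceClass (Compound d E) :=
  (M.Uprop (x + s) s).inverse ∘L M.A₀₁ ∘L M.Uprop (x + s) s ∘L M.A₁₀

/-- `K̃^λ_t = ∫₀^∞ U_{x+t/λ²,t/λ²}⁻¹ A₀₁ U_{x+t/λ²,t/λ²} A₁₀ dx`. -/
def Ktilde (lam t : ℝ) : TraceClass (Compound d E) →L[ℂ] TraceClass (Compound d E) :=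
  ∫ x in Set.Ioi (0 : ℝ), M.kernel (lam⁻¹ ^ 2 * t) x

/-- The function `t ↦ U_{t/λ²}⁻¹ K̃^λ_t U_{t/λ²}`, to be averaged over time. -/
def rotated (lam t : ℝ) : TraceClass (Compound d E) →L[ℂ] TraceClass (Compound d E) :=
  (M.U (lam⁻¹ ^ 2 * t)).inverse ∘L M.Ktilde lam t ∘L M.U (lam⁻¹ ^ 2 * t)

/-- `K` is the local average of `t ↦ K̃^λ_t`, for every `λ > 0`: all integrals converge and
`(2δ)⁻¹ ∫_{-δ}^{δ} U_{t/λ²}⁻¹ K̃^λ_t U_{t/λ²} dt → K` as `δ → ∞`. -/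
def IsLocalAverage (K : TraceClass (Compound d E) →L[ℂ] TraceClass (Compound d E)) : Prop :=
  ∀ lam : ℝ, 0 < lam →
    (∀ t, MeasureTheory.IntegrableOn (M.kernel (lam⁻¹ ^ 2 * t)) (Set.Ioi 0)) ∧
    (∀ δ : ℝ, IntervalIntegrable (M.rotated lam) MeasureTheory.volume (-δ) δ) ∧
    Filter.Tendsto (fun δ : ℝ => (2 * δ)⁻¹ • ∫ t in (-δ)..δ, M.rotated lam t)
      Filter.atTop (nhds K)

/-- `W` is a solution, continuous in time, of the integral equation
`W_t = 𝒫₀ U_t + ∫₀^t U_t K U_s⁻¹ W_s ds` on `[0, ∞)`. -/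
def IsReducedEvolution (K : TraceClass (Compound d E) →L[ℂ] TraceClass (Compound d E))
    (W : ℝ → TraceClass (Compound d E) →L[ℂ] TraceClass (Compound d E)) : Prop :=
  ContinuousOn W (Set.Ici 0) ∧
    ∀ t, 0 ≤ t → W t = M.P₀ ∘L M.U t +
      ∫ s in (0 : ℝ)..t, M.U t ∘L K ∘L (M.U s).inverse ∘L W s

/-- `Λ` is the reduced dynamics on `M_d` in the weak coupling limit:
`W_t v₀ = Λ_t ρ₀ ⊗ ω_E` whenever `ρ₀ ⊗ ω_E = 𝒫₀ v₀`. -/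
def IsReducedDynamics (Λ : ℝ → SuperOp d) : Prop :=
  ∃ K W, M.IsLocalAverage K ∧ M.IsReducedEvolution K W ∧
    ∀ t, 0 ≤ t → ∀ v₀ ρ₀, tensorState M.ωE ρ₀ = M.P₀ v₀ →
      W t v₀ = tensorState M.ωE (Λ t ρ₀)

/-! #### The generators -/

/-- One-sided Fourier transform `∫₀^∞ f_{μν}(x) e^{-iwx} dx`. -/
def halfFourier (μ ν : Fin m) (w : ℝ) : ℂ :=
  ∫ x in Set.Ioi (0 : ℝ), M.f μ ν x * Complex.exp (-(Complex.I * w * x))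

/-- Two-sided Fourier transform `h_{μν}(w) = ∫ f_{μν}(x) e^{-iwx} dx`. -/
def h (μ ν : Fin m) (w : ℝ) : ℂ := ∫ x : ℝ, M.f μ ν x * Complex.exp (-(Complex.I * w * x))

/-- `ζ_{μν}`, defined by `∫₀^∞ f_{μν}(x) e^{-iwx} dx = h_{μν}(w) / 2 + i ζ_{μν}(w)`. -/
def ζ (μ ν : Fin m) (w : ℝ) : ℂ := (M.halfFourier μ ν w - M.h μ ν w / 2) / Complex.I

/-- Fourier coefficients of the quasiperiodic function `t ↦ p_t† S_μ p_t`. -/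
def Shat (μ : Fin m) (n : Fin r → ℤ) : Mat d :=
  UnitAddTorus.mFourierCoeff (fun θ => (M.phat θ).conjTranspose * M.S μ * M.phat θ) n

/-- `S_{μ n w} = ∑ P_k Ŝ_{μ,n} P_l`, the sum being over the pairs with `ε_k - ε_l = w`. -/
def Scomp (μ : Fin m) (n : Fin r → ℤ) (w : ℝ) : Mat d :=
  ∑ k, ∑ l, if M.ε k - M.ε l = w then M.spectralProj k * M.Shat μ n * M.spectralProj l else 0

/-- The `n`-th term of the series for `ΔH`, for given `μ`, `ν`. -/
def lambTerm (μ ν : Fin m) (n : Fin r → ℤ) : Mat d :=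
  ∑ w ∈ M.bohr, M.ζ μ ν (w + dotFreq M.Ω n) •
    ((M.Scomp μ n w).conjTranspose * M.Scomp ν n w)

/-- The Hamiltonian correction `ΔH`. -/
def ΔH : Mat d := ∑ μ, ∑ ν, ∑' n, M.lambTerm μ ν n

/-- The `n`-th term of the series for `D̄`, for given `μ`, `ν`. -/
def dissTerm (μ ν : Fin m) (n : Fin r → ℤ) : SuperOp d :=
  ∑ w ∈ M.bohr, M.h μ ν (w + dotFreq M.Ω n) • dissipator (M.Scomp ν n w) (M.Scomp μ n w)

/-- The dissipative part `D̄`. -/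
def Dbar : SuperOp d := ∑ μ, ∑ ν, ∑' n, M.dissTerm μ ν n

/-- `X = -i [H̄ + ΔH, ·] + D̄`. -/
def X : SuperOp d := (-Complex.I) • adMap (M.Hbar + M.ΔH) + M.Dbar

/-- `Σ_t ρ = p_t ρ p_t†`. -/
def Sigma (t : ℝ) : SuperOp d := mulBoth (M.p t) (M.p t).conjTranspose

/-- `L_t = -i [H_t + Σ_t (ΔH), ·] + Σ_t D̄ Σ_t⁻¹`. -/
def L (t : ℝ) : SuperOp d :=
  (-Complex.I) • adMap (M.H t + M.Sigma t M.ΔH) + M.Sigma t ∘L M.Dbar ∘L (M.Sigma t).inverse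

end

end OpenSystem

end OpenQuantum

end

/-!
The reduced dynamics can be computed in closed form. The free evolution `U_t` is conjugation by the
unitary `w_t = u_t ⊗ e^{-itH_E}` (`OpenSystem.U_eq`), so it commutes with `𝒫₀`, which is a
projection onto the states `ρ ⊗ ω_E`, which `partialTrace` identifies with `M_d`. In the
interaction picture the memory kernel `U_s⁻¹ (…) U_s` is therefore the lift of a map `systemKernel
s x` on `M_d` (`OpenSystem.kernel_eq`); as `tr(ω_E R_μ) = 0`, the projection `𝒫₁` in the middle
drops out. Expanding the double commutator gives `systemKernel s x = Φ + Φ*`, with `Φ* ρ = Φ(ρ†)†`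
and `Φ` bilinear in the operators `S_ν(s)` and `S_μ(x + s)†`, where `S_μ(t) = u_t† S_μ u_t`, with
the weight `f_{μν}(x)` (`OpenSystem.systemKernel_eq`).

The operators `S_μ(s)` are finite sums of terms `e^{iωs} G_ω(Ω s)`, with `ω` a Bohr quasi-frequency
and `G_ω` continuous on the torus (`OpenSystem.Sint_eq`). Weyl equidistribution, twisted by a
character of the line (`hasMean_exp_mul_comp_winding`), and Parseval's identity on the torus
compute the time average of the correlations (`exists_hasMean_correlation`): as the Bohr
quasi-frequencies do not resonate with `Ω`, only equal frequencies survive, and the average is a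
convergent sum over the Fourier modes `n` of one-sided Fourier transforms of `f_{μν}` at `ω + n ·
Ω`. Writing these as `h/2 + iζ` gives the generator `-i[ΔH, ·] + D̄`
(`OpenSystem.hasMean_systemKernel`). The convergence of the series for `ΔH` and `D̄` is a
by-product of Parseval's identity.

The integral equation for `W_t` becomes one with constant coefficients in the interaction picture,
and its only solution is `U_t e^{tK} 𝒫₀` (`eq_mul_exp_mul_of_integral_eq`). Hence `Λ_t ρ = u_t
(e^{t(-i[ΔH, ·] + D̄)} ρ) u_t†`. As `ΔH` and `D̄` commute with `[H̄, ·]`, this is `Σ_t e^{tX}`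
(`OpenSystem.reducedDynamics_eq`), from which the master equation and reducibility follow by
differentiating `Σ_t`.

For positivity, the matrices `[h_{μν}(ω)]` are positive semidefinite by the easy half of Bochner's
theorem (`OpenSystem.posSemidef_h`), so the Choi matrix of `ρ ↦ ∑ h S_ν ρ S_μ†` is positive
semidefinite, and a Kraus decomposition of this map turns `D̄` into a finite sum of dissipators
(`OpenSystem.exists_Dbar_eq`). A generator in standard form generates a completely positive trace
preserving semigroup (`IsLindbladian.isCompletelyPositive_exp`), whence `Λ_t` and the propagators
`Σ_t e^{(t-s)X} Σ_s⁻¹` are completely positive. Finally, `Λ_t` is bounded, being completely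
positive and trace preserving, and so is `L_t`, being quasiperiodic; so `Λ` has a bounded
derivative and is uniformly continuous.
-/

noncomputable section

namespace OpenQuantum

/-! ### The trace of trace class operators -/

section

/-- Parseval's identity with values in `[0, ∞]`. -/
theorem ofReal_norm_sq_eq_tsum {H : Type*} [NormedAddCommGroup H] [InnerProductSpace ℂ H]
    {ι : Type*} (b : HilbertBasis ι ℂ H) (v : H) :
    ENNReal.ofReal (‖v‖ ^ 2) = ∑' i, ENNReal.ofReal (‖inner ℂ (b i) v‖ ^ 2) := by
  have h := b.hasSum_inner_mul_inner v v
  have h' : HasSum (fun i => ‖inner ℂ (b i) v‖ ^ 2) (‖v‖ ^ 2) := by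
    rw [inner_self_eq_norm_sq_to_K] at h
    have h2 : ∀ i, inner ℂ v (b i) * inner ℂ (b i) v = ((‖inner ℂ (b i) v‖ ^ 2 : ℝ) : ℂ) := by
      intro i
      rw [← inner_conj_symm, Complex.conj_mul']
      norm_cast
    simp only [h2] at h
    have h3 : ((‖v‖ : ℝ) : ℂ) ^ 2 = ((‖v‖ ^ 2 : ℝ) : ℂ) := by norm_cast
    exact Complex.hasSum_ofReal.1 (by rw [← h3]; exact h)
  rw [← h'.tsum_eq, ENNReal.ofReal_tsum_of_nonneg (fun i => by positivity) h'.summable]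

variable {H : Type*} [NormedAddCommGroup H] [InnerProductSpace ℂ H] [CompleteSpace H]

/-- For a positive operator the sum of the diagonal matrix elements, with values in `[0, ∞]`, does
not depend on the orthonormal basis. -/
theorem tsum_ofReal_inner_eq {ι κ : Type*} (b : HilbertBasis ι ℂ H) (c : HilbertBasis κ ℂ H)
    {T : H →L[ℂ] H} (hT : 0 ≤ T) :
    ∑' i, ENNReal.ofReal (inner ℂ (b i) (T (b i))).re =
      ∑' k, ENNReal.ofReal (inner ℂ (c k) (T (c k))).re := by
  set S := CFC.sqrt T with hS
  have hSS : S * S = T := CFC.sqrt_mul_sqrt_self T hT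
  have hSa : ∀ u v : H, inner ℂ (S u) v = inner ℂ u (S v) :=
    fun u v => ((CFC.sqrt_nonneg T).isSelfAdjoint.isSymmetric u v)
  have hdiag : ∀ u : H, (inner ℂ u (T u)).re = ‖S u‖ ^ 2 := by
    intro u
    rw [← hSS, mul_apply_eq_comp, ← hSa, inner_self_eq_norm_sq_to_K]
    norm_cast
  simp_rw [hdiag]
  simp_rw [ofReal_norm_sq_eq_tsum c (S _)]
  rw [ENNReal.tsum_comm]
  refine tsum_congr fun k => ?_
  rw [← ofReal_norm_sq_eq_tsum c, ofReal_norm_sq_eq_tsum b]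
  refine tsum_congr fun i => ?_
  rw [← hSa, ← inner_conj_symm, Complex.norm_conj]

theorem traceNorm_of_nonneg {T : H →L[ℂ] H} (hT : 0 ≤ T) :
    traceNorm T = ∑' i, ENNReal.ofReal (inner ℂ (stdBasis H i) (T (stdBasis H i))).re := by
  rw [traceNorm, CFC.abs_of_nonneg T hT]

theorem traceNorm_mono {S T : H →L[ℂ] H} (hS : 0 ≤ S) (hST : S ≤ T) :
    traceNorm S ≤ traceNorm T := by
  rw [traceNorm_of_nonneg hS, traceNorm_of_nonneg (hS.trans hST)]
  refine ENNReal.tsum_le_tsum fun i => ENNReal.ofReal_le_ofReal ?_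
  have h := ((ContinuousLinearMap.nonneg_iff_isPositive _).1 (sub_nonneg.2 hST)
    ).re_inner_nonneg_right (stdBasis H i)
  rw [sub_apply, inner_sub_right] at h
  simpa using h

theorem traceNorm_abs (T : H →L[ℂ] H) : traceNorm (CFC.abs T) = traceNorm T := by
  rw [traceNorm_of_nonneg (CFC.abs_nonneg T), traceNorm]

theorem traceNorm_star_le (T : H →L[ℂ] H) : traceNorm (star T) ≤ traceNorm T := by
  refine traceNorm_le_of _ _ fun n x y hxy => ?_
  have e : ∑ i, inner ℂ (x i) (star T (y i)) = starRingEnd ℂ (∑ i, inner ℂ (y i) (T (x i))) := by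
    rw [map_sum]
    refine Finset.sum_congr rfl fun i _ => ?_
    rw [ContinuousLinearMap.star_eq_adjoint, ContinuousLinearMap.adjoint_inner_right,
      inner_conj_symm]
  have e2 : ∑ i, InnerProductSpace.rankOne ℂ (x i) (y i)
      = star (∑ i, InnerProductSpace.rankOne ℂ (y i) (x i)) := by
    rw [star_sum]
    refine Finset.sum_congr rfl fun i _ => ?_
    rw [ContinuousLinearMap.star_eq_adjoint, InnerProductSpace.adjoint_rankOne]
  have h1 : ‖∑ i, inner ℂ (x i) (star T (y i))‖ₑ = ‖∑ i, inner ℂ (y i) (T (x i))‖ₑ := by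
    rw [e, ← ofReal_norm, ← ofReal_norm, Complex.norm_conj]
  rw [h1]
  refine (enorm_sum_inner_le T y x).trans (mul_le_of_le_one_left' ?_)
  rw [← ofReal_norm, e2, norm_star]
  exact ENNReal.ofReal_le_one.2 hxy

namespace TraceClass

/-- The adjoint of a trace class operator. -/
def adj (T : TraceClass H) : TraceClass H :=
  ofCLM (star T.val) ((traceNorm_star_le _).trans_lt T.traceNorm_lt_top)

theorem val_adj (T : TraceClass H) : T.adj.val = star T.val := rfl

theorem trace_apply (T : TraceClass H) :
    trace T = ∑' j, inner ℂ (stdBasis H j) (T.val (stdBasis H j)) := rfl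

theorem trace_adj (T : TraceClass H) : trace T.adj = starRingEnd ℂ (trace T) := by
  rw [trace_apply, trace_apply, Complex.conj_tsum]
  refine tsum_congr fun j => ?_
  rw [val_adj, ContinuousLinearMap.star_eq_adjoint, ContinuousLinearMap.adjoint_inner_right,
    inner_conj_symm]

theorem trace_nonneg {T : TraceClass H} (hT : 0 ≤ T.val) : 0 ≤ trace T := by
  rw [trace_apply]
  exact tsum_nonneg fun j =>
    ((ContinuousLinearMap.nonneg_iff_isPositive _).1 hT).inner_nonneg_right _

theorem traceNorm_posPart_le {T : H →L[ℂ] H} (hT : IsSelfAdjoint T) :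
    traceNorm T⁺ ≤ traceNorm T := by
  rw [← traceNorm_abs T, ← CFC.posPart_add_negPart T hT]
  exact traceNorm_mono (CFC.posPart_nonneg T) (le_add_of_nonneg_right (CFC.negPart_nonneg T))

theorem traceNorm_negPart_le {T : H →L[ℂ] H} (hT : IsSelfAdjoint T) :
    traceNorm T⁻ ≤ traceNorm T := by
  rw [← traceNorm_abs T, ← CFC.posPart_add_negPart T hT]
  exact traceNorm_mono (CFC.negPart_nonneg T) (le_add_of_nonneg_left (CFC.posPart_nonneg T))

/-- The positive and negative parts of a self-adjoint trace class operator are of trace class. -/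
theorem exists_eq_sub_of_isSelfAdjoint (T : TraceClass H) (hT : IsSelfAdjoint T.val) :
    ∃ a b : TraceClass H, 0 ≤ a.val ∧ 0 ≤ b.val ∧ T = a - b := by
  refine ⟨ofCLM T.val⁺ ((traceNorm_posPart_le hT).trans_lt T.traceNorm_lt_top),
    ofCLM T.val⁻ ((traceNorm_negPart_le hT).trans_lt T.traceNorm_lt_top),
    CFC.posPart_nonneg T.val, CFC.negPart_nonneg T.val, ext ?_⟩
  rw [val_sub, val_ofCLM, val_ofCLM, CFC.posPart_sub_negPart T.val hT]

/-- Trace class operators are combinations of positive ones. -/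
theorem exists_nonneg_decomposition (T : TraceClass H) :
    ∃ a b c e : TraceClass H, 0 ≤ a.val ∧ 0 ≤ b.val ∧ 0 ≤ c.val ∧ 0 ≤ e.val ∧
      T = a - b + Complex.I • (c - e) := by
  obtain ⟨a, b, ha, hb, hab⟩ := exists_eq_sub_of_isSelfAdjoint ((1 / 2 : ℂ) • (T + T.adj)) (by
    rw [val_smul, val_add, val_adj, isSelfAdjoint_iff, star_smul, star_add, star_star,
      add_comm T.val]
    simp)
  obtain ⟨c, e, hc, he, hce⟩ := exists_eq_sub_of_isSelfAdjoint
    ((-Complex.I / 2 : ℂ) • (T - T.adj)) (by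
    rw [val_smul, val_sub, val_adj, isSelfAdjoint_iff, star_smul, star_sub, star_star,
      ← neg_sub T.val, smul_neg, ← neg_smul]
    simp [neg_div])
  refine ⟨a, b, c, e, ha, hb, hc, he, ?_⟩
  rw [← hab, ← hce]
  have : Complex.I * (-Complex.I / 2) = 1 / 2 := by
    linear_combination (-1 / 2 : ℂ) * Complex.I_mul_I
  rw [smul_smul, this, ← smul_add, add_add_sub_cancel, ← two_smul ℂ T, smul_smul]
  norm_num

/-- The trace is unitarily invariant, as the trace of a positive operator does not depend on the
orthonormal basis. -/
theorem trace_unitary_conj {V : H →L[ℂ] H} (hV : V ∈ unitary (H →L[ℂ] H)) (T : TraceClass H) :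
    trace (sandwich (star V) V T) = trace T := by
  have pos : ∀ S : TraceClass H, 0 ≤ S.val → trace (sandwich (star V) V S) = trace S := by
    intro S hS
    have hS' : 0 ≤ (sandwich (star V) V S).val := by
      rw [val_sandwich]
      exact star_left_conjugate_nonneg hS V
    have tr : ∀ R : TraceClass H, 0 ≤ R.val → trace R = ((∑' i, ENNReal.ofReal
        (inner ℂ (stdBasis H i) (R.val (stdBasis H i))).re).toReal : ℂ) := by
      intro R hR
      have hpos := fun z => ((ContinuousLinearMap.nonneg_iff_isPositive _).1 hR).inner_nonneg_right z
      rw [ENNReal.tsum_toReal_eq (fun _ => ENNReal.ofReal_ne_top), Complex.ofReal_tsum, trace_apply]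
      refine tsum_congr fun j => ?_
      rw [ENNReal.toReal_ofReal (Complex.le_def.1 (hpos _)).1]
      exact Complex.ext rfl (Complex.le_def.1 (hpos _)).2.symm
    rw [tr _ hS', tr _ hS]
    congr 2
    let Vu : H ≃ₗᵢ[ℂ] H := Unitary.linearIsometryEquiv ⟨V, hV⟩
    -- the standard basis, moved by `V`
    let c : HilbertBasis (stdIndex H) ℂ H := ⟨Vu.symm.trans (stdBasis H).repr⟩
    classical
    have hc : ∀ i, c i = V (stdBasis H i) := by
      intro i
      rw [← c.repr_symm_single, ← (stdBasis H).repr_symm_single]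
      rfl
    rw [← tsum_ofReal_inner_eq c (stdBasis H) hS]
    refine tsum_congr fun i => ?_
    rw [hc, val_sandwich]
    change ENNReal.ofReal (inner ℂ (stdBasis H i) (star V (S.val (V (stdBasis H i))))).re = _
    rw [ContinuousLinearMap.star_eq_adjoint, ContinuousLinearMap.adjoint_inner_right]
  obtain ⟨a, b, c, e, ha, hb, hc, he, rfl⟩ := T.exists_nonneg_decomposition
  simp only [map_add, map_sub, map_smul, pos _ ha, pos _ hb, pos _ hc, pos _ he]

theorem sandwich_sandwich {G F : Type*} [NormedAddCommGroup G] [InnerProductSpace ℂ G]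
    [CompleteSpace G] [NormedAddCommGroup F] [InnerProductSpace ℂ F] [CompleteSpace F]
    (B : H →L[ℂ] G) (C : G →L[ℂ] H) (B' : G →L[ℂ] F) (C' : F →L[ℂ] G) (T : TraceClass H) :
    sandwich B' C' (sandwich B C T) = sandwich (B' ∘L B) (C ∘L C') T := ext (by
  simp only [val_sandwich, ContinuousLinearMap.comp_assoc])

/-- The trace is cyclic: every bounded operator is a combination of unitaries. -/
theorem trace_comm (B : H →L[ℂ] H) (T : TraceClass H) :
    trace (sandwich B 1 T) = trace (sandwich 1 B T) := by
  have hB : B ∈ Submodule.span ℂ (unitary (H →L[ℂ] H) : Set (H →L[ℂ] H)) := by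
    rw [CStarAlgebra.span_unitary]; trivial
  induction hB using Submodule.span_induction with
  | mem V hV =>
    rw [← trace_unitary_conj hV (sandwich V 1 T), sandwich_sandwich]
    change trace (sandwich (star V * V) (1 * V) T) = _
    rw [(Unitary.mem_iff.1 hV).1, one_mul]
  | zero => congr 1; exact ext (by simp [val_sandwich])
  | add X Y _ _ hX hY =>
    have e1 : sandwich (X + Y) 1 T = sandwich X 1 T + sandwich Y 1 T :=
      ext (by simp [val_sandwich, val_add])
    have e2 : sandwich 1 (X + Y) T = sandwich 1 X T + sandwich 1 Y T :=
      ext (by simp [val_sandwich, val_add])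
    rw [e1, e2, map_add, map_add, hX, hY]
  | smul z X _ hX =>
    have e1 : sandwich (z • X) 1 T = z • sandwich X 1 T :=
      ext (by simp [val_sandwich, val_smul])
    have e2 : sandwich 1 (z • X) T = z • sandwich 1 X T :=
      ext (by simp [val_sandwich, val_smul])
    rw [e1, e2, map_smul, map_smul, hX]

theorem trace_sandwich (B C : H →L[ℂ] H) (T : TraceClass H) :
    trace (sandwich B C T) = trace (sandwich (C * B) 1 T) := by
  have := trace_comm C (sandwich B 1 T)
  rw [sandwich_sandwich, sandwich_sandwich] at this
  exact this.symm

end TraceClass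

end

/-! ### Sandwich maps, tensor products and the partial trace -/

section

namespace TraceClass

section Bilinear

variable {H : Type*} [NormedAddCommGroup H] [InnerProductSpace ℂ H] [CompleteSpace H]
variable {G : Type*} [NormedAddCommGroup G] [InnerProductSpace ℂ G] [CompleteSpace G]

theorem norm_sandwich_le (B : H →L[ℂ] G) (C : G →L[ℂ] H) : ‖sandwich B C‖ ≤ ‖B‖ * ‖C‖ :=
  LinearMap.mkContinuous_norm_le _ (by positivity) _

variable (H G) in
/-- The map `(B, C) ↦ (T ↦ B T C)` as a bounded bilinear map. -/
def sandwichL : (H →L[ℂ] G) →L[ℂ] (G →L[ℂ] H) →L[ℂ] TraceClass H →L[ℂ] TraceClass G :=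
  LinearMap.mkContinuous₂
    (LinearMap.mk₂ ℂ (fun B C => sandwich B C)
      (fun B B' C => ContinuousLinearMap.ext fun T => ext (by
        simp [val_sandwich, val_add]))
      (fun z B C => ContinuousLinearMap.ext fun T => ext (by
        simp [val_sandwich, val_smul]))
      (fun B C C' => ContinuousLinearMap.ext fun T => ext (by
        simp [val_sandwich, val_add]))
      (fun z B C => ContinuousLinearMap.ext fun T => ext (by
        simp [val_sandwich, val_smul])))
    1 (fun B C => by rw [one_mul]; exact norm_sandwich_le B C)

theorem sandwichL_apply (B : H →L[ℂ] G) (C : G →L[ℂ] H) : sandwichL H G B C = sandwich B C := rfl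

theorem sandwich_comp {F : Type*} [NormedAddCommGroup F] [InnerProductSpace ℂ F] [CompleteSpace F]
    (B : H →L[ℂ] G) (C : G →L[ℂ] H) (B' : G →L[ℂ] F) (C' : F →L[ℂ] G) :
    sandwich B' C' ∘L sandwich B C = sandwich (B' ∘L B) (C ∘L C') :=
  ContinuousLinearMap.ext fun T => sandwich_sandwich B C B' C' T

theorem sandwich_mul_sandwich (B C B' C' : H →L[ℂ] H) :
    sandwich B' C' * sandwich B C = sandwich (B' * B) (C * C') := sandwich_comp _ _ _ _

theorem sandwich_one : sandwich (1 : H →L[ℂ] H) 1 = 1 :=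
  ContinuousLinearMap.ext fun _ => ext rfl

end Bilinear

end TraceClass

section Tensor

variable {d : ℕ} {E : Type*} [NormedAddCommGroup E] [InnerProductSpace ℂ E]

theorem tensorOp_apply (S : Mat d) (R : E →L[ℂ] E) (v : Compound d E) (i : Fin d) :
    (tensorOp S R v) i = ∑ j, S i j • R (v j) := by
  classical
  have : ∀ i' j, (S i' j • (incl i' ∘L R ∘L comp j) : Compound d E →L[ℂ] Compound d E) v
      = S i' j • WithLp.toLp 2 (Pi.single i' (R (v j)) : Fin d → E) := fun _ _ => rfl
  simp only [tensorOp, sum_apply, this]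
  simp only [WithLp.ofLp_sum, WithLp.ofLp_smul, Finset.sum_apply, Pi.smul_apply]
  rw [Finset.sum_eq_single i]
  · simp
  · intro b _ hb
    simp [Pi.single_eq_of_ne hb.symm]
  · simp

theorem tensorOp_mul (S S' : Mat d) (R R' : E →L[ℂ] E) :
    tensorOp S R * tensorOp S' R' = tensorOp (S * S') (R * R') := by
  refine ContinuousLinearMap.ext fun v => PiLp.ext fun i => ?_
  rw [mul_apply_eq_comp, tensorOp_apply, tensorOp_apply]
  simp only [tensorOp_apply, map_sum, map_smul, Finset.smul_sum, smul_smul, Matrix.mul_apply,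
    Finset.sum_smul, mul_apply_eq_comp]
  exact Finset.sum_comm

theorem tensorOp_one : tensorOp (1 : Mat d) (1 : E →L[ℂ] E) = 1 := by
  refine ContinuousLinearMap.ext fun v => PiLp.ext fun i => ?_
  rw [tensorOp_apply, Finset.sum_eq_single i]
  · simp
  · intro b _ hb
    simp [Matrix.one_apply_ne hb.symm]
  · simp

theorem tensorOp_add_left (S S' : Mat d) (R : E →L[ℂ] E) :
    tensorOp (S + S') R = tensorOp S R + tensorOp S' R := by
  refine ContinuousLinearMap.ext fun v => PiLp.ext fun i => ?_
  rw [add_apply, PiLp.add_apply]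
  simp only [tensorOp_apply, Matrix.add_apply, add_smul, Finset.sum_add_distrib]

theorem tensorOp_smul_left (c : ℂ) (S : Mat d) (R : E →L[ℂ] E) :
    tensorOp (c • S) R = c • tensorOp S R := by
  simp only [tensorOp, Matrix.smul_apply, smul_assoc, Finset.smul_sum]

theorem tensorOp_add_right (S : Mat d) (R R' : E →L[ℂ] E) :
    tensorOp S (R + R') = tensorOp S R + tensorOp S R' := by
  simp only [tensorOp, ContinuousLinearMap.add_comp, ContinuousLinearMap.comp_add, smul_add,
    Finset.sum_add_distrib]

theorem tensorOp_smul_right (c : ℂ) (S : Mat d) (R : E →L[ℂ] E) :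
    tensorOp S (c • R) = c • tensorOp S R := by
  simp only [tensorOp, ContinuousLinearMap.smul_comp, ContinuousLinearMap.comp_smul,
    Finset.smul_sum, smul_comm c]

theorem comp_comp_tensorOp (S : Mat d) (R : E →L[ℂ] E) (i : Fin d) :
    comp i ∘L tensorOp S R = ∑ k, S i k • (R ∘L comp k) := by
  refine ContinuousLinearMap.ext fun v => ?_
  rw [ContinuousLinearMap.comp_apply]
  change (tensorOp S R v) i = _
  rw [tensorOp_apply, sum_apply]
  rfl

theorem tensorOp_comp_incl (S : Mat d) (R : E →L[ℂ] E) (j : Fin d) :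
    tensorOp S R ∘L incl j = ∑ k, S k j • (incl k ∘L R) := by
  classical
  refine ContinuousLinearMap.ext fun x => PiLp.ext fun i => ?_
  have h1 : ∀ k, incl j x k = (Pi.single j x : Fin d → E) k := fun k => rfl
  have h2 : ∀ k, (S k j • (incl k ∘L R) : E →L[ℂ] Compound d E) x
      = S k j • WithLp.toLp 2 (Pi.single k (R x) : Fin d → E) := fun _ => rfl
  rw [ContinuousLinearMap.comp_apply, tensorOp_apply, Finset.sum_eq_single j]
  · rw [h1, sum_apply]
    simp only [h2, WithLp.ofLp_sum, WithLp.ofLp_smul, Finset.sum_apply, Pi.smul_apply]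
    rw [Finset.sum_eq_single i]
    · simp
    · intro b _ hb
      simp [Pi.single_eq_of_ne hb.symm]
    · simp
  · intro b _ hb
    rw [h1, Pi.single_eq_of_ne hb, map_zero, smul_zero]
  · simp

theorem comp_comp_incl (i j : Fin d) :
    comp i ∘L incl j = if i = j then (1 : E →L[ℂ] E) else 0 := by
  refine ContinuousLinearMap.ext fun x => ?_
  change (Pi.single j x : Fin d → E) i = _
  split_ifs with h
  · subst h; simp
  · simp [Pi.single_eq_of_ne h]

theorem continuous_tensorOp_left (R : E →L[ℂ] E) :
    Continuous fun S : Mat d => tensorOp S R :=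
  LinearMap.continuous_of_finiteDimensional
    (⟨⟨fun S => tensorOp S R, fun S S' => tensorOp_add_left S S' R⟩,
      fun c S => tensorOp_smul_left c S R⟩ : Mat d →ₗ[ℂ] (Compound d E →L[ℂ] Compound d E))

variable [CompleteSpace E]

theorem star_tensorOp (S : Mat d) (R : E →L[ℂ] E) :
    star (tensorOp S R) = tensorOp S.conjTranspose (star R) := by
  rw [ContinuousLinearMap.star_eq_adjoint, ContinuousLinearMap.star_eq_adjoint]
  symm
  rw [ContinuousLinearMap.eq_adjoint_iff]
  intro x y
  rw [PiLp.inner_apply, PiLp.inner_apply]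
  simp only [tensorOp_apply, sum_inner, inner_sum, inner_smul_left, inner_smul_right,
    ContinuousLinearMap.adjoint_inner_left, Matrix.conjTranspose_apply, RCLike.star_def,
    RingHomCompTriple.comp_apply, RingHom.id_apply]
  rw [Finset.sum_comm]

theorem val_tensorState (T : TraceClass E) (ρ : Mat d) :
    (tensorState T ρ).val = tensorOp ρ T.val := by
  have : tensorState T ρ = ∑ i, ∑ j, ρ i j • TraceClass.sandwich (incl i) (comp j) T := by
    simp [tensorState]
  have hv : ∀ (s : Finset (Fin d)) (g : Fin d → TraceClass (Compound d E)),
      (∑ i ∈ s, g i).val = ∑ i ∈ s, (g i).val := fun s g =>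
    map_sum (⟨⟨TraceClass.val, TraceClass.val_zero⟩, TraceClass.val_add⟩ :
      TraceClass (Compound d E) →+ _) g s
  rw [this, hv]
  simp only [hv, TraceClass.val_smul, TraceClass.val_sandwich, tensorOp]

theorem partialTrace_apply (a : TraceClass (Compound d E)) (i j : Fin d) :
    partialTrace a i j = TraceClass.trace (TraceClass.sandwich (comp i) (incl j) a) := by
  simp only [partialTrace, sum_apply, ContinuousLinearMap.smulRight_apply,
    ContinuousLinearMap.comp_apply, Matrix.sum_apply, Matrix.smul_apply, Matrix.single_apply,
    smul_eq_mul, mul_ite, mul_one, mul_zero]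
  rw [Finset.sum_eq_single i, Finset.sum_eq_single j]
  · simp
  · intro b _ hb; simp [hb]
  · simp
  · intro b _ hb; simp [hb]
  · simp

theorem sandwich_tensorState (S S' : Mat d) (R R' : E →L[ℂ] E) (T : TraceClass E) (ρ : Mat d) :
    TraceClass.sandwich (tensorOp S R) (tensorOp S' R') (tensorState T ρ)
      = tensorState (TraceClass.sandwich R R' T) (S * ρ * S') := by
  refine TraceClass.ext ?_
  rw [TraceClass.val_sandwich, val_tensorState, val_tensorState, TraceClass.val_sandwich]
  change tensorOp S R * (tensorOp ρ T.val * tensorOp S' R') = tensorOp _ (R * (T.val * R'))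
  rw [tensorOp_mul, tensorOp_mul, mul_assoc]

theorem partialTrace_tensorState (T : TraceClass E) (ρ : Mat d) :
    partialTrace (tensorState T ρ) = TraceClass.trace T • ρ := by
  ext i j
  rw [partialTrace_apply]
  have : TraceClass.sandwich (comp i) (incl j) (tensorState T ρ) = ρ i j • T := by
    refine TraceClass.ext ?_
    rw [TraceClass.val_sandwich, val_tensorState, TraceClass.val_smul,
      tensorOp_comp_incl, ContinuousLinearMap.comp_finsetSum, Finset.sum_eq_single i]
    · rw [ContinuousLinearMap.comp_smul, ← ContinuousLinearMap.comp_assoc, comp_comp_incl, if_pos rfl]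
      rfl
    · intro b _ hb
      rw [ContinuousLinearMap.comp_smul, ← ContinuousLinearMap.comp_assoc, comp_comp_incl,
        if_neg hb.symm]
      simp
    · simp
  rw [this, map_smul, Matrix.smul_apply, smul_eq_mul, smul_eq_mul, mul_comm]

/-- The partial trace is covariant under local operations, provided that the one on the
environment preserves the trace. -/
theorem partialTrace_sandwich (S S' : Mat d) {V V' : E →L[ℂ] E} (hV : V' * V = 1)
    (a : TraceClass (Compound d E)) :
    partialTrace (TraceClass.sandwich (tensorOp S V) (tensorOp S' V') a)
      = S * partialTrace a * S' := by
  ext i j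
  rw [partialTrace_apply, TraceClass.sandwich_sandwich, comp_comp_tensorOp, tensorOp_comp_incl,
    ← TraceClass.sandwichL_apply]
  simp only [map_sum, map_smul, sum_apply, smul_apply]
  simp only [Matrix.mul_apply, partialTrace_apply, Finset.sum_mul]
  refine Finset.sum_congr rfl fun k _ => ?_
  rw [Finset.smul_sum]
  refine Finset.sum_congr rfl fun l _ => ?_
  have : TraceClass.sandwichL _ _ (V ∘L comp l) (incl k ∘L V') a
      = TraceClass.sandwich V V' (TraceClass.sandwich (comp l) (incl k) a) := by
    rw [TraceClass.sandwich_sandwich]; rfl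
  rw [this, TraceClass.trace_sandwich, hV, TraceClass.sandwich_one]
  simp only [smul_eq_mul, one_apply_eq_self]
  ring

end Tensor

end

/-! ### Exponentials and the free evolution -/

section

section Exp

variable {𝔸 : Type*} [NormedRing 𝔸] [NormedAlgebra ℂ 𝔸] [CompleteSpace 𝔸]

theorem hasDerivAt_exp_ofReal_smul (Z : 𝔸) (t : ℝ) :
    HasDerivAt (fun s : ℝ => NormedSpace.exp ((s : ℂ) • Z))
      (Z * NormedSpace.exp ((t : ℂ) • Z)) t := by
  have h := (hasDerivAt_exp_smul_const' (𝕂 := ℂ) Z (t : ℂ)).scomp t Complex.ofRealCLM.hasDerivAt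
  rw [Complex.ofRealCLM_apply, Complex.ofReal_one, one_smul] at h
  exact h

theorem continuous_exp_ofReal_smul (Z : 𝔸) :
    Continuous fun s : ℝ => NormedSpace.exp ((s : ℂ) • Z) :=
  continuous_iff_continuousAt.2 fun t => (hasDerivAt_exp_ofReal_smul Z t).continuousAt

theorem exp_neg_mul_exp (Z : 𝔸) : NormedSpace.exp (-Z) * NormedSpace.exp Z = 1 := by
  let : NormedAlgebra ℚ 𝔸 := NormedAlgebra.restrictScalars ℚ ℂ 𝔸
  rw [← NormedSpace.exp_add_of_commute (Commute.neg_left rfl), neg_add_cancel,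
    NormedSpace.exp_zero]

theorem exp_mul_exp_neg (Z : 𝔸) : NormedSpace.exp Z * NormedSpace.exp (-Z) = 1 := by
  simpa using exp_neg_mul_exp (-Z)

/-- Uniqueness for linear equations with constant coefficients. -/
theorem eq_exp_mul_of_hasDerivWithinAt {s : Set ℝ} (hs : Convex ℝ s) (h0 : (0 : ℝ) ∈ s) {Z : 𝔸}
    {g : ℝ → 𝔸} (hg : ∀ t ∈ s, HasDerivWithinAt g (Z * g t) s t) {t : ℝ} (ht : t ∈ s) :
    g t = NormedSpace.exp ((t : ℂ) • Z) * g 0 := by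
  have hd : ∀ x ∈ s, HasDerivWithinAt
      (fun x : ℝ => NormedSpace.exp ((x : ℂ) • (-Z)) * g x) 0 s x := by
    intro x hx
    have h := (hasDerivAt_exp_ofReal_smul (-Z) x).hasDerivWithinAt (s := s).mul (hg x hx)
    refine h.congr_deriv ?_
    have hc : Commute Z (NormedSpace.exp ((x : ℂ) • (-Z))) :=
      Commute.exp_right (((Commute.refl Z).neg_right).smul_right _)
    rw [neg_mul, neg_mul, ← mul_assoc, hc.eq]
    simp
  have hconst := hs.norm_image_sub_le_of_norm_hasDerivWithin_le (C := 0) hd (by simp) h0 ht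
  rw [zero_mul, norm_le_zero_iff, sub_eq_zero] at hconst
  simp only [Complex.ofReal_zero, zero_smul, NormedSpace.exp_zero, one_mul] at hconst
  rw [← hconst, ← mul_assoc, smul_neg, exp_mul_exp_neg, one_mul]

/-- Intertwining relations pass to exponentials. -/
theorem exp_comp_of_comp_eq {V W : Type*} [NormedAddCommGroup V] [NormedSpace ℂ V]
    [CompleteSpace V] [NormedAddCommGroup W] [NormedSpace ℂ W] [CompleteSpace W]
    {A : W →L[ℂ] W} {B : V →L[ℂ] V} {T : V →L[ℂ] W} (h : A ∘L T = T ∘L B) :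
    NormedSpace.exp A ∘L T = T ∘L NormedSpace.exp B := by
  have hpow : ∀ n : ℕ, (A ^ n) ∘L T = T ∘L (B ^ n) := by
    intro n
    induction n with
    | zero => rfl
    | succ n ih =>
      calc (A ^ (n + 1)) ∘L T = (A ^ n) ∘L (A ∘L T) := by rw [pow_succ]; rfl
        _ = ((A ^ n) ∘L T) ∘L B := by rw [h]; rfl
        _ = T ∘L (B ^ (n + 1)) := by rw [ih, pow_succ]; rfl
  have h1 := (NormedSpace.exp_series_hasSum_exp' (𝕂 := ℂ) A).mapL
    ((ContinuousLinearMap.compL ℂ V W W).flip T)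
  have h2 := (NormedSpace.exp_series_hasSum_exp' (𝕂 := ℂ) B).mapL
    (ContinuousLinearMap.compL ℂ V V W T)
  refine h1.unique ?_
  refine h2.congr_fun ?_
  intro n
  simp [hpow]

end Exp

theorem mulBoth_mul_mulBoth {d : ℕ} (A B A' B' : Mat d) :
    mulBoth A' B' * mulBoth A B = mulBoth (A' * A) (B * B') := by
  ext1 ρ
  simp [mulBoth, mul_assoc]

theorem mulBoth_apply {d : ℕ} (A B ρ : Mat d) : mulBoth A B ρ = A * ρ * B := rfl

theorem mulBoth_one {d : ℕ} : mulBoth (1 : Mat d) 1 = 1 := by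
  ext1 ρ
  simp [mulBoth]

set_option synthInstance.maxHeartbeats 400000 in
theorem continuous_tensorOp_right {d : ℕ} {E : Type*} [NormedAddCommGroup E]
    [InnerProductSpace ℂ E] (S : Mat d) :
    Continuous fun R : E →L[ℂ] E => tensorOp S R := by
  unfold tensorOp
  refine continuous_finsetSum _ fun i _ => continuous_finsetSum _ fun j _ => ?_
  exact ((continuous_const (y := incl i)).clm_comp
    (continuous_id.clm_comp (continuous_const (y := comp j)))).const_smul (S i j)

/-- `S ↦ S ⊗ 1` as a continuous linear map. -/
def tensorLeft (d : ℕ) (E : Type*) [NormedAddCommGroup E] [InnerProductSpace ℂ E] :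
    Mat d →L[ℂ] (Compound d E →L[ℂ] Compound d E) where
  toFun S := tensorOp S 1
  map_add' S S' := tensorOp_add_left S S' 1
  map_smul' c S := tensorOp_smul_left c S 1
  cont := continuous_tensorOp_left 1

/-- `R ↦ 1 ⊗ R` as a continuous linear map. -/
def tensorRight (d : ℕ) (E : Type*) [NormedAddCommGroup E] [InnerProductSpace ℂ E] :
    (E →L[ℂ] E) →L[ℂ] (Compound d E →L[ℂ] Compound d E) where
  toFun R := tensorOp 1 R
  map_add' S S' := tensorOp_add_right 1 S S'
  map_smul' c S := tensorOp_smul_right c 1 S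
  cont := continuous_tensorOp_right 1

theorem tensorOp_comp_tensorOp {d : ℕ} {E : Type*} [NormedAddCommGroup E]
    [InnerProductSpace ℂ E] (S S' : Mat d) (R R' : E →L[ℂ] E) :
    tensorOp S R ∘L tensorOp S' R' = tensorOp (S * S') (R * R') := tensorOp_mul S S' R R'

theorem tensorOp_eq_mul {d : ℕ} {E : Type*} [NormedAddCommGroup E] [InnerProductSpace ℂ E]
    (S : Mat d) (R : E →L[ℂ] E) :
    tensorOp S R = tensorLeft d E S * tensorRight d E R := by
  change tensorOp S R = tensorOp S 1 * tensorOp 1 R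
  rw [tensorOp_mul, mul_one, one_mul]

theorem smul_smul_generator {V : Type*} [AddCommGroup V] [Module ℂ V] (h : V) (t : ℝ) :
    (-(Complex.I * t)) • h = (t : ℂ) • ((-Complex.I) • h) := by
  rw [smul_smul]; congr 1; ring

theorem smul_I_smul {V : Type*} [AddCommGroup V] [Module ℂ V] (h : V) (t : ℝ) :
    (t : ℂ) • (Complex.I • h) = ((-t : ℝ) : ℂ) • ((-Complex.I) • h) := by
  rw [smul_smul, smul_smul]; congr 1; push_cast; ring

section Conjugation

variable {H : Type*} [NormedAddCommGroup H] [InnerProductSpace ℂ H] [CompleteSpace H]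

theorem hasDerivWithinAt_sandwich {a b : ℝ → H →L[ℂ] H} {a' b' : H →L[ℂ] H} {s : Set ℝ} {t : ℝ}
    (ha : HasDerivWithinAt a a' s t) (hb : HasDerivWithinAt b b' s t) :
    HasDerivWithinAt (fun t => TraceClass.sandwich (a t) (b t))
      (TraceClass.sandwich a' (b t) + TraceClass.sandwich (a t) b') s t := by
  have h := ((TraceClass.sandwichL H H).bilinearRestrictScalars ℝ).hasDerivWithinAt_of_bilinear
    ha hb
  rw [add_comm] at h
  exact h

/-- Stated for a variable Hilbert space, so that it applies to operators on `Compound d E` without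
unfolding that space. -/
theorem star_add_clm (a b : H →L[ℂ] H) : star (a + b) = star a + star b := star_add a b

/-- The generator `-i[h, ·]` acts on conjugations by a product rule. -/
theorem commutator_mul_sandwich (h a b : H →L[ℂ] H) :
    ((-Complex.I) • TraceClass.commutator h) * TraceClass.sandwich a b =
      TraceClass.sandwich ((-Complex.I) • (h * a)) b +
        TraceClass.sandwich a (Complex.I • (b * h)) := by
  rw [TraceClass.commutator, smul_mul_assoc, sub_mul, TraceClass.sandwich_mul_sandwich,
    TraceClass.sandwich_mul_sandwich, one_mul, mul_one, ← TraceClass.sandwichL_apply,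
    ← TraceClass.sandwichL_apply, ← TraceClass.sandwichL_apply, ← TraceClass.sandwichL_apply,
    map_smul, map_smul, smul_apply, smul_sub, neg_smul, neg_smul, sub_neg_eq_add]

theorem exp_generator (h : H →L[ℂ] H) (t : ℝ) :
    NormedSpace.exp ((-(Complex.I * t)) • h)
      = NormedSpace.exp ((t : ℂ) • ((-Complex.I) • h)) := by
  rw [smul_smul_generator]

theorem exp_smul_I_smul (h : H →L[ℂ] H) (t : ℝ) :
    NormedSpace.exp ((t : ℂ) • (Complex.I • h))
      = NormedSpace.exp (((-t : ℝ) : ℂ) • ((-Complex.I) • h)) := by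
  rw [smul_I_smul]

/-- The group generated by `-i[h, ·]` is conjugation by `e^{-ith}`. -/
theorem exp_smul_commutator (h : H →L[ℂ] H) (t : ℝ) :
    NormedSpace.exp ((t : ℂ) • ((-Complex.I) • TraceClass.commutator h)) = TraceClass.sandwich
      (NormedSpace.exp ((t : ℂ) • ((-Complex.I) • h)))
      (NormedSpace.exp ((t : ℂ) • (Complex.I • h))) := by
  have hd : ∀ t : ℝ, t ∈ Set.univ → HasDerivWithinAt (fun t : ℝ => TraceClass.sandwich
      (NormedSpace.exp ((t : ℂ) • ((-Complex.I) • h)))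
      (NormedSpace.exp ((t : ℂ) • (Complex.I • h))))
      (((-Complex.I) • TraceClass.commutator h) * TraceClass.sandwich
      (NormedSpace.exp ((t : ℂ) • ((-Complex.I) • h)))
      (NormedSpace.exp ((t : ℂ) • (Complex.I • h)))) Set.univ t := by
    intro t _
    have h1 := (hasDerivAt_exp_ofReal_smul ((-Complex.I) • h) t).hasDerivWithinAt (s := Set.univ)
    have h2 := (hasDerivAt_exp_ofReal_smul (Complex.I • h) t).hasDerivWithinAt (s := Set.univ)
    refine (hasDerivWithinAt_sandwich h1 h2).congr_deriv ?_
    have hc : Commute h (NormedSpace.exp ((t : ℂ) • (Complex.I • h))) :=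
      Commute.exp_right (((Commute.refl h).smul_right _).smul_right _)
    rw [commutator_mul_sandwich, smul_mul_assoc, smul_mul_assoc, hc.eq]
  have h0 := eq_exp_mul_of_hasDerivWithinAt convex_univ (Set.mem_univ _) hd (Set.mem_univ t)
  simp only [Complex.ofReal_zero, zero_smul, NormedSpace.exp_zero, TraceClass.sandwich_one,
    mul_one] at h0
  exact h0.symm

theorem hasDerivWithinAt_sandwich_star {a : ℝ → H →L[ℂ] H} {h : H →L[ℂ] H} {s : Set ℝ} {t : ℝ}
    (ha : HasDerivWithinAt a ((-Complex.I) • (h * a t)) s t) (hh : star h = h) :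
    HasDerivWithinAt (fun t => TraceClass.sandwich (a t) (star (a t)))
      (((-Complex.I) • TraceClass.commutator h) * TraceClass.sandwich (a t) (star (a t))) s t := by
  refine (hasDerivWithinAt_sandwich ha ha.star).congr_deriv ?_
  rw [commutator_mul_sandwich, star_smul, star_mul, hh]
  simp

theorem continuous_sandwich {X : Type*} [TopologicalSpace X] {a b : X → H →L[ℂ] H}
    (ha : Continuous a) (hb : Continuous b) :
    Continuous fun x => TraceClass.sandwich (a x) (b x) :=
  ((TraceClass.sandwichL H H).continuous.comp ha).clm_apply hb

theorem continuous_sandwich_star {X : Type*} [TopologicalSpace X] {a : X → H →L[ℂ] H}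
    (ha : Continuous a) : Continuous fun x => TraceClass.sandwich (a x) (star (a x)) :=
  continuous_sandwich ha ha.star

theorem continuous_star_sandwich {X : Type*} [TopologicalSpace X] {a : X → H →L[ℂ] H}
    (ha : Continuous a) : Continuous fun x => TraceClass.sandwich (star (a x)) (a x) :=
  continuous_sandwich ha.star ha

end Conjugation

namespace OpenSystem

variable {r d m : ℕ} {E : Type*} [NormedAddCommGroup E] [InnerProductSpace ℂ E] [CompleteSpace E]
variable (M : OpenSystem r d m E)

/-- The unitary group `e^{-itH̄}`. -/
def sysU (t : ℝ) : Mat d := NormedSpace.exp ((-(Complex.I * t)) • M.Hbar)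

/-- The unitary evolution operator `u_t ⊗ e^{-itH_E}` of the uncoupled compound system. -/
def w (t : ℝ) : Compound d E →L[ℂ] Compound d E := tensorOp (M.u t) (M.envU t)

theorem hasDerivAt_sysU (t : ℝ) : HasDerivAt M.sysU ((-Complex.I) • (M.Hbar * M.sysU t)) t := by
  have h := hasDerivAt_exp_ofReal_smul ((-Complex.I) • M.Hbar) t
  simp only [← smul_smul_generator, smul_mul_assoc] at h
  exact h

theorem hasDerivAt_envU (t : ℝ) : HasDerivAt M.envU ((-Complex.I) • (M.HE * M.envU t)) t := by
  have h := hasDerivAt_exp_ofReal_smul ((-Complex.I) • M.HE) t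
  simp only [← smul_smul_generator, smul_mul_assoc] at h
  exact h

theorem continuous_sysU : Continuous M.sysU :=
  continuous_iff_continuousAt.2 fun t => (M.hasDerivAt_sysU t).continuousAt

theorem continuous_envU : Continuous M.envU :=
  continuous_iff_continuousAt.2 fun t => (M.hasDerivAt_envU t).continuousAt

theorem envU_zero : M.envU 0 = 1 := by simp [envU]

theorem sysU_zero : M.sysU 0 = 1 := by simp [sysU]

theorem u_eq (t : ℝ) : M.u t = M.p t * M.sysU t := rfl

theorem envU_mul (s t : ℝ) : M.envU s * M.envU t = M.envU (s + t) := by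
  let : NormedAlgebra ℚ (E →L[ℂ] E) := NormedAlgebra.restrictScalars ℚ ℂ _
  rw [envU, envU, envU, ← NormedSpace.exp_add_of_commute
    (((Commute.refl M.HE).smul_left _).smul_right _), ← add_smul]
  congr 2
  push_cast
  ring

theorem sysU_mul (s t : ℝ) : M.sysU s * M.sysU t = M.sysU (s + t) := by
  let : NormedAlgebra ℚ (Mat d) := NormedAlgebra.restrictScalars ℚ ℂ _
  rw [sysU, sysU, sysU, ← NormedSpace.exp_add_of_commute
    (((Commute.refl M.Hbar).smul_left _).smul_right _), ← add_smul]
  congr 2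
  push_cast
  ring

theorem conjTranspose_sysU (t : ℝ) : (M.sysU t).conjTranspose = M.sysU (-t) := by
  rw [sysU, sysU, ← Matrix.exp_conjTranspose, Matrix.conjTranspose_smul, M.hermitian_Hbar.eq]
  congr 2
  simp

variable {M}

theorem star_envU (hM : M.Assumptions) (t : ℝ) : star (M.envU t) = M.envU (-t) := by
  rw [envU, envU, NormedSpace.star_exp, star_smul, hM.selfAdjoint_HE.star_eq]
  congr 2
  simp

theorem commute_envU_ωE (hM : M.Assumptions) (t : ℝ) : Commute (M.envU t) M.ωE.val :=
  Commute.exp_left (hM.commute_ωE.smul_left _)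

/-- The state of the environment is invariant. -/
theorem sandwich_envU_ωE (hM : M.Assumptions) (t : ℝ) :
    TraceClass.sandwich (M.envU t) (M.envU (-t)) M.ωE = M.ωE := by
  refine TraceClass.ext ?_
  change M.envU t * (M.ωE.val * M.envU (-t)) = _
  rw [← mul_assoc, (commute_envU_ωE hM t).eq, mul_assoc, envU_mul, add_neg_cancel, envU_zero,
    mul_one]

theorem conjTranspose_p_mul (hM : M.Assumptions) (t : ℝ) :
    (M.p t).conjTranspose * M.p t = 1 := Matrix.mem_unitaryGroup_iff'.1 (hM.unitary_p t)

theorem p_mul_conjTranspose (hM : M.Assumptions) (t : ℝ) :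
    M.p t * (M.p t).conjTranspose = 1 := Matrix.mem_unitaryGroup_iff.1 (hM.unitary_p t)

theorem conjTranspose_u (t : ℝ) :
    (M.u t).conjTranspose = M.sysU (-t) * (M.p t).conjTranspose := by
  rw [u_eq, Matrix.conjTranspose_mul, conjTranspose_sysU]

theorem conjTranspose_u_mul (hM : M.Assumptions) (t : ℝ) :
    (M.u t).conjTranspose * M.u t = 1 := by
  rw [conjTranspose_u, u_eq, mul_assoc, ← mul_assoc _ (M.p t), conjTranspose_p_mul hM, one_mul,
    sysU_mul, neg_add_cancel, sysU_zero]

theorem u_mul_conjTranspose (hM : M.Assumptions) (t : ℝ) :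
    M.u t * (M.u t).conjTranspose = 1 := mul_eq_one_comm.1 (conjTranspose_u_mul hM t)

theorem star_w (hM : M.Assumptions) (t : ℝ) :
    star (M.w t) = tensorOp (M.u t).conjTranspose (M.envU (-t)) := by
  rw [w, star_tensorOp, star_envU hM]

theorem star_w_mul (hM : M.Assumptions) (t : ℝ) : star (M.w t) * M.w t = 1 := by
  rw [star_w hM, w, tensorOp_mul, conjTranspose_u_mul hM, envU_mul, neg_add_cancel, envU_zero,
    tensorOp_one]

theorem w_mul_star (hM : M.Assumptions) (t : ℝ) : M.w t * star (M.w t) = 1 := by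
  rw [star_w hM, w, tensorOp_mul, u_mul_conjTranspose hM, envU_mul, add_neg_cancel, envU_zero,
    tensorOp_one]

theorem hasDerivWithinAt_tensorOp {a : ℝ → Mat d} {b : ℝ → E →L[ℂ] E} {a' : Mat d}
    {b' : E →L[ℂ] E} {s : Set ℝ} {t : ℝ} (ha : HasDerivWithinAt a a' s t)
    (hb : HasDerivWithinAt b b' s t) :
    HasDerivWithinAt (fun t => tensorOp (a t) (b t)) (tensorOp a' (b t) + tensorOp (a t) b') s t := by
  have h1 := ((tensorLeft d E).restrictScalars ℝ).hasFDerivAt.comp_hasDerivWithinAt t ha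
  have h2 := ((tensorRight d E).restrictScalars ℝ).hasFDerivAt.comp_hasDerivWithinAt t hb
  have h := h1.mul h2
  have e : ∀ x y, tensorOp x y = (tensorLeft d E).restrictScalars ℝ x *
    (tensorRight d E).restrictScalars ℝ y := tensorOp_eq_mul
  rw [e, e]
  refine h.congr_of_eventuallyEq (Filter.Eventually.of_forall fun x => e _ _) (e _ _)

/-- The two summands commute, and `S ↦ S ⊗ 1` and `R ↦ 1 ⊗ R` are continuous homomorphisms. -/
theorem exp_smul_tensorOp_add (A : Mat d) (B : E →L[ℂ] E) (c : ℂ) :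
    NormedSpace.exp (c • (tensorOp A 1 + tensorOp 1 B))
      = tensorOp (NormedSpace.exp (c • A)) (NormedSpace.exp (c • B)) := by
  let : NormedAlgebra ℚ (E →L[ℂ] E) := NormedAlgebra.restrictScalars ℚ ℂ _
  let : NormedAlgebra ℚ (Mat d) := NormedAlgebra.restrictScalars ℚ ℂ _
  let : NormedAlgebra ℚ (Compound d E →L[ℂ] Compound d E) := NormedAlgebra.restrictScalars ℚ ℂ _
  let f : Mat d →+* (Compound d E →L[ℂ] Compound d E) :=
    { toFun := fun S => tensorOp S 1
      map_one' := tensorOp_one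
      map_mul' := fun S S' => by rw [tensorOp_mul, one_mul]
      map_zero' := (tensorLeft d E).map_zero
      map_add' := fun S S' => tensorOp_add_left S S' 1 }
  let g : (E →L[ℂ] E) →+* (Compound d E →L[ℂ] Compound d E) :=
    { toFun := fun R => tensorOp 1 R
      map_one' := tensorOp_one
      map_mul' := fun S S' => by rw [tensorOp_mul, one_mul]
      map_zero' := (tensorRight d E).map_zero
      map_add' := fun S S' => tensorOp_add_right 1 S S' }
  have h1 : f (NormedSpace.exp (c • A)) = NormedSpace.exp (f (c • A)) :=
    NormedSpace.map_exp f (continuous_tensorOp_left 1) _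
  have h2 : g (NormedSpace.exp (c • B)) = NormedSpace.exp (g (c • B)) :=
    NormedSpace.map_exp g (continuous_tensorOp_right 1) _
  have e1 : f (NormedSpace.exp (c • A)) * g (NormedSpace.exp (c • B))
      = tensorOp (NormedSpace.exp (c • A)) (NormedSpace.exp (c • B)) := by
    change tensorOp _ 1 * tensorOp 1 _ = _
    rw [tensorOp_mul, mul_one, one_mul]
  have hc : Commute (f (c • A)) (g (c • B)) := by
    change tensorOp _ 1 * tensorOp 1 _ = tensorOp 1 _ * tensorOp _ 1
    rw [tensorOp_mul, tensorOp_mul, mul_one, one_mul, mul_one, one_mul]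
  have e2 : c • (tensorOp A 1 + tensorOp 1 B) = f (c • A) + g (c • B) := by
    change _ = tensorOp (c • A) 1 + tensorOp 1 (c • B)
    rw [tensorOp_smul_left, tensorOp_smul_right]
    exact smul_add _ _ _
  rw [← e1, h1, h2, e2]
  exact NormedSpace.exp_add_of_commute hc

theorem exp_smul_Zbar (M : OpenSystem r d m E) (t : ℝ) :
    NormedSpace.exp ((t : ℂ) • M.Zbar) = TraceClass.sandwich
      (tensorOp (M.sysU t) (M.envU t)) (tensorOp (M.sysU (-t)) (M.envU (-t))) := by
  have h1 : ∀ t : ℝ, tensorOp (M.sysU t) (M.envU t) = NormedSpace.exp ((t : ℂ) •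
      ((-Complex.I) • (tensorOp M.Hbar 1 + tensorOp 1 M.HE))) := by
    intro t
    refine Eq.trans ?_ (exp_generator _ t)
    exact (exp_smul_tensorOp_add _ _ _).symm
  refine (exp_smul_commutator _ t).trans ?_
  rw [h1 t, h1 (-t)]
  exact congrArg _ (exp_smul_I_smul _ t)

/-- The free evolution is conjugation by the unitaries `u_t ⊗ e^{-itH_E}`. -/
theorem U_eq (hM : M.Assumptions) (t : ℝ) :
    M.U t = TraceClass.sandwich (M.w t) (star (M.w t)) := by
  rw [U, exp_smul_Zbar, P]
  rw [TraceClass.sandwich_comp, tensorOp_comp_tensorOp, tensorOp_comp_tensorOp, star_w hM,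
    conjTranspose_u,
    one_mul, mul_one]
  rfl

theorem U_zero (hM : M.Assumptions) : M.U 0 = 1 := by
  have hu : M.u 0 = 1 := by rw [u_eq, hM.p_zero, sysU_zero, mul_one]
  rw [U_eq hM, star_w hM, w, hu, neg_zero, envU_zero, Matrix.conjTranspose_one, tensorOp_one,
    TraceClass.sandwich_one]

theorem hasDerivWithinAt_w (hM : M.Assumptions) {t : ℝ} (ht : 0 ≤ t) :
    HasDerivWithinAt M.w ((-Complex.I) • (M.Hfree t * M.w t)) (Set.Ici 0) t := by
  refine (hasDerivWithinAt_tensorOp (hM.schroedinger t ht)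
    (M.hasDerivAt_envU t).hasDerivWithinAt).congr_deriv ?_
  have e : M.Hfree t * M.w t
      = tensorOp (M.H t * M.u t) (M.envU t) + tensorOp (M.u t) (M.HE * M.envU t) := by
    have e1 := tensorOp_mul (M.H t) (M.u t) 1 (M.envU t)
    have e2 := tensorOp_mul 1 (M.u t) M.HE (M.envU t)
    rw [one_mul] at e1 e2
    rw [← e1, ← e2]
    exact add_mul _ _ _
  rw [tensorOp_smul_left, tensorOp_smul_right, e]
  exact (smul_add _ _ _).symm

theorem star_Hfree (hM : M.Assumptions) (t : ℝ) : star (M.Hfree t) = M.Hfree t := by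
  refine (star_add_clm _ _).trans ?_
  rw [star_tensorOp, star_tensorOp, (hM.hermitian_H t).eq, star_one,
    hM.selfAdjoint_HE.star_eq, Matrix.conjTranspose_one]
  exact rfl

theorem hasDerivWithinAt_U (hM : M.Assumptions) {t : ℝ} (ht : 0 ≤ t) :
    HasDerivWithinAt M.U (M.Z t ∘L M.U t) (Set.Ici 0) t := by
  have e : M.U = fun t => TraceClass.sandwich (M.w t) (star (M.w t)) := funext (U_eq hM)
  rw [e]
  exact hasDerivWithinAt_sandwich_star (hasDerivWithinAt_w hM ht) (star_Hfree hM t)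

variable (M) in
/-- The inverse of the free evolution. -/
def Uinv (t : ℝ) : TraceClass (Compound d E) →L[ℂ] TraceClass (Compound d E) :=
  TraceClass.sandwich (star (M.w t)) (M.w t)

theorem U_mul_Uinv (hM : M.Assumptions) (t : ℝ) : M.U t * M.Uinv t = 1 := by
  rw [U_eq hM, Uinv, TraceClass.sandwich_mul_sandwich, w_mul_star hM, TraceClass.sandwich_one]

theorem Uinv_mul_U (hM : M.Assumptions) (t : ℝ) : M.Uinv t * M.U t = 1 := by
  rw [U_eq hM, Uinv, TraceClass.sandwich_mul_sandwich, star_w_mul hM, TraceClass.sandwich_one]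

theorem inverse_U (hM : M.Assumptions) (t : ℝ) : (M.U t).inverse = M.Uinv t :=
  ContinuousLinearMap.inverse_eq (U_mul_Uinv hM t) (Uinv_mul_U hM t)

theorem continuous_winding (Ω : Fin r → ℝ) : Continuous (winding Ω) :=
  continuous_pi fun _ => (AddCircle.continuous_mk' 1).comp
    ((continuous_const.mul continuous_id).div_const _)

theorem continuous_p (hM : M.Assumptions) : Continuous M.p :=
  hM.continuous_phat.comp (continuous_winding M.Ω)

theorem continuous_u (hM : M.Assumptions) : Continuous M.u :=
  (continuous_p hM).mul M.continuous_sysU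

theorem continuous_w (hM : M.Assumptions) : Continuous M.w := by
  have e : M.w = fun t => tensorLeft d E (M.u t) * tensorRight d E (M.envU t) :=
    funext fun t => tensorOp_eq_mul _ _
  rw [e]
  exact ((tensorLeft d E).continuous.comp (continuous_u hM)).mul
    ((tensorRight d E).continuous.comp M.continuous_envU)

theorem continuous_U (hM : M.Assumptions) : Continuous M.U := by
  have e : M.U = fun t => TraceClass.sandwich (M.w t) (star (M.w t)) := funext (U_eq hM)
  rw [e]
  exact continuous_sandwich_star (continuous_w hM)

theorem continuous_Uinv (hM : M.Assumptions) : Continuous M.Uinv :=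
  continuous_star_sandwich (continuous_w hM)

theorem U_comp_tensorState (hM : M.Assumptions) (t : ℝ) :
    M.U t ∘L tensorState M.ωE = tensorState M.ωE ∘L mulBoth (M.u t) (M.u t).conjTranspose := by
  refine ContinuousLinearMap.ext fun ρ => ?_
  rw [U_eq hM, star_w hM, w, ContinuousLinearMap.comp_apply, sandwich_tensorState,
    sandwich_envU_ωE hM]
  rfl

theorem Uinv_comp_tensorState (hM : M.Assumptions) (t : ℝ) :
    M.Uinv t ∘L tensorState M.ωE = tensorState M.ωE ∘L mulBoth (M.u t).conjTranspose (M.u t) := by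
  refine ContinuousLinearMap.ext fun ρ => ?_
  have h := sandwich_envU_ωE hM (-t)
  rw [neg_neg] at h
  rw [Uinv, star_w hM, w, ContinuousLinearMap.comp_apply, sandwich_tensorState, h]
  rfl

theorem partialTrace_comp_U (hM : M.Assumptions) (t : ℝ) :
    partialTrace ∘L M.U t = mulBoth (M.u t) (M.u t).conjTranspose ∘L partialTrace := by
  refine ContinuousLinearMap.ext fun a => ?_
  rw [U_eq hM, star_w hM, w, ContinuousLinearMap.comp_apply, partialTrace_sandwich _ _
    (by rw [envU_mul, neg_add_cancel, envU_zero])]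
  rfl

theorem partialTrace_comp_Uinv (hM : M.Assumptions) (t : ℝ) :
    partialTrace ∘L M.Uinv t = mulBoth (M.u t).conjTranspose (M.u t) ∘L partialTrace := by
  refine ContinuousLinearMap.ext fun a => ?_
  rw [Uinv, star_w hM, w, ContinuousLinearMap.comp_apply, partialTrace_sandwich _ _
    (by rw [envU_mul, add_neg_cancel, envU_zero])]
  rfl

theorem partialTrace_comp_tensorState (hM : M.Assumptions) :
    partialTrace ∘L tensorState M.ωE = (1 : SuperOp d) := by
  refine ContinuousLinearMap.ext fun ρ => ?_
  rw [ContinuousLinearMap.comp_apply, partialTrace_tensorState, hM.trace_ωE, one_smul]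
  rfl

theorem P₀_comp_Uinv (hM : M.Assumptions) (t : ℝ) : M.P₀ * M.Uinv t = M.Uinv t * M.P₀ := by
  change (tensorState M.ωE ∘L partialTrace) ∘L M.Uinv t
    = M.Uinv t ∘L tensorState M.ωE ∘L partialTrace
  rw [ContinuousLinearMap.comp_assoc, partialTrace_comp_Uinv hM,
    ← ContinuousLinearMap.comp_assoc, ← ContinuousLinearMap.comp_assoc,
    Uinv_comp_tensorState hM]

theorem P₀_comp_U (hM : M.Assumptions) (t : ℝ) : M.P₀ * M.U t = M.U t * M.P₀ := by
  change (tensorState M.ωE ∘L partialTrace) ∘L M.U t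
    = M.U t ∘L tensorState M.ωE ∘L partialTrace
  rw [ContinuousLinearMap.comp_assoc, partialTrace_comp_U hM,
    ← ContinuousLinearMap.comp_assoc, ← ContinuousLinearMap.comp_assoc,
    U_comp_tensorState hM]

theorem P₀_mul_P₀ (hM : M.Assumptions) : M.P₀ * M.P₀ = M.P₀ := by
  change (tensorState M.ωE ∘L partialTrace) ∘L (tensorState M.ωE ∘L partialTrace) = _
  rw [ContinuousLinearMap.comp_assoc, ← ContinuousLinearMap.comp_assoc partialTrace,
    partialTrace_comp_tensorState hM]
  rfl

end OpenSystem

end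

/-! ### Time averages along a winding of the torus -/

section

open MeasureTheory Filter Topology UnitAddTorus

section TimeMean

variable {V W : Type*} [NormedAddCommGroup V] [NormedSpace ℝ V] [NormedAddCommGroup W]
  [NormedSpace ℝ W]

/-- The continuous function `g` has the time average `L`, over large symmetric intervals. -/
def HasMean (g : ℝ → V) (L : V) : Prop :=
  Continuous g ∧ Tendsto (fun δ : ℝ => (2 * δ)⁻¹ • ∫ t in (-δ)..δ, g t) atTop (𝓝 L)

theorem HasMean.add {g g' : ℝ → V} {L L' : V} (h : HasMean g L) (h' : HasMean g' L') :
    HasMean (fun t => g t + g' t) (L + L') := by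
  refine ⟨h.1.add h'.1, (h.2.add h'.2).congr fun δ => ?_⟩
  rw [intervalIntegral.integral_add (h.1.intervalIntegrable _ _) (h'.1.intervalIntegrable _ _),
    smul_add]

theorem HasMean.zero : HasMean (fun _ : ℝ => (0 : V)) 0 := by
  refine ⟨continuous_const, ?_⟩
  simp

theorem HasMean.sum {ι : Type*} {s : Finset ι} {g : ι → ℝ → V} {L : ι → V}
    (h : ∀ i ∈ s, HasMean (g i) (L i)) : HasMean (fun t => ∑ i ∈ s, g i t) (∑ i ∈ s, L i) := by
  classical
  induction s using Finset.induction_on with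
  | empty => simpa using HasMean.zero
  | insert a s ha ih =>
    simp only [Finset.sum_insert ha]
    exact (h a (Finset.mem_insert_self _ _)).add
      (ih fun i hi => h i (Finset.mem_insert_of_mem hi))

theorem HasMean.mapL [CompleteSpace V] [CompleteSpace W] {g : ℝ → V} {L : V} (h : HasMean g L)
    (T : V →L[ℝ] W) : HasMean (fun t => T (g t)) (T L) := by
  refine ⟨T.continuous.comp h.1, ((T.continuous.tendsto L).comp h.2).congr fun δ => ?_⟩
  rw [Function.comp_apply, map_smul, T.intervalIntegral_comp_comm (h.1.intervalIntegrable _ _)]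

/-- Time averages do not see the time scale. -/
theorem HasMean.comp_mul_left {g : ℝ → V} {L : V} (h : HasMean g L) {c : ℝ} (hc : 0 < c) :
    HasMean (fun t => g (c * t)) L := by
  refine ⟨h.1.comp (continuous_const.mul continuous_id), ?_⟩
  refine (h.2.comp (tendsto_id.const_mul_atTop hc)).congr fun δ => ?_
  have e := intervalIntegral.integral_comp_mul_left (a := -δ) (b := δ) g hc.ne'
  simp only [Function.comp_apply, id_eq]
  rw [e, smul_smul, mul_neg]
  congr 1
  rw [mul_inv, mul_inv, mul_inv]
  ring

end TimeMean

section Torus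

attribute [local instance] instMeasureSpaceUnitAddCircle instIsAddHaarMeasureUnitAddCircleVolume
  instIsProbabilityMeasureUnitAddCircleVolume

variable {r : ℕ} (Ω : Fin r → ℝ)

theorem winding_add (s t : ℝ) : winding Ω (s + t) = winding Ω s + winding Ω t := by
  funext j
  simp only [winding, Pi.add_apply]
  rw [← AddCircle.coe_add]
  congr 1
  ring

theorem mFourier_winding (n : Fin r → ℤ) (s : ℝ) :
    mFourier n (winding Ω s) = Complex.exp (Complex.I * dotFreq Ω n * s) := by
  simp only [mFourier, ContinuousMap.coe_mk, winding, fourier_coe_apply]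
  rw [← Complex.exp_sum]
  congr 1
  simp only [dotFreq]
  push_cast
  rw [Finset.mul_sum, Finset.sum_mul]
  refine Finset.sum_congr rfl fun j _ => ?_
  have : (Real.pi : ℂ) ≠ 0 := by exact_mod_cast Real.pi_ne_zero
  field_simp

theorem integral_mFourier (n : Fin r → ℤ) :
    ∫ θ, mFourier n θ = if n = 0 then 1 else 0 := by
  have h := (orthonormal_iff_ite.1 (orthonormal_mFourier (d := Fin r))) 0 n
  rw [ContinuousMap.inner_toLp] at h
  simp only [mFourier_zero, ContinuousMap.one_apply, map_one, mul_one] at h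
  simp only [h, eq_comm]

/-- The time average of a character of the line. -/
theorem hasMean_exp (β : ℝ) :
    HasMean (fun s : ℝ => Complex.exp (Complex.I * β * s)) (if β = 0 then 1 else 0) := by
  refine ⟨by fun_prop, ?_⟩
  split_ifs with hβ
  · subst hβ
    refine tendsto_const_nhds.congr' ((eventually_gt_atTop 0).mono fun δ hδ => ?_)
    simp only [Complex.ofReal_zero, mul_zero, zero_mul, Complex.exp_zero,
      intervalIntegral.integral_const, smul_smul, sub_neg_eq_add]
    rw [← two_mul, inv_mul_cancel₀ (by positivity), one_smul]
  · have hI : Complex.I * β ≠ 0 := mul_ne_zero Complex.I_ne_zero (by exact_mod_cast hβ)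
    have hn : ‖Complex.I * β‖ ≠ 0 := by simpa using hβ
    have hb : ∀ x : ℝ, ‖Complex.exp (Complex.I * β * x)‖ = 1 := fun x => by
      rw [Complex.norm_exp]; simp
    refine squeeze_zero_norm' (a := fun δ : ℝ => δ⁻¹ * ‖Complex.I * β‖⁻¹)
      ((eventually_gt_atTop 0).mono fun δ hδ => ?_) ?_
    · rw [integral_exp_mul_complex hI, norm_smul, norm_div, Real.norm_of_nonneg (by positivity)]
      have h2 : ‖Complex.exp (Complex.I * β * δ) - Complex.exp (Complex.I * β * ((-δ : ℝ) : ℂ))‖ ≤ 2 :=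
        (norm_sub_le _ _).trans (by rw [hb, hb]; norm_num)
      calc (2 * δ)⁻¹ * (_ / ‖Complex.I * β‖) ≤ (2 * δ)⁻¹ * (2 / ‖Complex.I * β‖) := by gcongr
        _ = δ⁻¹ * ‖Complex.I * β‖⁻¹ := by field_simp
    · simpa using tendsto_inv_atTop_zero.mul_const (‖Complex.I * β‖⁻¹)

variable {Ω}

/-- Weyl equidistribution for the winding, twisted by a character of the line which does not
resonate with a nontrivial character of the torus. -/
theorem hasMean_exp_mul_comp_winding {α : ℝ} (hα : ∀ n, α + dotFreq Ω n = 0 → n = 0)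
    (F : C(UnitAddTorus (Fin r), ℂ)) :
    HasMean (fun s : ℝ => Complex.exp (Complex.I * α * s) * F (winding Ω s))
      (if α = 0 then ∫ θ, F θ else 0) := by
  have hcont : ∀ F : C(UnitAddTorus (Fin r), ℂ),
      Continuous fun s : ℝ => Complex.exp (Complex.I * α * s) * F (winding Ω s) := fun F =>
    (by fun_prop : Continuous fun s : ℝ => Complex.exp (Complex.I * α * s)).mul
      (F.continuous.comp (OpenSystem.continuous_winding Ω))
  have hFi : ∀ F : C(UnitAddTorus (Fin r), ℂ), Integrable (fun θ => F θ) := fun F =>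
    F.continuous.integrable_of_hasCompactSupport (HasCompactSupport.of_compactSpace _)
  let L : C(UnitAddTorus (Fin r), ℂ) →ₗ[ℂ] ℂ :=
    { toFun := fun F => if α = 0 then ∫ θ, F θ else 0
      map_add' := fun F G => by
        split_ifs
        · exact integral_add (hFi F) (hFi G)
        · simp
      map_smul' := fun c F => by
        split_ifs
        · exact integral_const_mul c _
        · simp }
  have hL : ∀ F, ‖L F‖ ≤ ‖F‖ := by
    intro F
    change ‖if α = 0 then ∫ θ, F θ else 0‖ ≤ _
    split_ifs
    · refine (norm_integral_le_of_norm_le_const (C := ‖F‖)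
        (Eventually.of_forall fun θ => F.norm_coe_le_norm θ)).trans ?_
      simp
    · simp
  let A : ℝ → C(UnitAddTorus (Fin r), ℂ) → ℂ := fun δ F =>
    (2 * δ)⁻¹ • ∫ s in (-δ)..δ, Complex.exp (Complex.I * α * s) * F (winding Ω s)
  have hAsub : ∀ δ F G, A δ (F - G) = A δ F - A δ G := by
    intro δ F G
    simp only [A, ContinuousMap.sub_apply, mul_sub]
    rw [intervalIntegral.integral_sub ((hcont F).intervalIntegrable _ _)
      ((hcont G).intervalIntegrable _ _), smul_sub]
  have hA : ∀ δ : ℝ, 0 < δ → ∀ F, ‖A δ F‖ ≤ ‖F‖ := by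
    intro δ hδ F
    have h1 : ∀ s : ℝ, ‖Complex.exp (Complex.I * α * s)‖ = 1 := fun x => by
      rw [Complex.norm_exp]; simp
    have h := intervalIntegral.norm_integral_le_of_norm_le_const (a := -δ) (b := δ) (C := ‖F‖)
      (f := fun s : ℝ => Complex.exp (Complex.I * α * s) * F (winding Ω s)) (fun s _ => by
        rw [norm_mul, h1, one_mul]; exact F.norm_coe_le_norm _)
    rw [norm_smul, Real.norm_of_nonneg (by positivity)]
    rw [sub_neg_eq_add, abs_of_pos (by positivity)] at h
    calc _ ≤ (2 * δ)⁻¹ * (‖F‖ * (δ + δ)) := by gcongr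
      _ = ‖F‖ := by field_simp; ring
  -- The functions for which the claim holds form a closed subspace, which contains all characters.
  let S : Submodule ℂ C(UnitAddTorus (Fin r), ℂ) :=
    { carrier := {F | Tendsto (fun δ => A δ F) atTop (𝓝 (L F))}
      add_mem' := fun {F G} hF hG => by
        rw [Set.mem_ofPred_eq, map_add]
        refine (Tendsto.add hF hG).congr fun δ => ?_
        have := hAsub δ (F + G) G
        rw [add_sub_cancel_right] at this
        rw [this]; ring
      zero_mem' := by simp [A]
      smul_mem' := fun c F hF => by
        rw [Set.mem_ofPred_eq, map_smul]
        refine (Tendsto.const_smul hF c).congr fun δ => ?_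
        simp only [A, ContinuousMap.smul_apply, smul_eq_mul, mul_left_comm _ c]
        rw [intervalIntegral.integral_const_mul, Complex.real_smul, Complex.real_smul]
        ring }
  have hclosed : IsClosed (S : Set C(UnitAddTorus (Fin r), ℂ)) := by
    refine isClosed_of_closure_subset fun F hF => Metric.tendsto_nhds.2 fun e he => ?_
    obtain ⟨G, hG, hFG⟩ := Metric.mem_closure_iff.1 hF (e / 3) (by positivity)
    rw [dist_eq_norm] at hFG
    filter_upwards [Metric.tendsto_nhds.1 hG (e / 3) (by positivity), eventually_gt_atTop 0]
      with δ h1 hδ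
    have h2 := hA δ hδ (F - G)
    have h3 := hL (F - G)
    rw [hAsub] at h2
    rw [map_sub] at h3
    rw [dist_eq_norm] at h1 ⊢
    have e1 : A δ F - L F = (A δ F - A δ G) + (A δ G - L G) - (L F - L G) := by ring
    rw [e1]
    calc _ ≤ ‖A δ F - A δ G‖ + ‖A δ G - L G‖ + ‖L F - L G‖ :=
          (norm_sub_le _ _).trans (by gcongr; exact norm_add_le _ _)
      _ < e := by linarith
  have htop : S = ⊤ := by
    refine top_unique ?_
    rw [← span_mFourier_closure_eq_top]
    refine Submodule.topologicalClosure_minimal _ (Submodule.span_le.2 ?_) hclosed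
    rintro _ ⟨n, rfl⟩
    change Tendsto (fun δ => A δ (mFourier n)) atTop (𝓝 (if α = 0 then ∫ θ, mFourier n θ else 0))
    have h := (hasMean_exp (α + dotFreq Ω n)).2
    have e : (if α + dotFreq Ω n = 0 then (1 : ℂ) else 0)
        = if α = 0 then ∫ θ, mFourier n θ else 0 := by
      rw [integral_mFourier]
      by_cases hn : n = 0
      · subst hn; simp [dotFreq]
      · have := fun h => hn (hα n h)
        simp only [if_neg this, if_neg hn, ite_self]
    rw [← e]
    refine h.congr fun δ => ?_
    simp only [A, mFourier_winding, ← Complex.exp_add]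
    congr 2
    funext s
    congr 1
    push_cast
    ring
  have : F ∈ S := by rw [htop]; trivial
  exact ⟨hcont F, this⟩

/-- Parseval's identity for continuous functions on the torus. -/
theorem hasSum_conj_mFourierCoeff_mul (F G : C(UnitAddTorus (Fin r), ℂ)) :
    HasSum (fun n => starRingEnd ℂ (mFourierCoeff F n) * mFourierCoeff G n)
      (∫ θ, starRingEnd ℂ (F θ) * G θ) := by
  have h := hasSum_prod_mFourierCoeff (F.toLp 2 volume ℂ) (G.toLp 2 volume ℂ)
  simp only [mFourierCoeff_toLp] at h
  convert h using 1
  refine integral_congr_ae ?_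
  filter_upwards [ContinuousMap.coeFn_toLp (p := 2) (𝕜 := ℂ) volume F,
    ContinuousMap.coeFn_toLp (p := 2) (𝕜 := ℂ) volume G] with θ h1 h2
  rw [h1, h2]

end Torus

end

/-! ### Averaged correlations of quasiperiodic functions -/

section

open MeasureTheory Filter Topology UnitAddTorus

section Correlation

attribute [local instance] instMeasureSpaceUnitAddCircle instIsAddHaarMeasureUnitAddCircleVolume
  instIsProbabilityMeasureUnitAddCircleVolume

variable {r : ℕ} {Ω : Fin r → ℝ}

theorem integrable_mFourier_mul (n : Fin r → ℤ) (F : C(UnitAddTorus (Fin r), ℂ)) :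
    Integrable (fun θ => mFourier n θ • F θ) :=
  ((mFourier n).continuous.smul F.continuous).integrable_of_hasCompactSupport
    (HasCompactSupport.of_compactSpace _)

/-- The `n`-th Fourier coefficient as a bounded functional. -/
def mFourierCoeffL (n : Fin r → ℤ) : C(UnitAddTorus (Fin r), ℂ) →L[ℂ] ℂ :=
  LinearMap.mkContinuous
    { toFun := fun F => mFourierCoeff F n
      map_add' := fun F G => by
        simp only [mFourierCoeff, ContinuousMap.add_apply, smul_add]
        exact integral_add (integrable_mFourier_mul _ F) (integrable_mFourier_mul _ G)
      map_smul' := fun c F => by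
        simp only [mFourierCoeff, ContinuousMap.smul_apply, smul_comm _ c]
        exact integral_smul c _ }
    1 (fun F => by
      refine (norm_integral_le_of_norm_le_const (C := ‖F‖)
        (Eventually.of_forall fun θ => ?_)).trans (by simp)
      rw [norm_smul]
      have h1 := (mFourier (-n)).norm_coe_le_norm θ
      rw [mFourier_norm] at h1
      exact (mul_le_of_le_one_left (norm_nonneg _) h1).trans (F.norm_coe_le_norm θ))

theorem mFourierCoeffL_apply (n : Fin r → ℤ) (F : C(UnitAddTorus (Fin r), ℂ)) :
    mFourierCoeffL n F = mFourierCoeff F n := rfl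

variable (Ω) in
/-- The translates of a function on the torus along the winding. -/
def translate (G : C(UnitAddTorus (Fin r), ℂ)) (x : ℝ) : C(UnitAddTorus (Fin r), ℂ) :=
  ⟨fun θ => G (θ + winding Ω x), G.continuous.comp (continuous_id.add continuous_const)⟩

theorem continuous_translate (G : C(UnitAddTorus (Fin r), ℂ)) : Continuous (translate Ω G) := by
  refine ContinuousMap.continuous_of_continuous_uncurry _ ?_
  exact G.continuous.comp (continuous_snd.add
    ((OpenSystem.continuous_winding Ω).comp continuous_fst))

theorem norm_translate_le (G : C(UnitAddTorus (Fin r), ℂ)) (x : ℝ) : ‖translate Ω G x‖ ≤ ‖G‖ :=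
  (ContinuousMap.norm_le _ (norm_nonneg _)).2 fun _ => G.norm_coe_le_norm _

theorem mFourierCoeff_translate (G : C(UnitAddTorus (Fin r), ℂ)) (x : ℝ) (n : Fin r → ℤ) :
    mFourierCoeff (translate Ω G x) n
      = Complex.exp (Complex.I * dotFreq Ω n * x) * mFourierCoeff G n := by
  have h := integral_add_right_eq_self (μ := (volume : Measure (UnitAddTorus (Fin r))))
    (fun θ => mFourier (-n) (θ - winding Ω x) • G θ) (winding Ω x)
  simp only [add_sub_cancel_right] at h
  refine h.trans ?_
  rw [mFourierCoeff, ← mFourier_winding, ← integral_const_mul]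
  refine integral_congr_ae (Eventually.of_forall fun θ => ?_)
  have e : mFourier (-n) (θ - winding Ω x) = mFourier n (winding Ω x) * mFourier (-n) θ := by
    have hm : ∀ θ θ' : UnitAddTorus (Fin r),
        mFourier n (θ + θ') = mFourier n θ * mFourier n θ' := by
      intro θ θ'
      simp only [mFourier, ContinuousMap.coe_mk, ← Finset.prod_mul_distrib]
      refine Finset.prod_congr rfl fun i _ => ?_
      simp [fourier_apply, smul_add, AddCircle.toCircle_add]
    have hneg : ∀ θ : UnitAddTorus (Fin r), mFourier (-n) θ = mFourier n (-θ) := by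
      intro θ
      simp only [mFourier, ContinuousMap.coe_mk]
      refine Finset.prod_congr rfl fun i _ => ?_
      simp [fourier_apply]
    rw [hneg, hneg, neg_sub, sub_eq_add_neg, hm]
  simp only [e, smul_eq_mul]
  ring

theorem integrableOn_conj {f : ℝ → ℂ} {s : Set ℝ} (hf : IntegrableOn f s) :
    IntegrableOn (fun x => starRingEnd ℂ (f x)) s :=
  Complex.conjCLE.toContinuousLinearMap.integrable_comp hf

/-- The time average of a correlation `∫₀^∞ f(x) a(s) b(x+s)* dx`, where
`a(s) = e^{iw's} a(Ωs)` and `b(s) = e^{iws} b(Ωs)`, by Parseval's identity on the torus. -/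
theorem exists_hasMean_correlation {f : ℝ → ℂ} (hf : IntegrableOn f (Set.Ioi 0)) {w w' : ℝ}
    (hα : ∀ n, w' - w + dotFreq Ω n = 0 → n = 0) (a b : C(UnitAddTorus (Fin r), ℂ)) :
    ∃ L, HasMean (fun s : ℝ => ∫ x in Set.Ioi (0 : ℝ), f x *
        (Complex.exp (Complex.I * w' * s) * a (winding Ω s) *
          starRingEnd ℂ (Complex.exp (Complex.I * w * (x + s : ℝ)) * b (winding Ω (x + s))))) L ∧
      HasSum (fun n => if w' = w then
        (∫ x in Set.Ioi (0 : ℝ), f x * Complex.exp (-(Complex.I * (w + dotFreq Ω n : ℝ) * x))) *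
          (mFourierCoeff a n * starRingEnd ℂ (mFourierCoeff b n)) else 0) L := by
  -- `H` is the Bochner integral of translates of `b`, conjugate to the inner integral over `x`.
  set F : ℝ → C(UnitAddTorus (Fin r), ℂ) := fun x =>
    (starRingEnd ℂ (f x) * Complex.exp (Complex.I * w * x)) • translate Ω b x with hF
  have hexp : Continuous fun x : ℝ => Complex.exp (Complex.I * w * x) := by fun_prop
  have hn1 : ∀ (v x : ℝ), ‖Complex.exp (Complex.I * v * x)‖ = 1 := fun v x => by
    rw [Complex.norm_exp]; simp
  have hFi : IntegrableOn F (Set.Ioi 0) := by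
    refine Integrable.mono' (hf.norm.mul_const ‖b‖)
      (((integrableOn_conj hf).aestronglyMeasurable.mul hexp.aestronglyMeasurable).smul
        (continuous_translate b).aestronglyMeasurable) (Eventually.of_forall fun x => ?_)
    rw [hF, norm_smul, norm_mul, hn1, mul_one, RCLike.norm_conj]
    exact mul_le_mul_of_nonneg_left (norm_translate_le b x) (norm_nonneg _)
  set H : C(UnitAddTorus (Fin r), ℂ) := ∫ x in Set.Ioi (0 : ℝ), F x with hH
  have hHθ : ∀ θ, H θ = ∫ x in Set.Ioi (0 : ℝ),
      starRingEnd ℂ (f x) * Complex.exp (Complex.I * w * x) * b (θ + winding Ω x) := fun θ =>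
    ((ContinuousMap.evalCLM ℂ θ).integral_comp_comm hFi).symm
  have hHn : ∀ n, mFourierCoeff H n = ∫ x in Set.Ioi (0 : ℝ),
      starRingEnd ℂ (f x) * Complex.exp (Complex.I * w * x) *
        (Complex.exp (Complex.I * dotFreq Ω n * x) * mFourierCoeff b n) := by
    intro n
    refine ((mFourierCoeffL n).integral_comp_comm hFi).symm.trans ?_
    refine integral_congr_ae (Eventually.of_forall fun x => ?_)
    simp only [hF, map_smul, smul_eq_mul, mFourierCoeffL_apply, mFourierCoeff_translate]
  refine ⟨if w' - w = 0 then ∫ θ, starRingEnd ℂ (H θ) * a θ else 0, ?_, ?_⟩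
  · have h := hasMean_exp_mul_comp_winding hα (star H * a)
    convert h using 1
    swap
    · rfl
    funext s
    have e1 : (star H * a) (winding Ω s) = starRingEnd ℂ (H (winding Ω s)) * a (winding Ω s) := rfl
    rw [e1, hHθ, ← integral_conj, ← integral_mul_const, ← integral_const_mul]
    refine integral_congr_ae (Eventually.of_forall fun x => ?_)
    simp only [map_mul, Complex.conj_conj, ← Complex.exp_conj, Complex.conj_ofReal, Complex.conj_I]
    rw [add_comm (winding Ω s), ← winding_add]
    have e2 : Complex.exp (Complex.I * ((w' - w : ℝ) : ℂ) * s) =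
        Complex.exp (Complex.I * w' * s) * Complex.exp (-(Complex.I * w * s)) := by
      rw [← Complex.exp_add]; congr 1; push_cast; ring
    have e3 : Complex.exp (-Complex.I * w * ((x + s : ℝ) : ℂ)) =
        Complex.exp (-Complex.I * w * x) * Complex.exp (-(Complex.I * w * s)) := by
      rw [← Complex.exp_add]; congr 1; push_cast; ring
    rw [e2, e3]
    ring
  · by_cases hw : w' = w
    · simp only [hw, if_true, sub_self]
      refine (hasSum_conj_mFourierCoeff_mul H a).congr_fun fun n => ?_
      rw [hHn, ← integral_conj]
      simp only [map_mul, Complex.conj_conj, ← Complex.exp_conj, Complex.conj_ofReal,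
        Complex.conj_I]
      rw [← integral_mul_const, ← integral_mul_const]
      refine integral_congr_ae (Eventually.of_forall fun x => ?_)
      have e2 : Complex.exp (-(Complex.I * ((w + dotFreq Ω n : ℝ) : ℂ) * x)) =
          Complex.exp (-Complex.I * w * x) * Complex.exp (-Complex.I * dotFreq Ω n * x) := by
        rw [← Complex.exp_add]; congr 1; push_cast; ring
      simp only
      rw [e2]
      ring
    · simp only [if_neg hw, if_neg (sub_ne_zero.2 hw)]
      exact hasSum_zero

theorem integrableOn_correlation {f : ℝ → ℂ} (hf : IntegrableOn f (Set.Ioi 0)) (w w' : ℝ)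
    (a b : C(UnitAddTorus (Fin r), ℂ)) (s : ℝ) :
    IntegrableOn (fun x : ℝ => f x *
        (Complex.exp (Complex.I * w' * s) * a (winding Ω s) *
          starRingEnd ℂ (Complex.exp (Complex.I * w * (x + s : ℝ)) * b (winding Ω (x + s)))))
      (Set.Ioi 0) := by
  have hc : Continuous fun x : ℝ => Complex.exp (Complex.I * w' * s) * a (winding Ω s) *
      starRingEnd ℂ (Complex.exp (Complex.I * w * (x + s : ℝ)) * b (winding Ω (x + s))) := by
    have h1 : Continuous fun x : ℝ => b (winding Ω (x + s)) :=
      b.continuous.comp ((OpenSystem.continuous_winding Ω).comp (by fun_prop))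
    have h2 : Continuous fun x : ℝ => Complex.exp (Complex.I * w * (x + s : ℝ)) := by fun_prop
    exact continuous_const.mul (Complex.continuous_conj.comp (h2.mul h1))
  have hn1 : ∀ (v x : ℝ), ‖Complex.exp (Complex.I * v * x)‖ = 1 := fun v x => by
    rw [Complex.norm_exp]; simp
  refine Integrable.mono' (hf.norm.mul_const (‖a‖ * ‖b‖))
    (hf.aestronglyMeasurable.mul hc.aestronglyMeasurable) (Eventually.of_forall fun x => ?_)
  rw [norm_mul, norm_mul, norm_mul, RCLike.norm_conj, norm_mul, hn1, hn1, one_mul, one_mul]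
  gcongr
  · exact a.norm_coe_le_norm _
  · exact b.norm_coe_le_norm _

end Correlation

end

/-! ### Correlation functions of the environment -/

section

open MeasureTheory Filter Topology

section PositiveDefinite

/-- The easy half of Bochner's theorem: an integrable function of positive type has a nonnegative
integral. -/
theorem integral_nonneg_of_positive_type {q : ℝ → ℂ} (hc : Continuous q) (hi : Integrable q)
    (hpos : ∀ T : ℝ, 0 < T → 0 ≤ ∫ s in (0 : ℝ)..T, ∫ t in (0 : ℝ)..T, q (t - s)) :
    0 ≤ ∫ x, q x := by
  have hQ : Continuous fun ab : ℝ × ℝ => ∫ x in ab.1..ab.2, q x := by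
    have h1 : Continuous fun a : ℝ => ∫ x in (0 : ℝ)..a, q x :=
      intervalIntegral.continuous_primitive (fun a b => hc.intervalIntegrable a b) 0
    have e : (fun ab : ℝ × ℝ => ∫ x in ab.1..ab.2, q x)
        = fun ab => (∫ x in (0 : ℝ)..ab.2, q x) - ∫ x in (0 : ℝ)..ab.1, q x := by
      funext ab
      rw [intervalIntegral.integral_interval_sub_left (hc.intervalIntegrable _ _)
        (hc.intervalIntegrable _ _)]
    rw [e]
    exact (h1.comp continuous_snd).sub (h1.comp continuous_fst)
  -- After division by `T` and the substitution `s = v T`, `t = x + v T`, the double integral is an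
  -- average over `v` of integrals of `q` over intervals which exhaust the line.
  have hlim : Tendsto (fun T : ℝ => ∫ v in (0 : ℝ)..1, ∫ x in (-(v * T))..((1 - v) * T), q x) atTop
      (𝓝 (∫ v in (0 : ℝ)..1, ∫ x, q x)) := by
    refine intervalIntegral.tendsto_integral_filter_of_dominated_convergence
      (fun _ => ∫ x, ‖q x‖) (Eventually.of_forall fun T => ?_)
      (Eventually.of_forall fun T => ae_of_all _ fun v _ => ?_)
      (by simp) ?_
    · exact (hQ.comp (by fun_prop : Continuous fun v : ℝ =>
        (-(v * T), (1 - v) * T))).aestronglyMeasurable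
    · refine intervalIntegral.norm_integral_le_integral_norm_uIoc.trans ?_
      exact setIntegral_le_integral hi.norm (ae_of_all _ fun _ => norm_nonneg _)
    · have h1 : ∀ᵐ v : ℝ, v ≠ 1 := by simp [ae_iff]
      filter_upwards [h1] with v hv1 hv
      rw [Set.uIoc_of_le zero_le_one] at hv
      have hv2 : v < 1 := lt_of_le_of_ne hv.2 hv1
      refine intervalIntegral_tendsto_integral hi ?_ ?_
      · exact tendsto_neg_atTop_atBot.comp (tendsto_id.const_mul_atTop hv.1)
      · exact tendsto_id.const_mul_atTop (sub_pos.2 hv2)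
  rw [intervalIntegral.integral_const, sub_zero, one_smul] at hlim
  refine ge_of_tendsto hlim ((eventually_gt_atTop 0).mono fun T hT => ?_)
  have h := hpos T hT
  have e : ∫ s in (0 : ℝ)..T, ∫ t in (0 : ℝ)..T, q (t - s)
      = T • ∫ v in (0 : ℝ)..1, ∫ x in (-(v * T))..((1 - v) * T), q x := by
    have h1 := intervalIntegral.smul_integral_comp_mul_right (a := 0) (b := 1)
      (fun s : ℝ => ∫ t in (0 : ℝ)..T, q (t - s)) T
    rw [zero_mul, one_mul] at h1
    rw [← h1]
    congr 1
    refine intervalIntegral.integral_congr fun v _ => ?_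
    rw [intervalIntegral.integral_comp_sub_right (fun x => q x)]
    congr 1 <;> ring
  rw [e, Complex.real_smul] at h
  have hT' : (0 : ℂ) < ((T⁻¹ : ℝ) : ℂ) := by exact_mod_cast inv_pos.2 hT
  have h2 := mul_nonneg hT'.le h
  rwa [← mul_assoc, ← Complex.ofReal_mul, inv_mul_cancel₀ hT.ne', Complex.ofReal_one,
    one_mul] at h2

end PositiveDefinite

namespace OpenSystem

variable {r d m : ℕ} {E : Type*} [NormedAddCommGroup E] [InnerProductSpace ℂ E] [CompleteSpace E]
variable (M : OpenSystem r d m E)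

/-- The state `B ↦ tr(B ω_E)` on the bounded operators of the environment. -/
def expect : (E →L[ℂ] E) →L[ℂ] ℂ :=
  (TraceClass.trace ∘L (ContinuousLinearMap.apply ℂ _ M.ωE)) ∘L (TraceClass.sandwichL E E).flip 1

theorem expect_apply (B : E →L[ℂ] E) :
    M.expect B = TraceClass.trace (TraceClass.sandwich B 1 M.ωE) := rfl

/-- The operator `e^{itH_E} B e^{-itH_E}` in the Heisenberg picture. -/
def heisenberg (t : ℝ) (B : E →L[ℂ] E) : E →L[ℂ] E := M.envU (-t) * B * M.envU t

variable {M}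

theorem nonneg_ωE (hM : M.Assumptions) : 0 ≤ M.ωE.val :=
  (ContinuousLinearMap.nonneg_iff_isPositive _).2 hM.positive_ωE

theorem expect_star (hM : M.Assumptions) (B : E →L[ℂ] E) :
    M.expect (star B) = starRingEnd ℂ (M.expect B) := by
  rw [expect_apply, expect_apply, TraceClass.trace_comm B, ← TraceClass.trace_adj]
  congr 1
  refine TraceClass.ext ?_
  rw [TraceClass.val_adj, TraceClass.val_sandwich, TraceClass.val_sandwich]
  change star B * (M.ωE.val * 1) = star (1 * (M.ωE.val * B))
  rw [mul_one, one_mul, star_mul, (nonneg_ωE hM).isSelfAdjoint.star_eq]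

theorem expect_star_mul_self_nonneg (hM : M.Assumptions) (B : E →L[ℂ] E) :
    0 ≤ M.expect (star B * B) := by
  rw [expect_apply, ← TraceClass.trace_sandwich]
  refine TraceClass.trace_nonneg ?_
  rw [TraceClass.val_sandwich]
  change 0 ≤ B * (M.ωE.val * star B)
  rw [← mul_assoc]
  exact star_right_conjugate_nonneg (nonneg_ωE hM) B

theorem expect_heisenberg (hM : M.Assumptions) (t : ℝ) (B : E →L[ℂ] E) :
    M.expect (M.heisenberg t B) = M.expect B := by
  rw [expect_apply, expect_apply, heisenberg, mul_assoc, ← TraceClass.trace_sandwich]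
  have h := TraceClass.sandwich_sandwich (M.envU t) (M.envU (-t)) B 1 M.ωE
  rw [sandwich_envU_ωE hM] at h
  rw [h]
  rfl

theorem heisenberg_mul (t : ℝ) (B C : E →L[ℂ] E) :
    M.heisenberg t B * M.heisenberg t C = M.heisenberg t (B * C) := by
  have h : M.envU t * M.envU (-t) = 1 := by rw [envU_mul, add_neg_cancel, envU_zero]
  calc M.envU (-t) * B * M.envU t * (M.envU (-t) * C * M.envU t)
      = M.envU (-t) * B * (M.envU t * M.envU (-t)) * C * M.envU t := by noncomm_ring
    _ = _ := by rw [h, heisenberg]; noncomm_ring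

theorem heisenberg_heisenberg (s t : ℝ) (B : E →L[ℂ] E) :
    M.heisenberg s (M.heisenberg t B) = M.heisenberg (s + t) B := by
  have h1 : M.envU (-(s + t)) = M.envU (-s) * M.envU (-t) := by rw [envU_mul, neg_add]
  have h2 : M.envU (s + t) = M.envU t * M.envU s := by rw [envU_mul, add_comm]
  rw [heisenberg, heisenberg, heisenberg, h1, h2]
  noncomm_ring

theorem star_heisenberg (hM : M.Assumptions) (t : ℝ) (B : E →L[ℂ] E) :
    star (M.heisenberg t B) = M.heisenberg t (star B) := by
  rw [heisenberg, heisenberg, star_mul, star_mul, star_envU hM, star_envU hM, neg_neg, mul_assoc]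

theorem continuous_heisenberg (B : E →L[ℂ] E) : Continuous fun t => M.heisenberg t B :=
  ((M.continuous_envU.comp continuous_neg).mul continuous_const).mul M.continuous_envU

theorem heisenberg_sum {ι : Type*} (s : Finset ι) (t : ℝ) (B : ι → E →L[ℂ] E) :
    M.heisenberg t (∑ i ∈ s, B i) = ∑ i ∈ s, M.heisenberg t (B i) := by
  simp only [heisenberg, Finset.mul_sum, Finset.sum_mul]

theorem heisenberg_smul (t : ℝ) (c : ℂ) (B : E →L[ℂ] E) :
    M.heisenberg t (c • B) = c • M.heisenberg t B := by
  simp only [heisenberg, mul_smul_comm, smul_mul_assoc]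

theorem f_eq (μ ν : Fin m) (t : ℝ) :
    M.f μ ν t = M.expect (M.heisenberg t (star (M.R μ)) * M.R ν) := by
  rw [expect_apply, f, heisenberg]
  rfl

/-- The two-point functions of the environment are stationary. -/
theorem expect_heisenberg_mul_heisenberg (hM : M.Assumptions) (μ ν : Fin m) (s t : ℝ) :
    M.expect (M.heisenberg t (star (M.R μ)) * M.heisenberg s (M.R ν)) = M.f μ ν (t - s) := by
  have h : M.heisenberg t (star (M.R μ)) = M.heisenberg s (M.heisenberg (t - s) (star (M.R μ))) := by
    rw [heisenberg_heisenberg, add_sub_cancel]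
  rw [h, heisenberg_mul, expect_heisenberg hM, f_eq]

/-- Follows from stationarity and `tr (B† ω_E) = conj (tr (B ω_E))`. -/
theorem f_neg (hM : M.Assumptions) (μ ν : Fin m) (x : ℝ) :
    M.f μ ν (-x) = starRingEnd ℂ (M.f ν μ x) := by
  have h1 := expect_heisenberg_mul_heisenberg hM μ ν x 0
  have h2 := expect_heisenberg_mul_heisenberg hM ν μ 0 x
  rw [zero_sub] at h1
  rw [sub_zero] at h2
  rw [← h1, ← h2, ← expect_star hM, star_mul, star_heisenberg hM, star_heisenberg hM, star_star]

theorem continuous_f (μ ν : Fin m) : Continuous (M.f μ ν) := by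
  rw [show M.f μ ν = fun t => M.expect (M.heisenberg t (star (M.R μ)) * M.R ν) from
    funext (f_eq μ ν)]
  exact M.expect.continuous.comp ((continuous_heisenberg _).mul continuous_const)

theorem integrable_f (hM : M.Assumptions) (μ ν : Fin m) : Integrable (M.f μ ν) := by
  rw [← integrableOn_univ, ← Set.Iic_union_Ioi (a := (0 : ℝ))]
  refine IntegrableOn.union ?_ (hM.integrable_f μ ν)
  rw [integrableOn_Iic_iff_integrableOn_Iio]
  have h : IntegrableOn (fun x => M.f μ ν (-x)) (Set.Ioi (-0)) := by
    simp only [f_neg hM, neg_zero]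
    exact integrableOn_conj (hM.integrable_f ν μ)
  simpa using h.comp_neg_Iio

theorem norm_exp_neg_I (w x : ℝ) : ‖Complex.exp (-(Complex.I * w * x))‖ = 1 := by
  rw [Complex.norm_exp]; simp

theorem continuous_exp_neg_I (w : ℝ) :
    Continuous fun x : ℝ => Complex.exp (-(Complex.I * w * x)) := by fun_prop

theorem integrable_f_mul_exp (hM : M.Assumptions) (μ ν : Fin m) (w : ℝ) :
    Integrable (fun x : ℝ => M.f μ ν x * Complex.exp (-(Complex.I * w * x))) :=
  (integrable_f hM μ ν).mono
    ((continuous_f μ ν).mul (continuous_exp_neg_I w)).aestronglyMeasurable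
    (ae_of_all _ fun x => by rw [norm_mul, norm_exp_neg_I, mul_one])

theorem h_eq (hM : M.Assumptions) (μ ν : Fin m) (w : ℝ) :
    M.h μ ν w = M.halfFourier μ ν w + starRingEnd ℂ (M.halfFourier ν μ w) := by
  have hi := integrable_f_mul_exp hM μ ν w
  rw [h, ← intervalIntegral.integral_Iic_add_Ioi hi.integrableOn hi.integrableOn (b := 0), add_comm]
  congr 1
  have e := integral_comp_neg_Ioi 0
    (fun x : ℝ => M.f μ ν x * Complex.exp (-(Complex.I * w * x)))
  rw [neg_zero] at e
  rw [← e, halfFourier, ← integral_conj]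
  refine integral_congr_ae (ae_of_all _ fun x => ?_)
  simp only [f_neg hM, map_mul, ← Complex.exp_conj, map_neg, Complex.conj_I, Complex.conj_ofReal]
  congr 2
  push_cast
  ring

theorem halfFourier_eq (μ ν : Fin m) (w : ℝ) :
    M.halfFourier μ ν w = M.h μ ν w / 2 + Complex.I * M.ζ μ ν w := by
  rw [ζ]
  field_simp
  ring

theorem conj_h (hM : M.Assumptions) (μ ν : Fin m) (w : ℝ) :
    starRingEnd ℂ (M.h μ ν w) = M.h ν μ w := by
  rw [h_eq hM, h_eq hM, map_add, Complex.conj_conj, add_comm]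

theorem conj_ζ (hM : M.Assumptions) (μ ν : Fin m) (w : ℝ) :
    starRingEnd ℂ (M.ζ μ ν w) = M.ζ ν μ w := by
  rw [ζ, ζ, map_div₀, map_sub, map_div₀, conj_h hM, Complex.conj_I, h_eq hM]
  simp only [Complex.conj_ofNat]
  have hI := Complex.I_ne_zero
  field_simp
  ring

theorem isHermitian_ζ (hM : M.Assumptions) (w : ℝ) :
    (Matrix.of fun μ ν => M.ζ μ ν w).IsHermitian :=
  Matrix.IsHermitian.ext fun μ ν => conj_ζ hM ν μ w

/-- The functions `x ↦ ∑ conj c_μ c_ν f_{μν}(x) e^{-iωx}` are of positive type. -/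
theorem posSemidef_h (hM : M.Assumptions) (w : ℝ) :
    (Matrix.of fun μ ν => M.h μ ν w).PosSemidef := by
  refine Matrix.posSemidef_iff_dotProduct_mulVec.2
    ⟨Matrix.IsHermitian.ext fun μ ν => conj_h hM ν μ w, fun c => ?_⟩
  set Rc : E →L[ℂ] E := ∑ ν, c ν • M.R ν with hRc
  set q : ℝ → ℂ := fun x => M.expect (M.heisenberg x (star Rc) * Rc) *
    Complex.exp (-(Complex.I * w * x)) with hq
  have hqf : ∀ x, q x = ∑ μ, ∑ ν, (starRingEnd ℂ (c μ) * c ν) *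
      (M.f μ ν x * Complex.exp (-(Complex.I * w * x))) := by
    intro x
    simp only [hq, hRc, star_sum, star_smul, heisenberg_sum, heisenberg_smul, Finset.sum_mul,
      Finset.mul_sum, map_sum, smul_mul_assoc, mul_smul_comm, map_smul, ← f_eq, smul_eq_mul,
      RCLike.star_def]
    rw [Finset.sum_comm]
    refine Finset.sum_congr rfl fun μ _ => Finset.sum_congr rfl fun ν _ => ?_
    ring
  have hqi : Integrable q := by
    rw [show q = _ from funext hqf]
    exact integrable_finsetSum _ fun μ _ => integrable_finsetSum _ fun ν _ =>
      (integrable_f_mul_exp hM μ ν w).const_mul _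
  have hqc : Continuous q :=
    (M.expect.continuous.comp ((continuous_heisenberg _).mul continuous_const)).mul
      (continuous_exp_neg_I w)
  have hsum : star c ⬝ᵥ ((Matrix.of fun μ ν => M.h μ ν w).mulVec c) = ∫ x, q x := by
    rw [show q = _ from funext hqf, integral_finsetSum _ fun μ _ => integrable_finsetSum _ fun ν _ =>
      (integrable_f_mul_exp hM μ ν w).const_mul _]
    simp only [dotProduct, Matrix.mulVec, Finset.mul_sum, Matrix.of_apply]
    refine Finset.sum_congr rfl fun μ _ => ?_
    rw [integral_finsetSum _ fun ν _ => (integrable_f_mul_exp hM μ ν w).const_mul _]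
    refine Finset.sum_congr rfl fun ν _ => ?_
    rw [integral_const_mul, h, Pi.star_apply, RCLike.star_def]
    ring
  rw [hsum]
  refine integral_nonneg_of_positive_type hqc hqi fun T _ => ?_
  -- The double integral is `tr (C† C ω_E)` for `C` the integral of `B` over `[0, T]`.
  set B : ℝ → E →L[ℂ] E := fun t => Complex.exp (Complex.I * w * t) • M.heisenberg t Rc with hB
  have hBc : Continuous B :=
    (by fun_prop : Continuous fun t : ℝ => Complex.exp (Complex.I * w * t)).smul
      (continuous_heisenberg _)
  have hqB : ∀ s t, q (t - s) = M.expect (star (B t) * B s) := by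
    intro s t
    have h1 : M.heisenberg t (star Rc) = M.heisenberg s (M.heisenberg (t - s) (star Rc)) := by
      rw [heisenberg_heisenberg, add_sub_cancel]
    simp only [hB, star_smul, smul_mul_assoc, mul_smul_comm, map_smul, star_heisenberg hM, h1,
      heisenberg_mul, expect_heisenberg hM, smul_smul, smul_eq_mul, hq, RCLike.star_def,
      ← Complex.exp_conj, map_mul, Complex.conj_I, Complex.conj_ofReal]
    rw [mul_comm, ← Complex.exp_add]
    congr 2
    push_cast
    ring
  have hBi : IntervalIntegrable B volume 0 T := hBc.intervalIntegrable _ _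
  have h1 : ∀ s, ∫ t in (0 : ℝ)..T, M.expect (star (B t) * B s)
      = M.expect (star (∫ t in (0 : ℝ)..T, B t) * B s) := by
    intro s
    have hL := (((M.expect ∘L (ContinuousLinearMap.mul ℂ _).flip (B s)).restrictScalars ℝ) ∘L
      (starL' ℝ : (E →L[ℂ] E) ≃L[ℝ] (E →L[ℂ] E)).toContinuousLinearMap).intervalIntegral_comp_comm
        hBi
    exact hL
  have h2 := ((M.expect ∘L (ContinuousLinearMap.mul ℂ _)
    (star (∫ t in (0 : ℝ)..T, B t))).restrictScalars ℝ).intervalIntegral_comp_comm hBi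
  simp only [hqB, h1]
  refine le_of_le_of_eq ?_ h2.symm
  exact expect_star_mul_self_nonneg hM _

end OpenSystem

end

/-! ### Frequency decomposition of the system operators -/

section

open MeasureTheory Filter Topology UnitAddTorus

/-- The exponential acts on an eigenspace by the exponential of the eigenvalue. -/
theorem exp_mul_of_mul_eq {d : ℕ} {A P : Mat d} {c : ℂ} (h : A * P = c • P) :
    NormedSpace.exp A * P = Complex.exp c • P := by
  have hpow : ∀ n : ℕ, A ^ n * P = c ^ n • P := by
    intro n
    induction n with
    | zero => simp
    | succ n ih => rw [pow_succ, mul_assoc, h, mul_smul_comm, ih, smul_smul, pow_succ, mul_comm]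
  have h1 := (NormedSpace.exp_series_hasSum_exp' (𝕂 := ℂ) A).mul_right P
  have h2 := (NormedSpace.exp_series_hasSum_exp' (𝕂 := ℂ) c).smul_const P
  rw [← Complex.exp_eq_exp_ℂ] at h2
  refine h1.unique (h2.congr_fun fun n => ?_)
  rw [smul_mul_assoc, hpow, smul_assoc]

namespace OpenSystem

attribute [local instance] instMeasureSpaceUnitAddCircle instIsAddHaarMeasureUnitAddCircleVolume
  instIsProbabilityMeasureUnitAddCircleVolume

variable {r d m : ℕ} {E : Type*} [NormedAddCommGroup E] [InnerProductSpace ℂ E] [CompleteSpace E]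
variable (M : OpenSystem r d m E)

theorem sum_spectralProj : ∑ k, M.spectralProj k = 1 := by
  have h1 : ∑ k : Fin d, Matrix.single k k (1 : ℂ) = 1 := by
    rw [← Matrix.diagonal_one, ← Matrix.sum_single_eq_diagonal]
  simp only [spectralProj]
  rw [← Finset.sum_mul, ← Finset.mul_sum, h1, mul_one]
  exact Unitary.coe_mul_star_self M.hermitian_Hbar.eigenvectorUnitary

theorem conjTranspose_spectralProj (k : Fin d) :
    (M.spectralProj k).conjTranspose = M.spectralProj k := by
  simp [spectralProj, Matrix.conjTranspose_mul, mul_assoc]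

theorem Hbar_mul_spectralProj (k : Fin d) :
    M.Hbar * M.spectralProj k = (M.ε k : ℂ) • M.spectralProj k := by
  have h := M.hermitian_Hbar.spectral_theorem
  rw [Unitary.conjStarAlgAut_apply] at h
  have h2 := Unitary.coe_star_mul_self M.hermitian_Hbar.eigenvectorUnitary
  set V : Mat d := (M.hermitian_Hbar.eigenvectorUnitary : Mat d) with hV
  set D : Mat d := Matrix.diagonal (RCLike.ofReal ∘ M.hermitian_Hbar.eigenvalues) with hD
  have h3 : D * Matrix.single k k 1 = (M.ε k : ℂ) • Matrix.single k k (1 : ℂ) := by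
    ext i j
    rw [hD, Matrix.diagonal_mul, Matrix.smul_apply, Matrix.single_apply]
    split_ifs with hk
    · rw [← hk.1]; simp [ε]
    · simp
  calc M.Hbar * M.spectralProj k
      = (V * D * star V) * (V * Matrix.single k k 1 * V.conjTranspose) := by
        conv_lhs => rw [h]
        rfl
    _ = V * D * (star V * V) * Matrix.single k k 1 * V.conjTranspose := by simp only [mul_assoc]
    _ = V * (D * Matrix.single k k 1) * V.conjTranspose := by rw [h2, mul_one, mul_assoc V]
    _ = (M.ε k : ℂ) • M.spectralProj k := by
        rw [h3, mul_smul_comm, smul_mul_assoc]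
        rfl

theorem spectralProj_mul_Hbar (k : Fin d) :
    M.spectralProj k * M.Hbar = (M.ε k : ℂ) • M.spectralProj k := by
  have h := congrArg Matrix.conjTranspose (M.Hbar_mul_spectralProj k)
  rw [Matrix.conjTranspose_mul, Matrix.conjTranspose_smul, conjTranspose_spectralProj,
    M.hermitian_Hbar.eq] at h
  simpa using h

theorem sysU_mul_spectralProj (t : ℝ) (k : Fin d) :
    M.sysU t * M.spectralProj k = Complex.exp (-(Complex.I * t) * M.ε k) • M.spectralProj k := by
  refine exp_mul_of_mul_eq ?_
  rw [smul_mul_assoc, Hbar_mul_spectralProj, smul_smul]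

theorem spectralProj_mul_sysU (t : ℝ) (k : Fin d) :
    M.spectralProj k * M.sysU t = Complex.exp (-(Complex.I * t) * M.ε k) • M.spectralProj k := by
  have h := congrArg Matrix.conjTranspose (M.sysU_mul_spectralProj (-t) k)
  rw [Matrix.conjTranspose_mul, Matrix.conjTranspose_smul, conjTranspose_spectralProj,
    conjTranspose_sysU, neg_neg, RCLike.star_def, ← Complex.exp_conj] at h
  simpa using h

/-- The component `∑ P_k A P_l`, over `ε_k - ε_l = w`, of a matrix which oscillates with the
Bohr frequency `w` under the dynamics generated by `H̄`. -/
def bohrComponent (w : ℝ) : Mat d →L[ℂ] Mat d :=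
  ∑ k, ∑ l, if M.ε k - M.ε l = w then mulBoth (M.spectralProj k) (M.spectralProj l) else 0

theorem bohrComponent_apply (w : ℝ) (A : Mat d) : M.bohrComponent w A =
    ∑ k, ∑ l, if M.ε k - M.ε l = w then M.spectralProj k * A * M.spectralProj l else 0 := by
  simp only [bohrComponent, sum_apply]
  refine Finset.sum_congr rfl fun k _ => Finset.sum_congr rfl fun l _ => ?_
  split_ifs <;> rfl

theorem Hbar_mul_bohrComponent (w : ℝ) (A : Mat d) :
    M.Hbar * M.bohrComponent w A = M.bohrComponent w A * M.Hbar + (w : ℂ) • M.bohrComponent w A := by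
  simp only [bohrComponent_apply, Finset.mul_sum, Finset.sum_mul, Finset.smul_sum,
    ← Finset.sum_add_distrib]
  refine Finset.sum_congr rfl fun k _ => Finset.sum_congr rfl fun l _ => ?_
  split_ifs with h
  · rw [← mul_assoc, ← mul_assoc, Hbar_mul_spectralProj, mul_assoc _ _ M.Hbar,
      spectralProj_mul_Hbar, mul_smul_comm, smul_mul_assoc, smul_mul_assoc, ← add_smul, ← h]
    congr 1
    push_cast
    ring
  · simp

theorem sysU_conj_eq_sum (t : ℝ) (A : Mat d) : M.sysU (-t) * A * M.sysU t =
    ∑ w ∈ M.bohr, Complex.exp (Complex.I * w * t) • M.bohrComponent w A := by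
  have h1 : M.sysU (-t) * A * M.sysU t = ∑ k, ∑ l,
      Complex.exp (Complex.I * (M.ε k - M.ε l : ℝ) * t) •
        (M.spectralProj k * A * M.spectralProj l) := by
    calc M.sysU (-t) * A * M.sysU t
        = M.sysU (-t) * (∑ k, M.spectralProj k) * A * ((∑ l, M.spectralProj l) * M.sysU t) := by
          rw [sum_spectralProj, mul_one, one_mul]
      _ = _ := by
          simp only [Finset.mul_sum, Finset.sum_mul]
          rw [Finset.sum_comm]
          refine Finset.sum_congr rfl fun k _ => Finset.sum_congr rfl fun l _ => ?_
          rw [sysU_mul_spectralProj, spectralProj_mul_sysU, smul_mul_assoc, smul_mul_assoc,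
            mul_smul_comm, smul_smul, ← Complex.exp_add]
          congr 2
          push_cast
          ring
  rw [h1]
  simp only [bohrComponent_apply, Finset.smul_sum]
  symm
  refine Finset.sum_comm.trans (Finset.sum_congr rfl fun k _ =>
    Finset.sum_comm.trans (Finset.sum_congr rfl fun l _ => ?_))
  have hmem : M.ε k - M.ε l ∈ M.bohr :=
    Finset.mem_image.2 ⟨(k, l), Finset.mem_univ _, rfl⟩
  rw [Finset.sum_eq_single_of_mem _ hmem fun w _ hw => by rw [if_neg hw.symm, smul_zero],
    if_pos rfl]

/-- The system operator `S_μ` in the interaction picture, `u_t† S_μ u_t`. -/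
def Sint (μ : Fin m) (t : ℝ) : Mat d := (M.u t).conjTranspose * M.S μ * M.u t

variable {M}

/-- The matrix elements of the component of frequency `w` of `p† S_μ p`, as functions on the
torus. -/
def entry (hM : M.Assumptions) (μ : Fin m) (w : ℝ) (i j : Fin d) :
    C(UnitAddTorus (Fin r), ℂ) :=
  ⟨fun θ => M.bohrComponent w ((M.phat θ).conjTranspose * M.S μ * M.phat θ) i j, by
    have h : Continuous fun θ => M.bohrComponent w ((M.phat θ).conjTranspose * M.S μ * M.phat θ) :=
      (M.bohrComponent w).continuous.comp
        (((continuous_star.comp hM.continuous_phat).mul continuous_const).mul hM.continuous_phat)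
    exact (LinearMap.continuous_of_finiteDimensional
      (Matrix.entryLinearMap ℂ ℂ i j : Mat d →ₗ[ℂ] ℂ)).comp h⟩

/-- In the interaction picture the system operators are finite sums of quasiperiodic functions, each
multiplied by a character `e^{iωt}`. -/
theorem Sint_eq (hM : M.Assumptions) (μ : Fin m) (t : ℝ) : M.Sint μ t =
    ∑ w ∈ M.bohr, ∑ i, ∑ j, (Complex.exp (Complex.I * w * t) *
      entry hM μ w i j (winding M.Ω t)) • Matrix.single i j 1 := by
  have h : M.Sint μ t = M.sysU (-t) * ((M.p t).conjTranspose * M.S μ * M.p t) * M.sysU t := by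
    rw [Sint, conjTranspose_u, u_eq]
    simp only [mul_assoc]
  rw [h, sysU_conj_eq_sum]
  refine Finset.sum_congr rfl fun w _ => ?_
  conv_lhs => rw [Matrix.matrix_eq_sum_single (M.bohrComponent w _)]
  simp only [Finset.smul_sum]
  refine Finset.sum_congr rfl fun i _ => Finset.sum_congr rfl fun j _ => ?_
  rw [Matrix.smul_single, Matrix.smul_single, smul_eq_mul, smul_eq_mul, mul_one]
  rfl

theorem Scomp_eq_bohrComponent (μ : Fin m) (n : Fin r → ℤ) (w : ℝ) :
    M.Scomp μ n w = M.bohrComponent w (M.Shat μ n) := (M.bohrComponent_apply w _).symm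

/-- The components `S_{μnω}` are the Fourier coefficients of the functions `entry`. -/
theorem Scomp_eq (hM : M.Assumptions) (μ : Fin m) (n : Fin r → ℤ) (w : ℝ) : M.Scomp μ n w =
    ∑ i, ∑ j, mFourierCoeff (entry hM μ w i j) n • Matrix.single i j 1 := by
  conv_lhs => rw [Matrix.matrix_eq_sum_single (M.Scomp μ n w)]
  refine Finset.sum_congr rfl fun i _ => Finset.sum_congr rfl fun j _ => ?_
  rw [Matrix.smul_single, smul_eq_mul, mul_one]
  congr 1
  let T : Mat d →L[ℂ] ℂ := LinearMap.toContinuousLinearMap (Matrix.entryLinearMap ℂ ℂ i j) ∘L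
    M.bohrComponent w
  have hc : Continuous fun θ => mFourier (-n) θ •
      ((M.phat θ).conjTranspose * M.S μ * M.phat θ) := (mFourier (-n)).continuous.smul
    (((continuous_star.comp hM.continuous_phat).mul continuous_const).mul hM.continuous_phat)
  have hi : Integrable fun θ => mFourier (-n) θ •
      ((M.phat θ).conjTranspose * M.S μ * M.phat θ) :=
    hc.integrable_of_hasCompactSupport (HasCompactSupport.of_compactSpace _)
  have h := T.integral_comp_comm hi
  rw [Scomp_eq_bohrComponent]
  refine h.symm.trans (integral_congr_ae (ae_of_all _ fun θ => ?_))
  simp only [map_smul]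
  rfl

variable {V : Type*} [NormedAddCommGroup V] [NormedSpace ℂ V]

/-- The integrand of a bilinear correlation, expanded into scalar correlations. -/
theorem f_smul_bilinear_eq (hM : M.Assumptions) (b : Mat d →L[ℂ] Mat d →L[ℂ] V) (μ ν : Fin m)
    (s x : ℝ) : M.f μ ν x • b (M.Sint ν s) (M.Sint μ (x + s)).conjTranspose =
      ∑ w' ∈ M.bohr, ∑ i', ∑ j', ∑ w ∈ M.bohr, ∑ i, ∑ j, (M.f μ ν x *
        (Complex.exp (Complex.I * w' * s) * entry hM ν w' i' j' (winding M.Ω s) *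
          starRingEnd ℂ (Complex.exp (Complex.I * w * (x + s : ℝ)) *
            entry hM μ w i j (winding M.Ω (x + s))))) •
        b (Matrix.single i' j' 1) (Matrix.single i j 1).conjTranspose := by
  rw [Sint_eq hM ν, Sint_eq hM μ]
  simp only [map_sum, map_smul, sum_apply, smul_apply, Finset.smul_sum]
  refine Finset.sum_congr rfl fun w' _ => Finset.sum_congr rfl fun i' _ =>
    Finset.sum_congr rfl fun j' _ => ?_
  simp only [Matrix.conjTranspose_sum, Matrix.conjTranspose_smul, map_sum, map_smul,
    Finset.smul_sum, smul_smul, RCLike.star_def]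

/-- The non-resonance hypothesis, in the form which equidistribution needs. -/
theorem Assumptions.resonance_free (hM : M.Assumptions) {w w' : ℝ} (hw : w ∈ M.bohr)
    (hw' : w' ∈ M.bohr) (n : Fin r → ℤ) (h : w' - w + dotFreq M.Ω n = 0) : n = 0 := by
  refine hM.congruence_free w hw w' hw' n ?_
  linarith

theorem integrableOn_f_smul_bilinear (hM : M.Assumptions) (b : Mat d →L[ℂ] Mat d →L[ℂ] V)
    (μ ν : Fin m) (s : ℝ) : IntegrableOn
      (fun x => M.f μ ν x • b (M.Sint ν s) (M.Sint μ (x + s)).conjTranspose) (Set.Ioi 0) := by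
  simp only [f_smul_bilinear_eq hM]
  refine integrable_finsetSum _ fun w' _ => integrable_finsetSum _ fun i' _ =>
    integrable_finsetSum _ fun j' _ => integrable_finsetSum _ fun w _ =>
    integrable_finsetSum _ fun i _ => integrable_finsetSum _ fun j _ => ?_
  exact (integrableOn_correlation (hM.integrable_f μ ν) w w' _ _ s).smul_const _

/-- The time average of a bilinear correlation of interaction picture operators retains only the
pairs of equal frequencies. -/
theorem exists_hasMean_bilinear [CompleteSpace V] (hM : M.Assumptions)
    (b : Mat d →L[ℂ] Mat d →L[ℂ] V) (μ ν : Fin m) :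
    ∃ L, HasMean (fun s => ∫ x in Set.Ioi (0 : ℝ),
        M.f μ ν x • b (M.Sint ν s) (M.Sint μ (x + s)).conjTranspose) L ∧
      HasSum (fun n => ∑ w ∈ M.bohr, M.halfFourier μ ν (w + dotFreq M.Ω n) •
        b (M.Scomp ν n w) (M.Scomp μ n w).conjTranspose) L := by
  have hex : ∀ w' ∈ M.bohr, ∀ i' j' : Fin d, ∀ w ∈ M.bohr, ∀ i j : Fin d, _ :=
    fun w' hw' i' j' w hw i j => exists_hasMean_correlation (hM.integrable_f μ ν)
      (hM.resonance_free hw hw') (entry hM ν w' i' j') (entry hM μ w i j)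
  choose! l hl1 hl2 using hex
  refine ⟨∑ w' ∈ M.bohr, ∑ i', ∑ j', ∑ w ∈ M.bohr, ∑ i, ∑ j, l w' i' j' w i j •
    b (Matrix.single i' j' 1) (Matrix.single i j 1).conjTranspose, ?_, ?_⟩
  · have heq : (fun s => ∫ x in Set.Ioi (0 : ℝ),
        M.f μ ν x • b (M.Sint ν s) (M.Sint μ (x + s)).conjTranspose) = fun s : ℝ =>
        ∑ w' ∈ M.bohr, ∑ i', ∑ j', ∑ w ∈ M.bohr, ∑ i, ∑ j,
          (∫ x in Set.Ioi (0 : ℝ), M.f μ ν x *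
        (Complex.exp (Complex.I * w' * s) * entry hM ν w' i' j' (winding M.Ω s) *
          starRingEnd ℂ (Complex.exp (Complex.I * w * (x + s : ℝ)) *
            entry hM μ w i j (winding M.Ω (x + s))))) •
        b (Matrix.single i' j' 1) (Matrix.single i j 1).conjTranspose := by
      funext s
      have hi := fun (w' : ℝ) (i' j' : Fin d) (w : ℝ) (i j : Fin d) =>
        (integrableOn_correlation (Ω := M.Ω) (hM.integrable_f μ ν) w w'
          (entry hM ν w' i' j') (entry hM μ w i j) s).smul_const
            (b (Matrix.single i' j' 1) (Matrix.single i j 1).conjTranspose)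
      simp only [f_smul_bilinear_eq hM]
      rw [integral_finsetSum _ fun w' _ => integrable_finsetSum _ fun i' _ =>
        integrable_finsetSum _ fun j' _ => integrable_finsetSum _ fun w _ =>
        integrable_finsetSum _ fun i _ => integrable_finsetSum _ fun j _ => hi w' i' j' w i j]
      refine Finset.sum_congr rfl fun w' _ => ?_
      rw [integral_finsetSum _ fun i' _ =>
        integrable_finsetSum _ fun j' _ => integrable_finsetSum _ fun w _ =>
        integrable_finsetSum _ fun i _ => integrable_finsetSum _ fun j _ => hi w' i' j' w i j]
      refine Finset.sum_congr rfl fun i' _ => ?_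
      rw [integral_finsetSum _ fun j' _ => integrable_finsetSum _ fun w _ =>
        integrable_finsetSum _ fun i _ => integrable_finsetSum _ fun j _ => hi w' i' j' w i j]
      refine Finset.sum_congr rfl fun j' _ => ?_
      rw [integral_finsetSum _ fun w _ =>
        integrable_finsetSum _ fun i _ => integrable_finsetSum _ fun j _ => hi w' i' j' w i j]
      refine Finset.sum_congr rfl fun w _ => ?_
      rw [integral_finsetSum _ fun i _ => integrable_finsetSum _ fun j _ => hi w' i' j' w i j]
      refine Finset.sum_congr rfl fun i _ => ?_
      rw [integral_finsetSum _ fun j _ => hi w' i' j' w i j]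
      refine Finset.sum_congr rfl fun j _ => ?_
      exact integral_smul_const _ _
    rw [heq]
    refine HasMean.sum fun w' hw' => HasMean.sum fun i' _ => HasMean.sum fun j' _ =>
      HasMean.sum fun w hw => HasMean.sum fun i _ => HasMean.sum fun j _ => ?_
    exact (hl1 w' hw' i' j' w hw i j).mapL
      (((ContinuousLinearMap.id ℂ ℂ).smulRight _).restrictScalars ℝ)
  · refine HasSum.congr_fun (hasSum_sum fun w' hw' => hasSum_sum fun i' _ => hasSum_sum fun j' _ =>
      hasSum_sum fun w hw => hasSum_sum fun i _ => hasSum_sum fun j _ =>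
        (hl2 w' hw' i' j' w hw i j).smul_const _) fun n => ?_
    refine Finset.sum_congr rfl fun w' hw' => ?_
    rw [Scomp_eq hM ν]
    simp only [map_sum, map_smul, sum_apply, smul_apply, Finset.smul_sum]
    refine Finset.sum_congr rfl fun i' _ => Finset.sum_congr rfl fun j' _ => ?_
    rw [Finset.sum_eq_single_of_mem w' hw' fun w _ hne => ?_]
    · rw [Scomp_eq hM μ]
      simp only [Matrix.conjTranspose_sum, Matrix.conjTranspose_smul, map_sum, map_smul,
        Finset.smul_sum, smul_smul, RCLike.star_def]
      refine Finset.sum_congr rfl fun i _ => Finset.sum_congr rfl fun j _ => ?_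
      rw [if_pos trivial]
      rfl
    · refine Finset.sum_eq_zero fun i _ => Finset.sum_eq_zero fun j _ => ?_
      rw [if_neg hne.symm, zero_smul]

end OpenSystem

end

/-! ### The memory kernel, reduced to the system -/

section

open MeasureTheory Filter Topology

namespace TraceClass

variable {H : Type*} [NormedAddCommGroup H] [InnerProductSpace ℂ H] [CompleteSpace H]

theorem sandwich_sum_sum {G ι κ : Type*} [NormedAddCommGroup G] [InnerProductSpace ℂ G]
    [CompleteSpace G] (s : Finset ι) (t : Finset κ) (X : ι → H →L[ℂ] G) (Y : κ → G →L[ℂ] H) :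
    sandwich (∑ i ∈ s, X i) (∑ j ∈ t, Y j) = ∑ i ∈ s, ∑ j ∈ t, sandwich (X i) (Y j) := by
  simp only [← sandwichL_apply, map_sum, sum_apply]
  exact Finset.sum_comm

theorem sandwich_sum_left {ι : Type*} (s : Finset ι) (X : ι → H →L[ℂ] H) (Y : H →L[ℂ] H) :
    sandwich (∑ i ∈ s, X i) Y = ∑ i ∈ s, sandwich (X i) Y := by
  simp only [← sandwichL_apply, map_sum, sum_apply]

theorem sandwich_sum_right {ι : Type*} (s : Finset ι) (X : H →L[ℂ] H) (Y : ι → H →L[ℂ] H) :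
    sandwich X (∑ i ∈ s, Y i) = ∑ i ∈ s, sandwich X (Y i) := by
  simp only [← sandwichL_apply, map_sum]

theorem sandwich_sum_mul_left {ι κ : Type*} (s : Finset ι) (t : Finset κ) (X : ι → H →L[ℂ] H)
    (X' : κ → H →L[ℂ] H) (Y : H →L[ℂ] H) :
    sandwich ((∑ i ∈ s, X i) * ∑ j ∈ t, X' j) Y = ∑ i ∈ s, ∑ j ∈ t, sandwich (X i * X' j) Y := by
  rw [Finset.sum_mul_sum, sandwich_sum_left]
  exact Finset.sum_congr rfl fun i _ => sandwich_sum_left _ _ _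

theorem sandwich_sum_mul_right {ι κ : Type*} (s : Finset ι) (t : Finset κ) (X : H →L[ℂ] H)
    (Y : ι → H →L[ℂ] H) (Y' : κ → H →L[ℂ] H) :
    sandwich X ((∑ i ∈ s, Y i) * ∑ j ∈ t, Y' j) = ∑ i ∈ s, ∑ j ∈ t, sandwich X (Y i * Y' j) := by
  rw [Finset.sum_mul_sum, sandwich_sum_right]
  exact Finset.sum_congr rfl fun i _ => sandwich_sum_right _ _ _

theorem conj_commutator {V : H →L[ℂ] H} (hV : star V * V = 1) (X : H →L[ℂ] H) :
    sandwich (star V) V * ((-Complex.I) • commutator X) * sandwich V (star V) =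
      (-Complex.I) • commutator (star V * X * V) := by
  rw [commutator, commutator, mul_smul_comm, smul_mul_assoc, mul_sub, sub_mul,
    sandwich_mul_sandwich, sandwich_mul_sandwich, sandwich_mul_sandwich, sandwich_mul_sandwich,
    one_mul, mul_one, hV, mul_assoc (star V) X V]

theorem commutator_apply (X : H →L[ℂ] H) (T : TraceClass H) :
    commutator X T = sandwich X 1 T - sandwich 1 X T := rfl

theorem neg_I_smul_neg_I_smul {V : Type*} [NormedAddCommGroup V] [NormedSpace ℂ V]
    (L L' : V →L[ℂ] V) (v : V) :
    ((-Complex.I) • L) (((-Complex.I) • L') v) = -(L (L' v)) := by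
  rw [smul_apply, smul_apply, map_smul, smul_smul]
  simp

/-- The double commutator, written out. -/
theorem commutator_commutator (X Y : H →L[ℂ] H) (T : TraceClass H) :
    ((-Complex.I) • commutator X) (((-Complex.I) • commutator Y) T) =
      sandwich X Y T + sandwich Y X T - sandwich (X * Y) 1 T - sandwich 1 (Y * X) T := by
  have h1 : sandwich X 1 (sandwich Y 1 T) = sandwich (X * Y) 1 T := sandwich_sandwich _ _ _ _ T
  have h2 : sandwich X 1 (sandwich 1 Y T) = sandwich X Y T := sandwich_sandwich _ _ _ _ T
  have h3 : sandwich 1 X (sandwich Y 1 T) = sandwich Y X T := sandwich_sandwich _ _ _ _ T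
  have h4 : sandwich 1 X (sandwich 1 Y T) = sandwich 1 (Y * X) T := sandwich_sandwich _ _ _ _ T
  rw [neg_I_smul_neg_I_smul, commutator_apply, commutator_apply, map_sub, map_sub, h1, h2, h3, h4]
  abel

end TraceClass

/-- Stated for a variable Hilbert space, for use on `Compound d E`. -/
theorem conj_sum {H ι : Type*} [NormedAddCommGroup H] [InnerProductSpace ℂ H] [CompleteSpace H]
    (s : Finset ι) (V : H →L[ℂ] H) (X : ι → H →L[ℂ] H) :
    star V * (∑ i ∈ s, X i) * V = ∑ i ∈ s, star V * X i * V := by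
  rw [Finset.mul_sum, Finset.sum_mul]

/-- Stated for a variable Hilbert space, for use on `Compound d E`. -/
theorem star_sum_clm {H ι : Type*} [NormedAddCommGroup H] [InnerProductSpace ℂ H] [CompleteSpace H]
    (s : Finset ι) (X : ι → H →L[ℂ] H) : star (∑ i ∈ s, X i) = ∑ i ∈ s, star (X i) := star_sum s X

namespace OpenSystem

variable {r d m : ℕ} {E : Type*} [NormedAddCommGroup E] [InnerProductSpace ℂ E] [CompleteSpace E]
variable {M : OpenSystem r d m E}

/-- The coupling in the interaction picture. -/
def coupling (M : OpenSystem r d m E) (t : ℝ) :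
    TraceClass (Compound d E) →L[ℂ] TraceClass (Compound d E) := M.Uinv t * M.A * M.U t

/-- The interaction Hamiltonian in the interaction picture. -/
def interaction (M : OpenSystem r d m E) (t : ℝ) : Compound d E →L[ℂ] Compound d E :=
  ∑ μ, tensorOp (M.Sint μ t) (M.heisenberg t (M.R μ))

theorem star_w_mul_tensorOp_mul (hM : M.Assumptions) (t : ℝ) (S : Mat d) (R : E →L[ℂ] E) :
    star (M.w t) * tensorOp S R * M.w t =
      tensorOp ((M.u t).conjTranspose * S * M.u t) (M.heisenberg t R) := by
  rw [star_w hM, w, tensorOp_mul, tensorOp_mul]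
  rfl

theorem star_w_mul_Hint_mul (hM : M.Assumptions) (t : ℝ) :
    star (M.w t) * M.Hint * M.w t = M.interaction t :=
  (conj_sum _ _ _).trans (Finset.sum_congr rfl fun _ _ => star_w_mul_tensorOp_mul hM t _ _)

/-- Self-adjointness of the interaction allows one to write it with the adjoint operators. -/
theorem interaction_eq_star (hM : M.Assumptions) (t : ℝ) : M.interaction t =
    ∑ μ, tensorOp (M.Sint μ t).conjTranspose (M.heisenberg t (star (M.R μ))) := by
  have h : M.Hint = ∑ μ, tensorOp (M.S μ).conjTranspose (star (M.R μ)) := by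
    rw [← hM.selfAdjoint_Hint.star_eq]
    exact (star_sum_clm _ _).trans (Finset.sum_congr rfl fun _ _ => star_tensorOp _ _)
  rw [← star_w_mul_Hint_mul hM, h]
  refine (conj_sum _ _ _).trans (Finset.sum_congr rfl fun μ _ =>
    (star_w_mul_tensorOp_mul hM t _ _).trans ?_)
  rw [Sint, Matrix.conjTranspose_mul, Matrix.conjTranspose_mul, Matrix.conjTranspose_conjTranspose,
    mul_assoc]

theorem coupling_eq (hM : M.Assumptions) (t : ℝ) :
    M.coupling t = (-Complex.I) • TraceClass.commutator (M.interaction t) := by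
  rw [coupling, Uinv, U_eq hM, A, ← star_w_mul_Hint_mul hM]
  exact TraceClass.conj_commutator (star_w_mul hM t) _

theorem partialTrace_sandwich_tensorState (S S' : Mat d) (R R' : E →L[ℂ] E) (ρ : Mat d) :
    partialTrace (TraceClass.sandwich (tensorOp S R) (tensorOp S' R') (tensorState M.ωE ρ)) =
      M.expect (R' * R) • (S * ρ * S') := by
  rw [sandwich_tensorState, partialTrace_tensorState, TraceClass.trace_sandwich, expect_apply]

theorem partialTrace_left (S : Mat d) (R : E →L[ℂ] E) (ρ : Mat d) :
    partialTrace (TraceClass.sandwich (tensorOp S R) 1 (tensorState M.ωE ρ)) =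
      M.expect R • (S * ρ) := by
  have h := partialTrace_sandwich_tensorState (M := M) S 1 R 1 ρ
  rwa [tensorOp_one, one_mul, mul_one] at h

theorem partialTrace_right (S : Mat d) (R : E →L[ℂ] E) (ρ : Mat d) :
    partialTrace (TraceClass.sandwich 1 (tensorOp S R) (tensorState M.ωE ρ)) =
      M.expect R • (ρ * S) := by
  have h := partialTrace_sandwich_tensorState (M := M) 1 S 1 R ρ
  rwa [tensorOp_one, mul_one, one_mul] at h

theorem expect_R (hM : M.Assumptions) (μ : Fin m) : M.expect (M.R μ) = 0 := by
  rw [expect_apply, TraceClass.trace_comm, hM.mean_zero]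

/-- The interaction has no mean, by `tr (ω_E R_μ) = 0`. -/
theorem partialTrace_coupling (hM : M.Assumptions) (t : ℝ) (ρ : Mat d) :
    partialTrace (M.coupling t (tensorState M.ωE ρ)) = 0 := by
  rw [coupling_eq hM, smul_apply, map_smul, TraceClass.commutator, sub_apply, map_sub,
    interaction, TraceClass.sandwich_sum_left, TraceClass.sandwich_sum_right, sum_apply, sum_apply,
    map_sum, map_sum, Finset.sum_eq_zero, Finset.sum_eq_zero, sub_zero, smul_zero]
  · intro μ _
    rw [partialTrace_right, expect_heisenberg hM, expect_R hM, zero_smul]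
  · intro μ _
    rw [partialTrace_left, expect_heisenberg hM, expect_R hM, zero_smul]

theorem P₀_coupling_P₀ (hM : M.Assumptions) (t : ℝ) : M.P₀ * M.coupling t * M.P₀ = 0 := by
  refine ContinuousLinearMap.ext fun a => ?_
  change tensorState M.ωE (partialTrace (M.coupling t (tensorState M.ωE (partialTrace a)))) = 0
  rw [partialTrace_coupling hM, map_zero]

/-- The memory kernel on the system, in the interaction picture. -/
def systemKernel (M : OpenSystem r d m E) (s x : ℝ) : SuperOp d :=
  partialTrace ∘L M.coupling (x + s) ∘L M.coupling s ∘L tensorState M.ωE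

/-- The extension `Φ ↦ (a ↦ Φ(tr_E a) ⊗ ω_E)` of maps on `M_d` to the compound system. -/
def lift (M : OpenSystem r d m E) :
    SuperOp d →L[ℂ] TraceClass (Compound d E) →L[ℂ] TraceClass (Compound d E) :=
  (ContinuousLinearMap.compL ℂ (TraceClass (Compound d E)) (Mat d) (TraceClass (Compound d E))
    (tensorState M.ωE)) ∘L
    ((ContinuousLinearMap.compL ℂ (TraceClass (Compound d E)) (Mat d) (Mat d)).flip partialTrace)

/-- In the interaction picture the memory kernel acts on the system alone. The projection `𝒫₁` between
the two couplings may be dropped, as the mean of the coupling vanishes. -/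
theorem kernel_eq (hM : M.Assumptions) (s x : ℝ) :
    M.kernel s x = M.U s * M.lift (M.systemKernel s x) * M.Uinv s := by
  have hUprop : M.Uprop (x + s) s = M.U (x + s) * M.Uinv s := by
    rw [Uprop, inverse_U hM]; rfl
  have hinv : (M.Uprop (x + s) s).inverse = M.U s * M.Uinv (x + s) := by
    rw [hUprop]
    refine ContinuousLinearMap.inverse_eq ?_ ?_
    · change M.U (x + s) * M.Uinv s * (M.U s * M.Uinv (x + s)) = 1
      rw [mul_assoc, ← mul_assoc (M.Uinv s), Uinv_mul_U hM, one_mul, U_mul_Uinv hM]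
    · change M.U s * M.Uinv (x + s) * (M.U (x + s) * M.Uinv s) = 1
      rw [mul_assoc, ← mul_assoc (M.Uinv (x + s)), Uinv_mul_U hM, one_mul, U_mul_Uinv hM]
  have hlift : M.lift (M.systemKernel s x) = M.P₀ * M.coupling (x + s) * M.coupling s * M.P₀ := rfl
  have h0 := P₀_coupling_P₀ hM (x + s)
  have hP1U : ∀ t, M.P₁ * M.U t = M.U t * M.P₁ := fun t => by
    rw [P₁, sub_mul, mul_sub, P₀_comp_U hM, one_mul, mul_one]
  have hP1V : ∀ t, M.P₁ * M.Uinv t = M.Uinv t * M.P₁ := fun t => by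
    rw [P₁, sub_mul, mul_sub, P₀_comp_Uinv hM, one_mul, mul_one]
  have hP1 : M.P₁ * M.P₁ = M.P₁ := by
    rw [P₁, sub_mul, mul_sub, mul_sub, P₀_mul_P₀ hM]; simp
  have hUV := U_mul_Uinv hM s
  have hP0 := P₀_mul_P₀ hM
  rw [kernel, hinv, hUprop, hlift]
  change M.U s * M.Uinv (x + s) * (M.P₀ * (M.A * M.P₁) * (M.U (x + s) * M.Uinv s *
    (M.P₁ * (M.A * M.P₀)))) = _
  calc _ = M.U s * (M.Uinv (x + s) * M.P₀) * M.A * (M.P₁ * M.U (x + s)) * (M.Uinv s * M.P₁) *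
        M.A * M.P₀ := by simp only [mul_assoc]
    _ = M.U s * (M.P₀ * M.Uinv (x + s)) * M.A * (M.U (x + s) * M.P₁) * (M.P₁ * M.Uinv s) *
        M.A * (M.U s * M.Uinv s) * M.P₀ := by
        rw [hP1U, ← hP1V, ← P₀_comp_Uinv hM, hUV, mul_one]
    _ = M.U s * (M.P₀ * M.coupling (x + s) * (M.P₁ * M.P₁) * M.coupling s * (M.Uinv s * M.P₀)) := by
        simp only [coupling, mul_assoc]
    _ = M.U s * (M.P₀ * M.coupling (x + s) * M.coupling s * (M.P₀ * M.Uinv s)) -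
        M.U s * (M.P₀ * M.coupling (x + s) * M.P₀) * M.coupling s * (M.P₀ * M.Uinv s) := by
        rw [hP1, P₀_comp_Uinv hM, P₁, mul_sub, mul_one, sub_mul, sub_mul, mul_sub]
        simp only [mul_assoc]
    _ = _ := by
        rw [h0]
        simp only [mul_zero, zero_mul, sub_zero, mul_assoc]

end OpenSystem

end

/-! ### The averaged memory kernel -/

section

open MeasureTheory Filter Topology

section SuperOp

variable {d : ℕ}

/-- The map `Φ ↦ (ρ ↦ Φ(ρ†)†)`. -/
def starConj (d : ℕ) : SuperOp d →L[ℝ] SuperOp d :=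
  LinearMap.mkContinuous
    { toFun := fun Φ => LinearMap.toContinuousLinearMap
        { toFun := fun ρ => star (Φ (star ρ))
          map_add' := fun ρ σ => by simp only [star_add, map_add]
          map_smul' := fun c ρ => by
            simp only [star_smul, map_smul, star_star, RingHom.id_apply] }
      map_add' := fun Φ Ψ => ContinuousLinearMap.ext fun ρ => star_add (Φ (star ρ)) (Ψ (star ρ))
      map_smul' := fun c Φ => ContinuousLinearMap.ext fun ρ => by
        change star (c • Φ (star ρ)) = c • star (Φ (star ρ))
        rw [star_smul, star_trivial] }
    1 fun Φ => by
      rw [one_mul]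
      refine ContinuousLinearMap.opNorm_le_bound _ (norm_nonneg _) fun ρ => ?_
      change ‖star (Φ (star ρ))‖ ≤ _
      rw [norm_star]
      simpa only [norm_star] using Φ.le_opNorm (star ρ)

theorem starConj_apply (Φ : SuperOp d) (ρ : Mat d) : starConj d Φ ρ = star (Φ (star ρ)) := rfl

theorem starConj_smul (c : ℂ) (Φ : SuperOp d) :
    starConj d (c • Φ) = starRingEnd ℂ c • starConj d Φ :=
  ContinuousLinearMap.ext fun ρ => star_smul c (Φ (star ρ))

theorem starConj_mulBoth (A B : Mat d) :
    starConj d (mulBoth A B) = mulBoth B.conjTranspose A.conjTranspose := by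
  refine ContinuousLinearMap.ext fun ρ => ?_
  rw [starConj_apply, mulBoth_apply, mulBoth_apply, star_mul, star_mul, star_star, mul_assoc]
  rfl

/-- The bilinear map `(A, C) ↦ C A`. -/
def mulFlip (d : ℕ) : Mat d →L[ℂ] Mat d →L[ℂ] Mat d :=
  (ContinuousLinearMap.mul ℂ (Mat d)).flip

theorem mulFlip_apply (A C : Mat d) : mulFlip d A C = C * A := rfl

/-- Left multiplication, as a map on `M_d`. -/
def leftMul (d : ℕ) : Mat d →L[ℂ] SuperOp d := (ContinuousLinearMap.mulLeftRight ℂ (Mat d)).flip 1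

/-- Right multiplication, as a map on `M_d`. -/
def rightMul (d : ℕ) : Mat d →L[ℂ] SuperOp d := ContinuousLinearMap.mulLeftRight ℂ (Mat d) 1

/-- The bilinear map `(A, C) ↦ (ρ ↦ A ρ C - C A ρ)`. -/
def halfGen (d : ℕ) : Mat d →L[ℂ] Mat d →L[ℂ] SuperOp d :=
  ContinuousLinearMap.mulLeftRight ℂ (Mat d) -
    (ContinuousLinearMap.compL ℂ (Mat d) (Mat d) (SuperOp d) (leftMul d)) ∘L mulFlip d

theorem halfGen_apply (A C : Mat d) : halfGen d A C = mulBoth A C - mulBoth (C * A) 1 := rfl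

/-- The bilinear map `(A, C) ↦ (ρ ↦ A ρ C - (1/2) {C A, ρ})`. -/
def dissGen (d : ℕ) : Mat d →L[ℂ] Mat d →L[ℂ] SuperOp d :=
  ContinuousLinearMap.mulLeftRight ℂ (Mat d) -
    (1 / 2 : ℂ) • (ContinuousLinearMap.compL ℂ (Mat d) (Mat d) (SuperOp d)
      (leftMul d + rightMul d)) ∘L mulFlip d

theorem dissGen_conjTranspose (A B : Mat d) : dissGen d A B.conjTranspose = dissipator A B := rfl

theorem starConj_dissipator (A B : Mat d) : starConj d (dissipator A B) = dissipator B A := by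
  rw [dissipator, map_sub, starConj_smul, map_add, starConj_mulBoth, starConj_mulBoth,
    starConj_mulBoth, dissipator, map_div₀, map_one, Complex.conj_ofNat]
  simp [add_comm]

theorem starConj_halfGen (A B : Mat d) : starConj d (halfGen d A B.conjTranspose) =
    mulBoth B A.conjTranspose - mulBoth 1 (A.conjTranspose * B) := by
  rw [halfGen_apply, map_sub, starConj_mulBoth, starConj_mulBoth]
  simp

theorem conjTranspose_conj_mul (A B : Mat d) :
    (A.conjTranspose * B).conjTranspose = B.conjTranspose * A := by
  rw [Matrix.conjTranspose_mul, Matrix.conjTranspose_conjTranspose]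

end SuperOp

namespace OpenSystem

variable {r d m : ℕ} {E : Type*} [NormedAddCommGroup E] [InnerProductSpace ℂ E] [CompleteSpace E]
variable {M : OpenSystem r d m E}

section Generic

variable {V : Type*} [NormedAddCommGroup V] [NormedSpace ℂ V]

/-- The sum over `μ, ν` of the correlations `f_{μν}(x) b(S_ν(s), S_μ(x + s)†)`, for a bilinear
map `b`. -/
def bilinearKernel (M : OpenSystem r d m E) (b : Mat d →L[ℂ] Mat d →L[ℂ] V) (s x : ℝ) : V :=
  ∑ μ, ∑ ν, M.f μ ν x • b (M.Sint ν s) (M.Sint μ (x + s)).conjTranspose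

theorem integrableOn_bilinearKernel (hM : M.Assumptions) (b : Mat d →L[ℂ] Mat d →L[ℂ] V) (s : ℝ) :
    IntegrableOn (M.bilinearKernel b s) (Set.Ioi 0) := by
  change IntegrableOn (fun x => M.bilinearKernel b s x) (Set.Ioi 0)
  simp only [bilinearKernel]
  exact integrable_finsetSum _ fun μ _ => integrable_finsetSum _ fun ν _ =>
    integrableOn_f_smul_bilinear hM b μ ν s

theorem integrableOn_bilinearKernel_add (hM : M.Assumptions) (b : Mat d →L[ℂ] Mat d →L[ℂ] V)
    (J : V →L[ℝ] V) (s : ℝ) :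
    IntegrableOn (fun x => M.bilinearKernel b s x + J (M.bilinearKernel b s x)) (Set.Ioi 0) :=
  (integrableOn_bilinearKernel hM b s).add (J.integrable_comp (integrableOn_bilinearKernel hM b s))

theorem exists_hasMean_bilinearKernel_add [CompleteSpace V] (hM : M.Assumptions)
    (b : Mat d →L[ℂ] Mat d →L[ℂ] V) (J : V →L[ℝ] V) :
    ∃ L : Fin m → Fin m → V,
      HasMean (fun s => ∫ x in Set.Ioi (0 : ℝ),
        (M.bilinearKernel b s x + J (M.bilinearKernel b s x)))
        (∑ μ, ∑ ν, (L μ ν + J (L ν μ))) ∧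
      ∀ μ ν, HasSum (fun n => ∑ w ∈ M.bohr, M.halfFourier μ ν (w + dotFreq M.Ω n) •
        b (M.Scomp ν n w) (M.Scomp μ n w).conjTranspose) (L μ ν) := by
  choose L hL1 hL2 using fun μ ν => exists_hasMean_bilinear hM b μ ν
  refine ⟨L, ?_, hL2⟩
  have hmean : HasMean (fun s => ∫ x in Set.Ioi (0 : ℝ), M.bilinearKernel b s x)
      (∑ μ, ∑ ν, L μ ν) := by
    have heq : (fun s => ∫ x in Set.Ioi (0 : ℝ), M.bilinearKernel b s x) = fun s =>
        ∑ μ, ∑ ν, ∫ x in Set.Ioi (0 : ℝ),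
          M.f μ ν x • b (M.Sint ν s) (M.Sint μ (x + s)).conjTranspose := by
      funext s
      simp only [bilinearKernel]
      rw [integral_finsetSum _ fun μ _ => integrable_finsetSum _ fun ν _ =>
        integrableOn_f_smul_bilinear hM b μ ν s]
      exact Finset.sum_congr rfl fun μ _ => integral_finsetSum _ fun ν _ =>
        integrableOn_f_smul_bilinear hM b μ ν s
    rw [heq]
    exact HasMean.sum fun μ _ => HasMean.sum fun ν _ => hL1 μ ν
  have hsum : ∑ μ, ∑ ν, (L μ ν + J (L ν μ)) = ∑ μ, ∑ ν, L μ ν + J (∑ μ, ∑ ν, L μ ν) := by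
    simp only [Finset.sum_add_distrib, map_sum]
    congr 1
    exact Finset.sum_comm
  have hint : ∀ s, ∫ x in Set.Ioi (0 : ℝ), (M.bilinearKernel b s x + J (M.bilinearKernel b s x)) =
      (∫ x in Set.Ioi (0 : ℝ), M.bilinearKernel b s x) +
        J (∫ x in Set.Ioi (0 : ℝ), M.bilinearKernel b s x) := fun s => by
    have hi := integrableOn_bilinearKernel hM b s
    rw [integral_add hi (J.integrable_comp hi), J.integral_comp_comm hi]
  rw [hsum, funext hint]
  exact hmean.add (hmean.mapL J)

theorem summable_halfFourier_smul_add [CompleteSpace V] (hM : M.Assumptions)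
    (b : Mat d →L[ℂ] Mat d →L[ℂ] V) (J : V →L[ℝ] V) (μ ν : Fin m) :
    Summable fun n => (∑ w ∈ M.bohr, M.halfFourier μ ν (w + dotFreq M.Ω n) •
        b (M.Scomp ν n w) (M.Scomp μ n w).conjTranspose) +
      J (∑ w ∈ M.bohr, M.halfFourier ν μ (w + dotFreq M.Ω n) •
        b (M.Scomp μ n w) (M.Scomp ν n w).conjTranspose) := by
  obtain ⟨L, -, hL⟩ := exists_hasMean_bilinear hM b μ ν
  obtain ⟨L', -, hL'⟩ := exists_hasMean_bilinear hM b ν μ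
  exact (hL.add (J.hasSum hL')).summable

end Generic

/-- The terms of the system kernel with the weights `f_{μν}`; the others are their Hermitian
conjugates. -/
def halfKernel (M : OpenSystem r d m E) (s x : ℝ) : SuperOp d :=
  M.bilinearKernel (V := SuperOp d) (halfGen d) s x

theorem halfKernel_apply (s x : ℝ) (ρ : Mat d) : M.halfKernel s x ρ =
    ∑ μ, ∑ ν, M.f μ ν x • (M.Sint ν s * ρ * (M.Sint μ (x + s)).conjTranspose) -
      ∑ μ, ∑ ν, M.f μ ν x • ((M.Sint μ (x + s)).conjTranspose * M.Sint ν s * ρ) := by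
  simp only [halfKernel, bilinearKernel, sum_apply, smul_apply, halfGen_apply, sub_apply,
    mulBoth_apply, smul_sub, Finset.sum_sub_distrib, mul_one]

theorem starConj_halfKernel_apply (s x : ℝ) (ρ : Mat d) : starConj d (M.halfKernel s x) ρ =
    ∑ μ, ∑ ν, starRingEnd ℂ (M.f μ ν x) •
        (M.Sint μ (x + s) * ρ * (M.Sint ν s).conjTranspose) -
      ∑ μ, ∑ ν, starRingEnd ℂ (M.f μ ν x) •
        (ρ * ((M.Sint ν s).conjTranspose * M.Sint μ (x + s))) := by
  rw [starConj_apply, halfKernel_apply, star_sub]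
  simp only [star_sum, star_smul, star_mul, Matrix.star_eq_conjTranspose,
    Matrix.conjTranspose_conjTranspose, RCLike.star_def, mul_assoc]

/-- The four terms of the double commutator come in Hermitian conjugate pairs. -/
theorem systemKernel_eq (hM : M.Assumptions) (s x : ℝ) :
    M.systemKernel s x = M.halfKernel s x + starConj d (M.halfKernel s x) := by
  refine ContinuousLinearMap.ext fun ρ => ?_
  rw [add_apply, halfKernel_apply, starConj_halfKernel_apply]
  change partialTrace (M.coupling (x + s) (M.coupling s (tensorState M.ωE ρ))) = _
  rw [coupling_eq hM, coupling_eq hM, TraceClass.commutator_commutator, map_sub, map_sub, map_add]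
  have hf : ∀ μ ν, M.expect (M.heisenberg (x + s) (star (M.R μ)) * M.heisenberg s (M.R ν)) =
      M.f μ ν x := fun μ ν => by
    rw [expect_heisenberg_mul_heisenberg hM, add_sub_cancel_right]
  have hf' : ∀ μ ν, M.expect (M.heisenberg s (star (M.R ν)) * M.heisenberg (x + s) (M.R μ)) =
      starRingEnd ℂ (M.f μ ν x) := fun μ ν => by
    rw [expect_heisenberg_mul_heisenberg hM, ← f_neg hM, sub_add_cancel_right]
  have h1 : partialTrace (TraceClass.sandwich (M.interaction (x + s)) (M.interaction s)
      (tensorState M.ωE ρ)) = ∑ μ, ∑ ν, starRingEnd ℂ (M.f μ ν x) •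
        (M.Sint μ (x + s) * ρ * (M.Sint ν s).conjTranspose) := by
    rw [interaction_eq_star hM s, interaction, TraceClass.sandwich_sum_sum]
    simp only [sum_apply, map_sum, partialTrace_sandwich_tensorState, hf']
  have h2 : partialTrace (TraceClass.sandwich (M.interaction s) (M.interaction (x + s))
      (tensorState M.ωE ρ)) = ∑ μ, ∑ ν, M.f μ ν x •
        (M.Sint ν s * ρ * (M.Sint μ (x + s)).conjTranspose) := by
    rw [interaction_eq_star hM (x + s), interaction, TraceClass.sandwich_sum_sum, Finset.sum_comm]
    simp only [sum_apply, map_sum, partialTrace_sandwich_tensorState, hf]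
  have h3 : partialTrace (TraceClass.sandwich (M.interaction (x + s) * M.interaction s) 1
      (tensorState M.ωE ρ)) = ∑ μ, ∑ ν, M.f μ ν x •
        ((M.Sint μ (x + s)).conjTranspose * M.Sint ν s * ρ) := by
    rw [interaction_eq_star hM (x + s), interaction, TraceClass.sandwich_sum_mul_left]
    simp only [sum_apply, map_sum, tensorOp_mul, partialTrace_left, hf]
  have h4 : partialTrace (TraceClass.sandwich 1 (M.interaction s * M.interaction (x + s))
      (tensorState M.ωE ρ)) = ∑ μ, ∑ ν, starRingEnd ℂ (M.f μ ν x) •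
        (ρ * ((M.Sint ν s).conjTranspose * M.Sint μ (x + s))) := by
    rw [interaction_eq_star hM s, interaction, TraceClass.sandwich_sum_mul_right, Finset.sum_comm]
    simp only [sum_apply, map_sum, tensorOp_mul, partialTrace_right, hf']
  rw [h1, h2, h3, h4]
  abel

theorem integrableOn_systemKernel (hM : M.Assumptions) (s : ℝ) :
    IntegrableOn (M.systemKernel s) (Set.Ioi 0) := by
  have h := integrableOn_bilinearKernel_add (V := SuperOp d) hM (halfGen d) (starConj d) s
  have e : M.systemKernel s = fun x => M.halfKernel s x + starConj d (M.halfKernel s x) :=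
    funext (systemKernel_eq hM s)
  rw [e]
  exact h

theorem conj_halfFourier (hM : M.Assumptions) (μ ν : Fin m) (w : ℝ) :
    starRingEnd ℂ (M.halfFourier ν μ w) = M.h μ ν w / 2 - Complex.I * M.ζ μ ν w := by
  rw [halfFourier_eq, map_add, map_mul, map_div₀, conj_h hM, conj_ζ hM, Complex.conj_I]
  simp only [Complex.conj_ofNat]
  ring

theorem summable_dissTerm (hM : M.Assumptions) (μ ν : Fin m) : Summable (M.dissTerm μ ν) := by
  refine (summable_halfFourier_smul_add (V := SuperOp d) hM (dissGen d) (starConj d) μ ν).congr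
    fun n => ?_
  rw [map_sum, ← Finset.sum_add_distrib]
  refine Finset.sum_congr rfl fun w _ => ?_
  rw [starConj_smul, dissGen_conjTranspose, dissGen_conjTranspose, starConj_dissipator, ← add_smul,
    h_eq hM]

theorem summable_lambTerm (hM : M.Assumptions) (μ ν : Fin m) : Summable (M.lambTerm μ ν) := by
  obtain ⟨L, -, hL⟩ := exists_hasMean_bilinear hM (mulFlip d) μ ν
  obtain ⟨L', -, hL'⟩ := exists_hasMean_bilinear hM (mulFlip d) ν μ
  refine ((hL.sub hL'.star).const_smul ((2 * Complex.I)⁻¹)).summable.congr fun n => ?_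
  rw [star_sum, ← Finset.sum_sub_distrib, Finset.smul_sum]
  refine Finset.sum_congr rfl fun w _ => ?_
  rw [star_smul, mulFlip_apply, mulFlip_apply, Matrix.star_eq_conjTranspose,
    conjTranspose_conj_mul, ← sub_smul, smul_smul, RCLike.star_def, conj_halfFourier hM,
    halfFourier_eq]
  congr 1
  have := Complex.I_ne_zero
  field_simp
  ring

theorem conjTranspose_lambTerm (hM : M.Assumptions) (μ ν : Fin m) (n : Fin r → ℤ) :
    (M.lambTerm μ ν n).conjTranspose = M.lambTerm ν μ n := by
  rw [lambTerm, Matrix.conjTranspose_sum]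
  refine Finset.sum_congr rfl fun w _ => ?_
  rw [Matrix.conjTranspose_smul, conjTranspose_conj_mul, RCLike.star_def, conj_ζ hM]

theorem isHermitian_ΔH (hM : M.Assumptions) : M.ΔH.IsHermitian := by
  rw [Matrix.IsHermitian, ΔH, Matrix.conjTranspose_sum]
  simp only [Matrix.conjTranspose_sum, Matrix.conjTranspose_tsum, conjTranspose_lambTerm hM]
  exact Finset.sum_comm

/-- The generator of the reduced dynamics in the interaction picture. -/
def generator (M : OpenSystem r d m E) : SuperOp d := (-Complex.I) • adMap M.ΔH + M.Dbar

/-- The commutator `[A, ·]`, as a linear function of `A`. -/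
def adMapL (d : ℕ) : Mat d →L[ℂ] SuperOp d := leftMul d - rightMul d

theorem adMapL_apply (A : Mat d) : adMapL d A = adMap A := rfl

theorem generator_eq (M : OpenSystem r d m E) : M.generator =
    ∑ μ, ∑ ν, ((-Complex.I) • adMap (∑' n, M.lambTerm μ ν n) + ∑' n, M.dissTerm μ ν n) := by
  simp only [generator, ΔH, Dbar, ← adMapL_apply, map_sum, Finset.smul_sum, Finset.sum_add_distrib]

/-- The one-sided Fourier transforms recombine into the Hamiltonian part, by `ζ`, and the dissipative
part, by `h`. -/
theorem term_eq (hM : M.Assumptions) (μ ν : Fin m) (A B : Mat d) (w : ℝ) :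
    M.halfFourier μ ν w • halfGen d A B.conjTranspose +
      starConj d (M.halfFourier ν μ w • halfGen d B A.conjTranspose) =
    (-Complex.I) • adMap (M.ζ μ ν w • (B.conjTranspose * A)) + M.h μ ν w • dissipator A B := by
  rw [← adMapL_apply, (adMapL d).map_smul, adMapL_apply, starConj_smul, starConj_halfGen,
    conj_halfFourier hM, halfFourier_eq, halfGen_apply, adMap, dissipator]
  module

/-- Averaging the memory kernel over time gives the Davies type generator. -/
theorem hasMean_systemKernel (hM : M.Assumptions) :
    HasMean (fun s => ∫ x in Set.Ioi (0 : ℝ), M.systemKernel s x) M.generator := by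
  obtain ⟨L, hL1, hL2⟩ :=
    exists_hasMean_bilinearKernel_add (V := SuperOp d) hM (halfGen d) (starConj d)
  have hmean : HasMean (fun s => ∫ x in Set.Ioi (0 : ℝ), M.systemKernel s x)
      (∑ μ, ∑ ν, (L μ ν + starConj d (L ν μ))) := by
    simp only [systemKernel_eq hM]
    exact hL1
  have h : ∀ μ ν, L μ ν + starConj d (L ν μ) =
      (-Complex.I) • adMap (∑' n, M.lambTerm μ ν n) + ∑' n, M.dissTerm μ ν n := by
    intro μ ν
    have h1 := (hL2 μ ν).add ((starConj d).hasSum (hL2 ν μ))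
    have h2 := (((adMapL d).hasSum (summable_lambTerm hM μ ν).hasSum).const_smul
      (-Complex.I)).add (summable_dissTerm hM μ ν).hasSum
    refine h1.unique (h2.congr_fun fun n => ?_)
    rw [lambTerm, dissTerm, map_sum, map_sum, Finset.smul_sum, ← Finset.sum_add_distrib,
      ← Finset.sum_add_distrib]
    exact Finset.sum_congr rfl fun w _ => term_eq hM μ ν _ _ _
  rw [generator_eq]
  simpa only [h] using hmean

end OpenSystem

end

/-! ### The local average and the reduced evolution -/

section

open MeasureTheory Filter Topology

section Generic

variable {𝔸 : Type*} [NormedRing 𝔸] [NormedAlgebra ℂ 𝔸] [CompleteSpace 𝔸]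

theorem integral_mul_exp_mul (a b K : 𝔸) (t : ℝ) :
    ∫ s in (0 : ℝ)..t, a * (K * (NormedSpace.exp ((s : ℂ) • K) * b)) =
      a * (NormedSpace.exp ((t : ℂ) • K) * b) - a * b := by
  have hd : ∀ s ∈ Set.uIcc 0 t, HasDerivAt
      (fun s : ℝ => a * (NormedSpace.exp ((s : ℂ) • K) * b))
      (a * (K * (NormedSpace.exp ((s : ℂ) • K) * b))) s := fun s _ => by
    have h := ((hasDerivAt_exp_ofReal_smul K s).mul_const b).const_mul a
    rwa [mul_assoc K] at h
  have hc : Continuous fun s : ℝ => a * (K * (NormedSpace.exp ((s : ℂ) • K) * b)) :=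
    continuous_const.mul (continuous_const.mul ((continuous_exp_ofReal_smul K).mul
      continuous_const))
  rw [intervalIntegral.integral_eq_sub_of_hasDerivAt hd (hc.intervalIntegrable _ _)]
  simp

/-- The solution of a linear integral equation with constant coefficients. -/
theorem eq_exp_mul_of_integral_eq {Y : ℝ → 𝔸} {b K : 𝔸} (hc : ContinuousOn Y (Set.Ici 0))
    (h : ∀ t, 0 ≤ t → Y t = b + ∫ s in (0 : ℝ)..t, K * Y s) {t : ℝ} (ht : 0 ≤ t) :
    Y t = NormedSpace.exp ((t : ℂ) • K) * b := by
  have hy : Continuous fun s : ℝ => Y (max s 0) :=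
    hc.comp_continuous (continuous_id.max continuous_const) fun s => le_max_right s 0
  have hYg : ∀ t, 0 ≤ t → Y t = b + ∫ s in (0 : ℝ)..t, K * Y (max s 0) := fun t ht => by
    rw [h t ht]
    congr 1
    refine intervalIntegral.integral_congr fun s hs => ?_
    rw [Set.uIcc_of_le ht] at hs
    simp only [max_eq_left hs.1]
  have hd : ∀ t ∈ Set.Ici (0 : ℝ), HasDerivWithinAt Y (K * Y t) (Set.Ici 0) t := by
    intro t ht
    have h1 : HasDerivAt (fun t => b + ∫ s in (0 : ℝ)..t, K * Y (max s 0)) (K * Y (max t 0)) t :=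
      (intervalIntegral.integral_hasDerivAt_right
        ((continuous_const.mul hy).intervalIntegrable _ _)
        (continuous_const.mul hy).aestronglyMeasurable.stronglyMeasurableAtFilter
        (continuous_const.mul hy).continuousAt).const_add b
    rw [max_eq_left ht] at h1
    exact h1.hasDerivWithinAt.congr (fun s hs => hYg s hs) (hYg t ht)
  have h0 : Y 0 = b := by rw [h 0 le_rfl]; simp
  rw [eq_exp_mul_of_hasDerivWithinAt (convex_Ici 0) Set.self_mem_Ici hd ht, h0]

/-- Variation of constants: an integral equation whose free part is an invertible family `U`. -/
theorem eq_mul_exp_mul_of_integral_eq {W U V : ℝ → 𝔸} {b K : 𝔸} (hW : ContinuousOn W (Set.Ici 0))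
    (hV : Continuous V) (hUV : ∀ t, U t * V t = 1) (hVU : ∀ t, V t * U t = 1)
    (hb : ∀ t, b * U t = U t * b)
    (h : ∀ t, 0 ≤ t → W t = b * U t + ∫ s in (0 : ℝ)..t, U t * (K * (V s * W s)))
    {t : ℝ} (ht : 0 ≤ t) : W t = U t * (NormedSpace.exp ((t : ℂ) • K) * b) := by
  have hY : V t * W t = NormedSpace.exp ((t : ℂ) • K) * b := by
    refine eq_exp_mul_of_integral_eq (Y := fun t => V t * W t) (hV.continuousOn.mul hW)
      (fun t ht => ?_) ht
    have hc : ContinuousOn (fun s => K * (V s * W s)) (Set.uIcc 0 t) := by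
      rw [Set.uIcc_of_le ht]
      exact continuousOn_const.mul ((hV.continuousOn.mul hW).mono Set.Icc_subset_Ici_self)
    have e : ∫ s in (0 : ℝ)..t, U t * (K * (V s * W s)) =
        U t * ∫ s in (0 : ℝ)..t, K * (V s * W s) :=
      (ContinuousLinearMap.mul ℝ 𝔸 (U t)).intervalIntegral_comp_comm hc.intervalIntegrable
    rw [h t ht, e, mul_add, hb, ← mul_assoc, ← mul_assoc, hVU, one_mul, one_mul]
  rw [← hY, ← mul_assoc, hUV, one_mul]

theorem integrableOn_mul_apply_mul {V : Type*} [NormedAddCommGroup V] [NormedSpace ℂ V]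
    [CompleteSpace V] {k : ℝ → V} {s : Set ℝ} (hk : IntegrableOn k s) (T : V →L[ℂ] 𝔸) (a b : 𝔸) :
    IntegrableOn (fun x => a * T (k x) * b) s ∧
      ∫ x in s, a * T (k x) * b = a * T (∫ x in s, k x) * b := by
  have h := T.integrable_comp hk
  refine ⟨(h.const_mul a).mul_const b, ?_⟩
  rw [integral_mul_const_of_integrable (h.const_mul a), integral_const_mul_of_integrable h,
    T.integral_comp_comm hk]

end Generic

namespace OpenSystem

variable {r d m : ℕ} {E : Type*} [NormedAddCommGroup E] [InnerProductSpace ℂ E] [CompleteSpace E]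
variable {M : OpenSystem r d m E}

theorem kernel_integral (hM : M.Assumptions) (s : ℝ) :
    IntegrableOn (M.kernel s) (Set.Ioi 0) ∧ ∫ x in Set.Ioi (0 : ℝ), M.kernel s x =
      M.U s * M.lift (∫ x in Set.Ioi (0 : ℝ), M.systemKernel s x) * M.Uinv s := by
  have h := integrableOn_mul_apply_mul (V := SuperOp d)
    (𝔸 := TraceClass (Compound d E) →L[ℂ] TraceClass (Compound d E))
    (integrableOn_systemKernel hM s) M.lift (M.U s) (M.Uinv s)
  have e : M.kernel s = fun x => M.U s * M.lift (M.systemKernel s x) * M.Uinv s :=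
    funext (kernel_eq hM s)
  rw [e]
  exact h

theorem rotated_eq (hM : M.Assumptions) (lam t : ℝ) : M.rotated lam t =
    M.lift (∫ x in Set.Ioi (0 : ℝ), M.systemKernel (lam⁻¹ ^ 2 * t) x) := by
  rw [rotated, Ktilde, (kernel_integral hM _).2, inverse_U hM]
  set s := lam⁻¹ ^ 2 * t
  change M.Uinv s * (M.U s * M.lift (∫ x in Set.Ioi (0 : ℝ), M.systemKernel s x) * M.Uinv s *
    M.U s) = _
  rw [mul_assoc (M.U s * _), Uinv_mul_U hM, mul_one, ← mul_assoc, Uinv_mul_U hM, one_mul]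

theorem hasMean_map {V W : Type*} [NormedAddCommGroup V] [NormedSpace ℂ V] [CompleteSpace V]
    [NormedAddCommGroup W] [NormedSpace ℂ W] [CompleteSpace W] {g : ℝ → V} {L : V}
    (h : HasMean g L) (T : V →L[ℂ] W) : HasMean (fun t => T (g t)) (T L) :=
  h.mapL (T.restrictScalars ℝ)

/-- Rescaling of time does not change a time average, so the local average does not depend on
`λ`. -/
theorem isLocalAverage (hM : M.Assumptions) : M.IsLocalAverage (M.lift M.generator) := by
  intro lam hlam
  have h0 := (hasMean_map (V := SuperOp d)
    (W := TraceClass (Compound d E) →L[ℂ] TraceClass (Compound d E))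
    (hasMean_systemKernel hM) M.lift).comp_mul_left (c := lam⁻¹ ^ 2) (by positivity)
  have h : HasMean (M.rotated lam) (M.lift M.generator) := by
    rw [funext (rotated_eq hM lam)]
    exact h0
  exact ⟨fun t => (kernel_integral hM _).1, fun δ => h.1.intervalIntegrable _ _, h.2⟩

theorem IsLocalAverage.eq (hM : M.Assumptions)
    {K : TraceClass (Compound d E) →L[ℂ] TraceClass (Compound d E)} (hK : M.IsLocalAverage K) :
    K = M.lift M.generator :=
  tendsto_nhds_unique (hK 1 one_pos).2.2 (isLocalAverage hM 1 one_pos).2.2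

/-- The solution of the reduced integral equation. -/
def reducedEvolution (M : OpenSystem r d m E) (t : ℝ) :
    TraceClass (Compound d E) →L[ℂ] TraceClass (Compound d E) :=
  M.U t * (NormedSpace.exp ((t : ℂ) • M.lift M.generator) * M.P₀)

theorem isReducedEvolution (hM : M.Assumptions) :
    M.IsReducedEvolution (M.lift M.generator) M.reducedEvolution := by
  refine ⟨?_, fun t _ => ?_⟩
  · exact ((continuous_U hM).mul ((continuous_exp_ofReal_smul (M.lift M.generator)).mul
      continuous_const)).continuousOn
  · have e : ∀ s, M.U t ∘L M.lift M.generator ∘L (M.U s).inverse ∘L M.reducedEvolution s =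
        M.U t * (M.lift M.generator *
          (NormedSpace.exp ((s : ℂ) • M.lift M.generator) * M.P₀)) := fun s => by
      rw [inverse_U hM]
      change M.U t * (M.lift M.generator * (M.Uinv s * (M.U s * _))) = _
      rw [← mul_assoc (M.Uinv s), Uinv_mul_U hM, one_mul]
    have e2 : M.P₀ ∘L M.U t = M.U t * M.P₀ := P₀_comp_U hM t
    simp only [e]
    have e3 := integral_mul_exp_mul (M.U t) M.P₀ (M.lift M.generator) t
    refine Eq.trans ?_ (congrArg (M.P₀ ∘L M.U t + ·) e3.symm)
    rw [e2, reducedEvolution, add_sub_cancel]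

theorem IsReducedEvolution.eq (hM : M.Assumptions)
    {K : TraceClass (Compound d E) →L[ℂ] TraceClass (Compound d E)}
    {W : ℝ → TraceClass (Compound d E) →L[ℂ] TraceClass (Compound d E)}
    (h : M.IsReducedEvolution K W) {t : ℝ} (ht : 0 ≤ t) :
    W t = M.U t * (NormedSpace.exp ((t : ℂ) • K) * M.P₀) := by
  refine eq_mul_exp_mul_of_integral_eq h.1 (continuous_Uinv hM) (U_mul_Uinv hM) (Uinv_mul_U hM)
    (P₀_comp_U hM) (fun t ht => ?_) ht
  rw [h.2 t ht]
  simp only [inverse_U hM]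
  rfl

theorem partialTrace_tensorState_ωE (hM : M.Assumptions) (ρ : Mat d) :
    partialTrace (tensorState M.ωE ρ) = ρ := by
  rw [partialTrace_tensorState, hM.trace_ωE, one_smul]

theorem reducedEvolution_apply (hM : M.Assumptions) (t : ℝ) (v : TraceClass (Compound d E)) :
    M.reducedEvolution t v = tensorState M.ωE ((mulBoth (M.u t) (M.u t).conjTranspose ∘L
      NormedSpace.exp ((t : ℂ) • M.generator)) (partialTrace v)) := by
  have h1 : ((t : ℂ) • M.lift M.generator) ∘L tensorState M.ωE =
      tensorState M.ωE ∘L ((t : ℂ) • M.generator) := by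
    refine ContinuousLinearMap.ext fun ρ => ?_
    change (t : ℂ) • tensorState M.ωE (M.generator (partialTrace (tensorState M.ωE ρ))) =
      tensorState M.ωE ((t : ℂ) • M.generator ρ)
    rw [partialTrace_tensorState_ωE hM, map_smul]
  have h2 := exp_comp_of_comp_eq h1
  have h3 := U_comp_tensorState hM t
  change M.U t ((NormedSpace.exp ((t : ℂ) • M.lift M.generator) ∘L tensorState M.ωE)
    (partialTrace v)) = _
  rw [h2]
  exact congrArg (fun T : Mat d →L[ℂ] TraceClass (Compound d E) =>
    T (NormedSpace.exp ((t : ℂ) • M.generator) (partialTrace v))) h3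

/-- The reduced dynamics `ρ ↦ u_t e^{tG}(ρ) u_t†`, where `G` generates the dynamics in the
interaction picture. -/
def reducedDynamics (M : OpenSystem r d m E) (t : ℝ) : SuperOp d :=
  mulBoth (M.u t) (M.u t).conjTranspose ∘L NormedSpace.exp ((t : ℂ) • M.generator)

/-- The reduced dynamics exists, with an explicit formula. -/
theorem isReducedDynamics (hM : M.Assumptions) : M.IsReducedDynamics M.reducedDynamics := by
  refine ⟨_, _, isLocalAverage hM, isReducedEvolution hM, fun t _ v₀ ρ₀ h => ?_⟩
  have hρ : ρ₀ = partialTrace v₀ := by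
    have h' := congrArg partialTrace h
    rw [partialTrace_tensorState_ωE hM] at h'
    rw [h']
    exact partialTrace_tensorState_ωE hM _
  rw [reducedEvolution_apply hM, hρ]
  rfl

/-- The reduced dynamics is unique on `[0, ∞)`. -/
theorem IsReducedDynamics.eq (hM : M.Assumptions) {Λ : ℝ → SuperOp d}
    (h : M.IsReducedDynamics Λ) {t : ℝ} (ht : 0 ≤ t) : Λ t = M.reducedDynamics t := by
  obtain ⟨K, W, hK, hW, hΛ⟩ := h
  refine ContinuousLinearMap.ext fun ρ => ?_
  have hWt : W t = M.reducedEvolution t := by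
    rw [hW.eq hM ht, hK.eq hM]
    rfl
  have h1 := hΛ t ht (tensorState M.ωE ρ) ρ (by
    change _ = tensorState M.ωE (partialTrace (tensorState M.ωE ρ))
    rw [partialTrace_tensorState_ωE hM])
  have h2 := congrArg partialTrace h1
  rw [hWt, reducedEvolution_apply hM, partialTrace_tensorState_ωE hM,
    partialTrace_tensorState_ωE hM, partialTrace_tensorState_ωE hM] at h2
  exact h2.symm

end OpenSystem

end

/-! ### The product form of the reduced dynamics and the master equation -/

section

theorem exp_smul_add_of_commute {𝔸 : Type*} [NormedRing 𝔸] [NormedAlgebra ℂ 𝔸] [CompleteSpace 𝔸]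
    {A B : 𝔸} (h : Commute A B) (c : ℂ) :
    NormedSpace.exp (c • (A + B)) = NormedSpace.exp (c • A) * NormedSpace.exp (c • B) := by
  let : NormedAlgebra ℚ 𝔸 := NormedAlgebra.restrictScalars ℚ ℂ 𝔸
  rw [smul_add, NormedSpace.exp_add_of_commute ((h.smul_left _).smul_right _)]

section SuperOp

variable {d : ℕ}

-- Instance synthesis does not find the next two through the operator norm on `Mat d`.
instance : IsScalarTower ℂ (SuperOp d) (SuperOp d) := ⟨fun _ _ _ => rfl⟩

instance : SMulCommClass ℂ (SuperOp d) (SuperOp d) :=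
  ⟨fun c A B => ContinuousLinearMap.ext fun ρ => (A.map_smul c (B ρ)).symm⟩

/-- `HasDerivWithinAt.congr_deriv`, with the instances of `SuperOp d` fixed. -/
theorem HasDerivWithinAt.congr_superOp {f : ℝ → SuperOp d} {f' g' : SuperOp d} {s : Set ℝ} {t : ℝ}
    (h : HasDerivWithinAt f f' s t) (e : f' = g') : HasDerivWithinAt f g' s t := e ▸ h

theorem hasDerivWithinAt_mulBoth {a b : ℝ → Mat d} {a' b' : Mat d} {s : Set ℝ} {t : ℝ}
    (ha : HasDerivWithinAt a a' s t) (hb : HasDerivWithinAt b b' s t) :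
    HasDerivWithinAt (fun t => mulBoth (a t) (b t))
      (mulBoth a' (b t) + mulBoth (a t) b') s t := by
  have h := ((ContinuousLinearMap.mulLeftRight ℂ (Mat d)).bilinearRestrictScalars
    ℝ).hasDerivWithinAt_of_bilinear ha hb
  exact h.congr_deriv (add_comm _ _)

theorem continuous_mulBoth {X : Type*} [TopologicalSpace X] {a b : X → Mat d}
    (ha : Continuous a) (hb : Continuous b) : Continuous fun x => mulBoth (a x) (b x) :=
  ((ContinuousLinearMap.mulLeftRight ℂ (Mat d)).continuous.comp ha).clm_apply hb

theorem adMap_apply (A ρ : Mat d) : adMap A ρ = A * ρ - ρ * A := by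
  rw [adMap, sub_apply, mulBoth_apply, mulBoth_apply, mul_one, one_mul]

/-- If `A` and `C†` oscillate with the same frequency under `H`, then `ρ ↦ A ρ C`
commutes with `[H, ·]`. -/
theorem commute_adMap_mulBoth {H A C : Mat d} {w : ℂ} (hA : H * A = A * H + w • A)
    (hC : C * H = H * C + w • C) : Commute (adMap H) (mulBoth A C) := by
  refine ContinuousLinearMap.ext fun ρ => ?_
  change adMap H (mulBoth A C ρ) = mulBoth A C (adMap H ρ)
  rw [adMap_apply, adMap_apply, mulBoth_apply, mulBoth_apply]
  have h1 : H * (A * ρ * C) = A * H * ρ * C + w • (A * ρ * C) := by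
    rw [← mul_assoc, ← mul_assoc, hA, add_mul, add_mul, smul_mul_assoc, smul_mul_assoc]
  have h2 : A * ρ * C * H = A * ρ * H * C + w • (A * ρ * C) := by
    rw [mul_assoc _ C, hC, mul_add, mul_smul_comm, ← mul_assoc]
  rw [h1, h2]
  noncomm_ring

theorem commute_adMap_dissipator {H A B : Mat d} {w : ℂ} (hA : H * A = A * H + w • A)
    (hB : B.conjTranspose * H = H * B.conjTranspose + w • B.conjTranspose) :
    Commute (adMap H) (dissipator A B) := by
  have hBA : H * (B.conjTranspose * A) = B.conjTranspose * A * H := by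
    have h1 : H * B.conjTranspose = B.conjTranspose * H - w • B.conjTranspose := by
      rw [hB, add_sub_cancel_right]
    rw [← mul_assoc, h1, sub_mul, mul_assoc, hA, mul_add, smul_mul_assoc, mul_smul_comm,
      add_sub_cancel_right, mul_assoc]
  have h0 : ∀ C : Mat d, C + (0 : ℂ) • C = C := fun C => by rw [zero_smul, add_zero]
  refine (commute_adMap_mulBoth hA hB).sub_right (Commute.smul_right (Commute.add_right ?_ ?_) _)
  · exact commute_adMap_mulBoth (w := 0) (by rw [zero_smul, add_zero, hBA])
      (by rw [zero_smul, add_zero, one_mul, mul_one])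
  · exact commute_adMap_mulBoth (w := 0) (by rw [zero_smul, add_zero, one_mul, mul_one])
      (by rw [zero_smul, add_zero, hBA])

theorem mulBoth_star_mul_generator (h a : Mat d) :
    ((-Complex.I) • adMap h) * mulBoth a a.conjTranspose =
      mulBoth ((-Complex.I) • (h * a)) a.conjTranspose +
        mulBoth a (Complex.I • (a.conjTranspose * h)) := by
  refine ContinuousLinearMap.ext fun ρ => ?_
  change (-Complex.I) • adMap h (mulBoth a a.conjTranspose ρ) =
    mulBoth ((-Complex.I) • (h * a)) a.conjTranspose ρ +
        mulBoth a (Complex.I • (a.conjTranspose * h)) ρ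
  simp only [adMap_apply, mulBoth_apply, smul_mul_assoc, mul_smul_comm, smul_sub, mul_assoc,
    neg_smul, neg_mul, sub_neg_eq_add]

theorem hasDerivWithinAt_mulBoth_star {a : ℝ → Mat d} {h : Mat d} {s : Set ℝ} {t : ℝ}
    (ha : HasDerivWithinAt a ((-Complex.I) • (h * a t)) s t) (hh : h.IsHermitian) :
    HasDerivWithinAt (fun t => mulBoth (a t) (a t).conjTranspose)
      (((-Complex.I) • adMap h) * mulBoth (a t) (a t).conjTranspose) s t := by
  refine HasDerivWithinAt.congr_superOp (hasDerivWithinAt_mulBoth ha ha.star) ?_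
  rw [mulBoth_star_mul_generator]
  congr 2
  rw [star_smul, star_mul, Matrix.star_eq_conjTranspose h, hh.eq, RCLike.star_def, map_neg,
    Complex.conj_I, neg_neg]
  rfl

theorem mulBoth_conj_adMap {a b : Mat d} (hba : b * a = 1) (A : Mat d) :
    mulBoth a b * adMap A = adMap (a * A * b) * mulBoth a b := by
  refine ContinuousLinearMap.ext fun ρ => ?_
  change mulBoth a b (adMap A ρ) = adMap (a * A * b) (mulBoth a b ρ)
  rw [adMap_apply, adMap_apply, mulBoth_apply, mulBoth_apply, mul_sub, sub_mul]
  have h1 : a * A * b * (a * ρ * b) = a * (A * ρ) * b := by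
    calc a * A * b * (a * ρ * b) = a * A * (b * a) * ρ * b := by simp only [mul_assoc]
      _ = _ := by rw [hba, mul_one]; simp only [mul_assoc]
  have h2 : a * ρ * b * (a * A * b) = a * (ρ * A) * b := by
    calc a * ρ * b * (a * A * b) = a * ρ * (b * a) * A * b := by simp only [mul_assoc]
      _ = _ := by rw [hba, mul_one]; simp only [mul_assoc]
  rw [h1, h2]

end SuperOp

/-- If `P' = A P - P B`, then `P` maps solutions of `y' = B y` to solutions of `x' = A x`. -/
theorem IsSolution.intertwine {V : Type*} [NormedAddCommGroup V] [NormedSpace ℂ V]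
    {A B P : ℝ → V →L[ℂ] V} {y : ℝ → V} (hy : IsSolution B y)
    (hP : ∀ t, 0 ≤ t → HasDerivWithinAt P (A t * P t - P t * B t) (Set.Ici 0) t) :
    IsSolution A fun t => P t (y t) := by
  intro t ht
  have h1 : HasDerivWithinAt (fun t => (P t).restrictScalars ℝ)
      ((A t * P t - P t * B t).restrictScalars ℝ) (Set.Ici 0) t :=
    ((ContinuousLinearMap.restrictScalarsL ℂ V V ℝ ℝ).hasFDerivAt.comp_hasDerivWithinAt t
      (hP t ht))
  have h2 := h1.clm_apply (hy t ht)
  refine h2.congr_deriv ?_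
  change (A t * P t - P t * B t) (y t) + P t (B t (y t)) = A t (P t (y t))
  rw [sub_apply, mul_apply_eq_comp, mul_apply_eq_comp, sub_add_cancel]

namespace OpenSystem

variable {r d m : ℕ} {E : Type*} [NormedAddCommGroup E] [InnerProductSpace ℂ E] [CompleteSpace E]
variable {M : OpenSystem r d m E}

theorem Hbar_mul_Scomp (μ : Fin m) (n : Fin r → ℤ) (w : ℝ) :
    M.Hbar * M.Scomp μ n w = M.Scomp μ n w * M.Hbar + (w : ℂ) • M.Scomp μ n w := by
  rw [Scomp_eq_bohrComponent, Hbar_mul_bohrComponent]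

theorem conjTranspose_Scomp_mul_Hbar (μ : Fin m) (n : Fin r → ℤ) (w : ℝ) :
    (M.Scomp μ n w).conjTranspose * M.Hbar =
      M.Hbar * (M.Scomp μ n w).conjTranspose + (w : ℂ) • (M.Scomp μ n w).conjTranspose := by
  have h := congrArg Matrix.conjTranspose (Hbar_mul_Scomp (M := M) μ n w)
  rw [Matrix.conjTranspose_mul, Matrix.conjTranspose_add, Matrix.conjTranspose_mul,
    Matrix.conjTranspose_smul, M.hermitian_Hbar.eq] at h
  simpa using h

theorem commute_Hbar_ΔH : Commute M.Hbar M.ΔH := by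
  refine Commute.sum_right _ _ _ fun μ _ => Commute.sum_right _ _ _ fun ν _ =>
    Commute.tsum_right _ fun n => Commute.sum_right _ _ _ fun w _ => Commute.smul_right ?_ _
  have h1 := conjTranspose_Scomp_mul_Hbar (M := M) μ n w
  rw [← sub_eq_iff_eq_add] at h1
  change M.Hbar * (_ * _) = _ * _ * M.Hbar
  rw [← mul_assoc, ← h1, mul_assoc _ _ M.Hbar, sub_mul, mul_assoc, Hbar_mul_Scomp, mul_add,
    mul_smul_comm, smul_mul_assoc, add_sub_cancel_right]

/-- All terms of the generator couple components of equal frequency, so they commute with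
`[H̄, ·]`. -/
theorem commute_adMap_generator : Commute (adMap M.Hbar) M.generator := by
  have h1 : Commute (adMap M.Hbar) (adMap M.ΔH) := by
    have h := (commute_Hbar_ΔH (M := M)).eq
    refine Commute.sub_right ?_ ?_
    · exact commute_adMap_mulBoth (w := 0) (by rw [zero_smul, add_zero, h])
        (by rw [zero_smul, add_zero, one_mul, mul_one])
    · exact commute_adMap_mulBoth (w := 0) (by rw [zero_smul, add_zero, one_mul, mul_one])
        (by rw [zero_smul, add_zero, h])
  refine (h1.smul_right _).add_right ?_
  refine Commute.sum_right _ _ _ fun μ _ => Commute.sum_right _ _ _ fun ν _ =>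
    Commute.tsum_right _ fun n => Commute.sum_right _ _ _ fun w _ => Commute.smul_right ?_ _
  exact commute_adMap_dissipator (Hbar_mul_Scomp ν n w) (conjTranspose_Scomp_mul_Hbar μ n w)

theorem adMap_add (A B : Mat d) : adMap (A + B) = adMap A + adMap B := by
  rw [← adMapL_apply, map_add, adMapL_apply, adMapL_apply]

theorem X_eq : M.X = (-Complex.I) • adMap M.Hbar + M.generator := by
  rw [X, generator, adMap_add, smul_add, add_assoc]

theorem exp_smul_adMap_Hbar (t : ℝ) : NormedSpace.exp ((t : ℂ) • ((-Complex.I) • adMap M.Hbar)) =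
    mulBoth (M.sysU t) (M.sysU t).conjTranspose := by
  have h := eq_exp_mul_of_hasDerivWithinAt (𝔸 := SuperOp d) convex_univ (Set.mem_univ 0)
    (Z := (-Complex.I) • adMap M.Hbar)
    (g := fun t => mulBoth (M.sysU t) (M.sysU t).conjTranspose) (fun t _ =>
      hasDerivWithinAt_mulBoth_star (M.hasDerivAt_sysU t).hasDerivWithinAt M.hermitian_Hbar)
    (Set.mem_univ t)
  rw [sysU_zero, Matrix.conjTranspose_one, mulBoth_one, mul_one] at h
  exact h.symm

/-- In the frame which rotates with `p_t` the generator `X` splits into commuting parts. -/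
theorem exp_smul_X (t : ℝ) : NormedSpace.exp ((t : ℂ) • M.X) =
    mulBoth (M.sysU t) (M.sysU t).conjTranspose * NormedSpace.exp ((t : ℂ) • M.generator) := by
  rw [X_eq, ← exp_smul_adMap_Hbar]
  exact exp_smul_add_of_commute (𝔸 := SuperOp d) (A := (-Complex.I) • adMap M.Hbar)
    (B := M.generator) (commute_adMap_generator.smul_left _) _

theorem mulBoth_u (t : ℝ) : mulBoth (M.u t) (M.u t).conjTranspose =
    M.Sigma t * mulBoth (M.sysU t) (M.sysU t).conjTranspose := by
  rw [Sigma, mulBoth_mul_mulBoth, u_eq, Matrix.conjTranspose_mul]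

theorem reducedDynamics_eq (t : ℝ) :
    M.reducedDynamics t = M.Sigma t ∘L NormedSpace.exp ((t : ℂ) • M.X) := by
  rw [exp_smul_X]
  change mulBoth (M.u t) (M.u t).conjTranspose * _ = M.Sigma t * (_ * _)
  rw [mulBoth_u, mul_assoc]

/-- The inverse `ρ ↦ p_t† ρ p_t` of `Σ_t`. -/
def Sigmainv (M : OpenSystem r d m E) (t : ℝ) : SuperOp d :=
  mulBoth (M.p t).conjTranspose (M.p t)

theorem Sigma_mul_Sigmainv (hM : M.Assumptions) (t : ℝ) : M.Sigma t * M.Sigmainv t = 1 := by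
  rw [Sigma, Sigmainv, mulBoth_mul_mulBoth, p_mul_conjTranspose hM, mulBoth_one]

theorem Sigmainv_mul_Sigma (hM : M.Assumptions) (t : ℝ) : M.Sigmainv t * M.Sigma t = 1 := by
  rw [Sigma, Sigmainv, mulBoth_mul_mulBoth, conjTranspose_p_mul hM, mulBoth_one]

theorem inverse_Sigma (hM : M.Assumptions) (t : ℝ) : (M.Sigma t).inverse = M.Sigmainv t :=
  ContinuousLinearMap.inverse_eq (Sigma_mul_Sigmainv hM t) (Sigmainv_mul_Sigma hM t)

theorem L_eq (hM : M.Assumptions) (t : ℝ) : M.L t =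
    (-Complex.I) • adMap (M.H t) + M.Sigma t * M.generator * M.Sigmainv t := by
  have h : M.Sigma t * adMap M.ΔH * M.Sigmainv t = adMap (M.Sigma t M.ΔH) := by
    rw [Sigma, mulBoth_conj_adMap (conjTranspose_p_mul hM t), mul_assoc, Sigmainv,
      mulBoth_mul_mulBoth, p_mul_conjTranspose hM, mulBoth_one, mul_one]
    rfl
  rw [L, inverse_Sigma hM, adMap_add, ← h, generator, smul_add, mul_add, add_mul, mul_smul_comm,
    smul_mul_assoc, add_assoc]
  rfl

theorem Sigma_zero (hM : M.Assumptions) : M.Sigma 0 = 1 := by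
  rw [Sigma, hM.p_zero, Matrix.conjTranspose_one, mulBoth_one]

theorem hasDerivWithinAt_p (hM : M.Assumptions) {t : ℝ} (ht : 0 ≤ t) :
    HasDerivWithinAt M.p ((-Complex.I) • (M.H t * M.p t) + Complex.I • (M.p t * M.Hbar))
      (Set.Ici 0) t := by
  have hp : M.p = fun t => M.u t * M.sysU (-t) := funext fun t => by
    rw [u_eq, mul_assoc, sysU_mul, add_neg_cancel, sysU_zero, mul_one]
  have h1 : HasDerivAt (fun t => M.sysU (-t)) (Complex.I • (M.Hbar * M.sysU (-t))) t := by
    refine ((M.hasDerivAt_sysU (-t)).scomp t (hasDerivAt_neg t)).congr_deriv ?_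
    rw [neg_smul, neg_smul, one_smul, neg_neg]
  have hc : Commute M.Hbar (M.sysU (-t)) :=
    Commute.exp_right ((Commute.refl M.Hbar).smul_right _)
  have h2 : HasDerivWithinAt (fun t => M.u t * M.sysU (-t)) _ _ _ :=
    (hM.schroedinger t ht).mul h1.hasDerivWithinAt
  have e : M.p t = M.u t * M.sysU (-t) := congrFun hp t
  rw [← hp] at h2
  refine h2.congr_deriv ?_
  rw [e, smul_mul_assoc, mul_smul_comm, mul_assoc, mul_assoc, hc.eq]

theorem hasDerivWithinAt_Sigma (hM : M.Assumptions) {t : ℝ} (ht : 0 ≤ t) :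
    HasDerivWithinAt M.Sigma (M.L t * M.Sigma t - M.Sigma t * M.X) (Set.Ici 0) t := by
  have hp := hasDerivWithinAt_p hM ht
  refine HasDerivWithinAt.congr_superOp (hasDerivWithinAt_mulBoth hp hp.star) ?_
  have e1 : M.L t * M.Sigma t - M.Sigma t * M.X =
      (-Complex.I) • (adMap (M.H t) * M.Sigma t) +
        Complex.I • (M.Sigma t * adMap M.Hbar) := by
    rw [L_eq hM, X_eq, add_mul, mul_add, mul_assoc _ (M.Sigmainv t), Sigmainv_mul_Sigma hM,
      mul_one, smul_mul_assoc, mul_smul_comm]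
    module
  rw [e1]
  refine ContinuousLinearMap.ext fun ρ => ?_
  change mulBoth _ _ ρ + mulBoth _ _ ρ = (-Complex.I) • adMap (M.H t) (M.Sigma t ρ) +
    Complex.I • M.Sigma t (adMap M.Hbar ρ)
  rw [adMap_apply, adMap_apply, Sigma, mulBoth_apply, mulBoth_apply, mulBoth_apply, mulBoth_apply,
    star_add, star_smul, star_smul, star_mul, star_mul, Matrix.star_eq_conjTranspose,
    Matrix.star_eq_conjTranspose, Matrix.star_eq_conjTranspose, (hM.hermitian_H t).eq,
    M.hermitian_Hbar.eq, RCLike.star_def, map_neg, Complex.conj_I, neg_neg]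
  simp only [mul_add, add_mul, mul_sub, sub_mul, smul_mul_assoc, mul_smul_comm, mul_assoc,
    neg_smul, neg_mul, mul_neg, smul_sub]
  abel

theorem hasDerivWithinAt_Sigmainv (hM : M.Assumptions) {t : ℝ} (ht : 0 ≤ t) :
    HasDerivWithinAt M.Sigmainv (M.X * M.Sigmainv t - M.Sigmainv t * M.L t) (Set.Ici 0) t := by
  have hp := hasDerivWithinAt_p hM ht
  refine HasDerivWithinAt.congr_superOp (hasDerivWithinAt_mulBoth hp.star hp) ?_
  have e1 : M.X * M.Sigmainv t - M.Sigmainv t * M.L t =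
      (-Complex.I) • (adMap M.Hbar * M.Sigmainv t) +
        Complex.I • (M.Sigmainv t * adMap (M.H t)) := by
    rw [L_eq hM, X_eq, add_mul, mul_add, mul_assoc (M.Sigma t), ← mul_assoc (M.Sigmainv t),
      Sigmainv_mul_Sigma hM, one_mul, smul_mul_assoc, mul_smul_comm]
    module
  rw [e1]
  refine ContinuousLinearMap.ext fun ρ => ?_
  change mulBoth _ _ ρ + mulBoth _ _ ρ = (-Complex.I) • adMap M.Hbar (M.Sigmainv t ρ) +
    Complex.I • M.Sigmainv t (adMap (M.H t) ρ)
  rw [adMap_apply, adMap_apply, Sigmainv, mulBoth_apply, mulBoth_apply, mulBoth_apply,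
    mulBoth_apply, star_add, star_smul, star_smul, star_mul, star_mul,
    Matrix.star_eq_conjTranspose, Matrix.star_eq_conjTranspose, Matrix.star_eq_conjTranspose,
    (hM.hermitian_H t).eq, M.hermitian_Hbar.eq, RCLike.star_def, map_neg, Complex.conj_I, neg_neg]
  simp only [mul_add, add_mul, mul_sub, sub_mul, smul_mul_assoc, mul_smul_comm, mul_assoc,
    neg_smul, neg_mul, mul_neg, smul_sub]
  abel

theorem isQuasiperiodic_Sigma (hM : M.Assumptions) : IsQuasiperiodic M.Ω M.Sigma :=
  ⟨fun θ => mulBoth (M.phat θ) (M.phat θ).conjTranspose,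
    continuous_mulBoth hM.continuous_phat hM.continuous_phat.star, fun _ => rfl⟩

theorem isQuasiperiodic_L (hM : M.Assumptions) : IsQuasiperiodic M.Ω M.L := by
  refine ⟨fun θ => (-Complex.I) • adMap (M.Hhat θ) +
    mulBoth (M.phat θ) (M.phat θ).conjTranspose * M.generator *
      mulBoth (M.phat θ).conjTranspose (M.phat θ), ?_, fun t => L_eq hM t⟩
  have h : Continuous fun θ => (-Complex.I) • adMap (M.Hhat θ) :=
    ((-Complex.I) • adMapL d).continuous.comp hM.continuous_Hhat
  exact h.add
    (((continuous_mulBoth hM.continuous_phat hM.continuous_phat.star).mul continuous_const).mul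
      (continuous_mulBoth hM.continuous_phat.star hM.continuous_phat))

/-- The change of variables is `Σ_t`. -/
theorem isReducible_L (hM : M.Assumptions) : IsReducible M.Ω M.L := by
  refine ⟨M.Sigma, M.X, isQuasiperiodic_Sigma hM, Sigma_zero hM, fun t =>
    ⟨⟨M.Sigma t, M.Sigmainv t, Sigma_mul_Sigmainv hM t, Sigmainv_mul_Sigma hM t⟩, rfl⟩,
    fun y => ⟨fun hy => hy.intertwine fun t ht => hasDerivWithinAt_Sigma hM ht, fun hx => ?_⟩⟩
  have h := hx.intertwine (A := fun _ => M.X) fun t ht => hasDerivWithinAt_Sigmainv hM ht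
  have e : ∀ t, M.Sigmainv t (M.Sigma t (y t)) = y t := fun t =>
    congrArg (fun T : SuperOp d => T (y t)) (Sigmainv_mul_Sigma hM t)
  simpa only [e] using h

theorem isSolution_exp_smul_X (ρ : Mat d) :
    IsSolution (fun _ => M.X) fun t => NormedSpace.exp ((t : ℂ) • M.X) ρ := by
  intro t _
  have h1 := ((ContinuousLinearMap.apply ℂ (Mat d) ρ).restrictScalars ℝ).hasFDerivAt.comp_hasDerivAt
    t (hasDerivAt_exp_ofReal_smul M.X t)
  exact h1.hasDerivWithinAt

/-- The Markovian master equation. -/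
theorem isSolution_reducedDynamics (hM : M.Assumptions) (ρ : Mat d) :
    IsSolution M.L fun t => M.reducedDynamics t ρ := by
  simp only [reducedDynamics_eq]
  exact (isSolution_exp_smul_X ρ).intertwine fun t ht => hasDerivWithinAt_Sigma hM ht

end OpenSystem

end

/-! ### Semigroups with a generator in standard form -/

section

open Filter Topology

theorem exp_add_smul_one {𝔸 : Type*} [NormedRing 𝔸] [NormedAlgebra ℂ 𝔸] [CompleteSpace 𝔸]
    (A : 𝔸) (c : ℂ) : NormedSpace.exp (A + c • 1) = Complex.exp c • NormedSpace.exp A := by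
  let : NormedAlgebra ℚ 𝔸 := NormedAlgebra.restrictScalars ℚ ℂ 𝔸
  have h : Commute A (c • (1 : 𝔸)) := (Commute.one_right A).smul_right c
  rw [NormedSpace.exp_add_of_commute h, ← Algebra.algebraMap_eq_smul_one,
    ← NormedSpace.algebraMap_exp_comm, ← Complex.exp_eq_exp_ℂ, ← Algebra.commutes, Algebra.smul_def]

theorem continuous_exp_const_smul {𝔸 : Type*} [NormedRing 𝔸] [NormedAlgebra ℂ 𝔸] [CompleteSpace 𝔸]
    (c : ℂ) : Continuous fun Z : 𝔸 => NormedSpace.exp (c • Z) := by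
  let : NormedAlgebra ℚ 𝔸 := NormedAlgebra.restrictScalars ℚ ℂ 𝔸
  exact NormedSpace.exp_continuous.comp (continuous_const_smul c)

theorem tendsto_add_one_div_smul {V : Type*} [NormedAddCommGroup V] [NormedSpace ℂ V] (a b : V) :
    Tendsto (fun n : ℕ => a + (((1 / ((n : ℝ) + 1) : ℝ)) : ℂ) • b) atTop (𝓝 a) := by
  have h1 : Tendsto (fun n : ℕ => (((1 / ((n : ℝ) + 1) : ℝ)) : ℂ) • b) atTop
      (𝓝 (((0 : ℝ) : ℂ) • b)) :=
    ((Complex.continuous_ofReal.tendsto 0).comp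
      (tendsto_one_div_add_atTop_nhds_zero_nat (𝕜 := ℝ))).smul_const b
  rw [Complex.ofReal_zero, zero_smul] at h1
  simpa using h1.const_add a

section CompletelyPositive

variable {d : ℕ}

theorem isCompletelyPositive_iff {Φ : SuperOp d} : IsCompletelyPositive Φ ↔
    ∀ (k : ℕ) (N : CStarMatrix (Fin k) (Fin k) (Mat d)), 0 ≤ N → 0 ≤ N.map Φ := by
  constructor
  · rintro ⟨Ψ, h⟩ k N hN
    have e : N.map Φ = N.map Ψ := CStarMatrix.ext fun i j => (h _).symm
    rw [e]
    exact Ψ.map_cstarMatrix_nonneg N hN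
  · intro h
    exact ⟨{ (Φ : Mat d →ₗ[ℂ] Mat d) with map_cstarMatrix_nonneg' := h }, fun _ => rfl⟩

theorem isCompletelyPositive_one : IsCompletelyPositive (1 : SuperOp d) :=
  isCompletelyPositive_iff.2 fun _ _ hN => hN

theorem IsCompletelyPositive.mul {Φ Ψ : SuperOp d} (hΦ : IsCompletelyPositive Φ)
    (hΨ : IsCompletelyPositive Ψ) : IsCompletelyPositive (Φ * Ψ) :=
  isCompletelyPositive_iff.2 fun k _ hN =>
    isCompletelyPositive_iff.1 hΦ k _ (isCompletelyPositive_iff.1 hΨ k _ hN)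

theorem IsCompletelyPositive.pow {Φ : SuperOp d} (hΦ : IsCompletelyPositive Φ) (n : ℕ) :
    IsCompletelyPositive (Φ ^ n) := by
  induction n with
  | zero => rw [pow_zero]; exact isCompletelyPositive_one
  | succ n ih => rw [pow_succ]; exact ih.mul hΦ

theorem IsCompletelyPositive.add {Φ Ψ : SuperOp d} (hΦ : IsCompletelyPositive Φ)
    (hΨ : IsCompletelyPositive Ψ) : IsCompletelyPositive (Φ + Ψ) :=
  isCompletelyPositive_iff.2 fun k N hN => by
    have e : N.map (Φ + Ψ) = N.map Φ + N.map Ψ := rfl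
    rw [e]
    exact add_nonneg (isCompletelyPositive_iff.1 hΦ k N hN) (isCompletelyPositive_iff.1 hΨ k N hN)

theorem isCompletelyPositive_zero : IsCompletelyPositive (0 : SuperOp d) :=
  isCompletelyPositive_iff.2 fun _ N _ => le_of_eq (show (0 : CStarMatrix _ _ _) = N.map _ from rfl)

theorem isCompletelyPositive_sum {ι : Type*} {s : Finset ι} {Φ : ι → SuperOp d}
    (h : ∀ i ∈ s, IsCompletelyPositive (Φ i)) : IsCompletelyPositive (∑ i ∈ s, Φ i) :=
  Finset.sum_induction _ _ (fun _ _ => IsCompletelyPositive.add) isCompletelyPositive_zero h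

theorem isCompletelyPositive_mulBoth (A : Mat d) :
    IsCompletelyPositive (mulBoth A A.conjTranspose) :=
  isCompletelyPositive_iff.2 fun k N hN => by
    let D : CStarMatrix (Fin k) (Fin k) (Mat d) := CStarMatrix.ofMatrix (Matrix.diagonal fun _ => A)
    have e : N.map (mulBoth A A.conjTranspose) = D * N * star D := by
      have e1 : ∀ i j, (D * N) i j = A * N i j := fun i j =>
        Matrix.diagonal_mul (fun _ => A) (CStarMatrix.ofMatrix.symm N) i j
      have hD : ∀ j l, (star D) l j = if l = j then A.conjTranspose else 0 := fun j l => by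
        change star (Matrix.diagonal (fun _ => A) j l) = _
        rw [Matrix.diagonal_apply]
        by_cases h : l = j
        · rw [if_pos h, if_pos h.symm]; rfl
        · rw [if_neg h, if_neg (Ne.symm h), star_zero]
      refine CStarMatrix.ext fun i j => ?_
      rw [CStarMatrix.map_apply, CStarMatrix.mul_apply, Finset.sum_eq_single j]
      · rw [e1, hD, if_pos rfl, mulBoth_apply]
      · intro l _ hl
        rw [hD, if_neg hl, mul_zero]
      · simp
    rw [e]
    exact star_right_conjugate_nonneg hN D

theorem IsCompletelyPositive.smul {Φ : SuperOp d} (hΦ : IsCompletelyPositive Φ) {c : ℝ}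
    (hc : 0 ≤ c) : IsCompletelyPositive ((c : ℂ) • Φ) := by
  have e : mulBoth ((Real.sqrt c : ℂ) • 1) ((Real.sqrt c : ℂ) • 1 : Mat d).conjTranspose =
      (c : ℂ) • (1 : SuperOp d) := by
    refine ContinuousLinearMap.ext fun ρ => ?_
    change ((Real.sqrt c : ℂ) • 1) * ρ * ((Real.sqrt c : ℂ) • 1 : Mat d).conjTranspose = (c : ℂ) • ρ
    rw [Matrix.conjTranspose_smul, Matrix.conjTranspose_one, smul_mul_assoc, one_mul,
      mul_smul_comm, mul_one, smul_smul, RCLike.star_def, Complex.conj_ofReal,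
      ← Complex.ofReal_mul, Real.mul_self_sqrt hc]
  have h := (isCompletelyPositive_mulBoth ((Real.sqrt c : ℂ) • (1 : Mat d))).mul hΦ
  rwa [e, smul_mul_assoc, one_mul] at h

/-- Positivity of each `N.map Φ` is a closed condition on `Φ`. -/
theorem isClosed_isCompletelyPositive : IsClosed {Φ : SuperOp d | IsCompletelyPositive Φ} := by
  have e : {Φ : SuperOp d | IsCompletelyPositive Φ} =
      ⋂ (k : ℕ), ⋂ (N : CStarMatrix (Fin k) (Fin k) (Mat d)), ⋂ (_ : 0 ≤ N),
        (fun Φ : SuperOp d => N.map Φ) ⁻¹' Set.Ici 0 := by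
    ext Φ
    simp only [Set.mem_iInter, Set.mem_preimage, Set.mem_Ici]
    exact isCompletelyPositive_iff
  rw [e]
  refine isClosed_iInter fun k => isClosed_iInter fun N => isClosed_iInter fun _ =>
    isClosed_Ici.preimage ?_
  exact continuous_pi fun i => continuous_pi fun j =>
    (ContinuousLinearMap.apply ℂ (Mat d) (N i j)).continuous

/-- The partial sums of the exponential series are completely positive. -/
theorem IsCompletelyPositive.exp {Φ : SuperOp d} (hΦ : IsCompletelyPositive Φ) :
    IsCompletelyPositive (NormedSpace.exp Φ) := by
  have h := NormedSpace.exp_series_hasSum_exp' (𝕂 := ℂ) Φ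
  refine isClosed_isCompletelyPositive.mem_of_tendsto h (Eventually.of_forall fun s => ?_)
  refine isCompletelyPositive_sum fun n _ => ?_
  have e : ((n.factorial : ℂ))⁻¹ = (((n.factorial : ℝ)⁻¹ : ℝ) : ℂ) := by push_cast; rfl
  rw [e]
  exact (hΦ.pow n).smul (by positivity)

/-- A generator in standard form generates completely positive maps: up to a small error it is
the sum of a completely positive map and a negative multiple of the identity. -/
theorem isCompletelyPositive_exp_generator (G : Mat d) {J : SuperOp d}
    (hJ : IsCompletelyPositive J) {t : ℝ} (ht : 0 ≤ t) : IsCompletelyPositive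
      (NormedSpace.exp ((t : ℂ) • (mulBoth G 1 + mulBoth 1 G.conjTranspose + J))) := by
  set Y : ℕ → SuperOp d := fun n => mulBoth G 1 + mulBoth 1 G.conjTranspose + J +
    ((1 / ((n : ℝ) + 1) : ℝ) : ℂ) • mulBoth G G.conjTranspose with hY
  have hlim : Tendsto Y atTop (𝓝 (mulBoth G 1 + mulBoth 1 G.conjTranspose + J)) :=
    tendsto_add_one_div_smul (V := SuperOp d) _ _
  have hcont : Continuous fun Z : SuperOp d => NormedSpace.exp ((t : ℂ) • Z) :=
    continuous_exp_const_smul (𝔸 := SuperOp d) t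
  refine isClosed_isCompletelyPositive.mem_of_tendsto ((hcont.tendsto _).comp hlim)
    (Eventually.of_forall fun n => ?_)
  have hn : ((n : ℝ) + 1) ≠ 0 := by positivity
  have hn' : ((n : ℂ) + 1) ≠ 0 := by exact_mod_cast hn
  -- `(n + 1) B ρ B† = (n + 1) ρ + G ρ + ρ G† + G ρ G† / (n + 1)`
  set B : Mat d := 1 + ((n : ℂ) + 1)⁻¹ • G with hB
  have e : (t : ℂ) • Y n = (t : ℂ) • ((((n : ℝ) + 1 : ℝ) : ℂ) • mulBoth B B.conjTranspose + J) +
      (-(t * ((n : ℂ) + 1))) • 1 := by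
    refine ContinuousLinearMap.ext fun ρ => ?_
    change (t : ℂ) • (G * ρ * 1 + 1 * ρ * G.conjTranspose + J ρ +
      ((1 / ((n : ℝ) + 1) : ℝ) : ℂ) • (G * ρ * G.conjTranspose)) =
      (t : ℂ) • ((((n : ℝ) + 1 : ℝ) : ℂ) • (B * ρ * B.conjTranspose) + J ρ) +
        (-(t * ((n : ℂ) + 1))) • ρ
    have hBs : B.conjTranspose = 1 + ((n : ℂ) + 1)⁻¹ • G.conjTranspose := by
      rw [hB, Matrix.conjTranspose_add, Matrix.conjTranspose_one, Matrix.conjTranspose_smul]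
      congr 2
      simp
    rw [hBs, hB, mul_one, one_mul]
    simp only [add_mul, mul_add, one_mul, mul_one, smul_mul_assoc, mul_smul_comm]
    push_cast
    match_scalars <;> field_simp
    ring
  change IsCompletelyPositive (NormedSpace.exp ((t : ℂ) • Y n))
  have e2 : Complex.exp (-(t * ((n : ℂ) + 1))) = ((Real.exp (-(t * ((n : ℝ) + 1))) : ℝ) : ℂ) := by
    push_cast; rfl
  rw [e]
  have e3 := exp_add_smul_one (𝔸 := SuperOp d)
    ((t : ℂ) • ((((n : ℝ) + 1 : ℝ) : ℂ) • mulBoth B B.conjTranspose + J)) (-(t * ((n : ℂ) + 1)))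
  rw [e3, e2]
  exact ((((isCompletelyPositive_mulBoth B).smul (by positivity)).add hJ).smul ht).exp.smul
    (Real.exp_pos _).le

theorem IsLindbladian.isCompletelyPositive_exp {L : SuperOp d} (hL : IsLindbladian L) {t : ℝ}
    (ht : 0 ≤ t) : IsCompletelyPositive (NormedSpace.exp ((t : ℂ) • L)) := by
  obtain ⟨H, k, V, hH, rfl⟩ := hL
  have hJ : IsCompletelyPositive (∑ a, mulBoth (V a) (V a).conjTranspose) :=
    isCompletelyPositive_sum fun a _ => isCompletelyPositive_mulBoth _
  set K : Mat d := ∑ a, (V a).conjTranspose * V a with hK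
  have hKs : K.conjTranspose = K := by
    simp only [hK, Matrix.conjTranspose_sum, conjTranspose_conj_mul]
  -- The generator is `ρ ↦ G ρ + ρ G† + ∑ V_a ρ V_a†` with `G = -iH - K/2`.
  have h := isCompletelyPositive_exp_generator ((-Complex.I) • H - (1 / 2 : ℂ) • K) hJ ht
  have e : mulBoth ((-Complex.I) • H - (1 / 2 : ℂ) • K) 1 +
      mulBoth 1 ((-Complex.I) • H - (1 / 2 : ℂ) • K).conjTranspose +
      ∑ a, mulBoth (V a) (V a).conjTranspose =
      (-Complex.I) • adMap H + ∑ a, dissipator (V a) (V a) := by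
    have hd : ∑ a, dissipator (V a) (V a) = ∑ a, mulBoth (V a) (V a).conjTranspose -
        (1 / 2 : ℂ) • (leftMul d K + rightMul d K) := by
      rw [hK, map_sum, map_sum, ← Finset.sum_add_distrib, Finset.smul_sum,
        ← Finset.sum_sub_distrib]
      rfl
    have hs : ((-Complex.I) • H - (1 / 2 : ℂ) • K).conjTranspose =
        Complex.I • H - (1 / 2 : ℂ) • K := by
      rw [Matrix.conjTranspose_sub, Matrix.conjTranspose_smul, Matrix.conjTranspose_smul, hKs,
        hH.eq]
      simp
    have h1 : ∀ A : Mat d, mulBoth A 1 = leftMul d A := fun _ => rfl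
    have h2 : ∀ A : Mat d, mulBoth 1 A = rightMul d A := fun _ => rfl
    rw [hs, hd, adMap, h1, h2, h1, h2, map_sub, map_sub, (leftMul d).map_smul,
      (leftMul d).map_smul, (rightMul d).map_smul, (rightMul d).map_smul]
    module
  rw [← e]
  exact h

end CompletelyPositive

section TracePreserving

variable {d : ℕ}

/-- The trace, as a bounded functional. -/
def traceL (d : ℕ) : Mat d →L[ℂ] ℂ :=
  LinearMap.toContinuousLinearMap (Matrix.traceLinearMap (Fin d) ℂ ℂ)

theorem trace_adMap (H ρ : Mat d) : (adMap H ρ).trace = 0 := by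
  rw [adMap_apply, Matrix.trace_sub, Matrix.trace_mul_comm, sub_self]

theorem trace_dissipator (V ρ : Mat d) : (dissipator V V ρ).trace = 0 := by
  change (V * ρ * V.conjTranspose - (1 / 2 : ℂ) •
    (V.conjTranspose * V * ρ * 1 + 1 * ρ * (V.conjTranspose * V))).trace = 0
  have h1 : (V * ρ * V.conjTranspose).trace = (V.conjTranspose * V * ρ).trace := by
    rw [Matrix.trace_mul_comm, mul_assoc]
  have h2 : (ρ * (V.conjTranspose * V)).trace = (V.conjTranspose * V * ρ).trace :=
    Matrix.trace_mul_comm _ _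
  rw [Matrix.trace_sub, Matrix.trace_smul, mul_one, one_mul, Matrix.trace_add, h1, h2,
    smul_eq_mul]
  ring

theorem IsLindbladian.trace_eq_zero {L : SuperOp d} (hL : IsLindbladian L) (ρ : Mat d) :
    (L ρ).trace = 0 := by
  obtain ⟨H, k, V, -, rfl⟩ := hL
  change ((-Complex.I) • adMap H ρ + (∑ a, dissipator (V a) (V a)) ρ).trace = 0
  rw [sum_apply, Matrix.trace_add, Matrix.trace_smul, trace_adMap, Matrix.trace_sum, smul_zero,
    zero_add]
  exact Finset.sum_eq_zero fun a _ => trace_dissipator _ _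

theorem IsLindbladian.isTracePreserving_exp {L : SuperOp d} (hL : IsLindbladian L) (t : ℝ) :
    IsTracePreserving (NormedSpace.exp ((t : ℂ) • L)) := by
  have h : (0 : ℂ →L[ℂ] ℂ) ∘L traceL d = traceL d ∘L ((t : ℂ) • L) :=
    ContinuousLinearMap.ext fun ρ => by
      change (0 : ℂ) = ((t : ℂ) • L ρ).trace
      rw [Matrix.trace_smul, hL.trace_eq_zero, smul_zero]
  have h2 := exp_comp_of_comp_eq h
  rw [NormedSpace.exp_zero] at h2
  intro ρ
  exact (congrArg (fun T : Mat d →L[ℂ] ℂ => T ρ) h2).symm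

theorem IsTracePreserving.mul {Φ Ψ : SuperOp d} (hΦ : IsTracePreserving Φ)
    (hΨ : IsTracePreserving Ψ) : IsTracePreserving (Φ * Ψ) := fun ρ => (hΦ _).trans (hΨ ρ)

/-- The norm of a positive matrix is one of its eigenvalues, and the trace is their sum. -/
theorem norm_le_trace_re {A : Mat d} (hA : 0 ≤ A) : ‖A‖ ≤ A.trace.re := by
  have hps := Matrix.nonneg_iff_posSemidef.1 hA
  rcases subsingleton_or_nontrivial (Mat d) with h | h
  · rw [Subsingleton.elim A 0]
    simp
  have h1 := CStarAlgebra.norm_mem_spectrum_of_nonneg hA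
  rw [hps.isHermitian.spectrum_real_eq_range_eigenvalues] at h1
  obtain ⟨i, hi⟩ := h1
  have h2 : A.trace.re = ∑ i, hps.isHermitian.eigenvalues i := by
    rw [hps.isHermitian.trace_eq_sum_eigenvalues, Complex.re_sum]
    rfl
  rw [h2, ← hi]
  exact Finset.single_le_sum (fun j _ => hps.eigenvalues_nonneg j) (Finset.mem_univ i)

theorem IsCompletelyPositive.map_nonneg {Φ : SuperOp d} (hΦ : IsCompletelyPositive Φ) {A : Mat d}
    (hA : 0 ≤ A) : 0 ≤ Φ A := by
  obtain ⟨Ψ, h⟩ := hΦ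
  rw [← h, ← map_zero Ψ]
  exact OrderHomClass.mono Ψ hA

/-- Families of completely positive trace preserving maps are bounded, by the uniform boundedness
principle and the fact that they do not increase the trace of positive matrices. -/
theorem exists_norm_le_of_isCompletelyPositive {ι : Type*} {Φ : ι → SuperOp d}
    (h1 : ∀ i, IsCompletelyPositive (Φ i)) (h2 : ∀ i, IsTracePreserving (Φ i)) :
    ∃ C, ∀ i, ‖Φ i‖ ≤ C := by
  refine banach_steinhaus fun A => ?_
  have hA : A ∈ Submodule.span ℂ {a : Mat d | 0 ≤ a} := by
    rw [CStarAlgebra.span_nonneg]; trivial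
  induction hA using Submodule.span_induction with
  | mem a ha =>
    refine ⟨a.trace.re, fun i => ?_⟩
    rw [← h2 i a]
    exact norm_le_trace_re ((h1 i).map_nonneg ha)
  | zero => exact ⟨0, fun i => by rw [map_zero, norm_zero]⟩
  | add a b _ _ ha hb =>
    obtain ⟨C, hC⟩ := ha
    obtain ⟨C', hC'⟩ := hb
    exact ⟨C + C', fun i => by
      rw [map_add]
      exact (norm_add_le _ _).trans (add_le_add (hC i) (hC' i))⟩
  | smul c a _ ha =>
    obtain ⟨C, hC⟩ := ha
    exact ⟨‖c‖ * C, fun i => by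
      rw [map_smul, norm_smul]
      exact mul_le_mul_of_nonneg_left (hC i) (norm_nonneg c)⟩

end TracePreserving

end

/-! ### Standard form of the generators -/

section

section Kraus

variable {d : ℕ}

/-- The Choi matrix of a map on `M_d`, with rows and columns indexed by the matrix units. -/
def choi (d : ℕ) : SuperOp d →L[ℂ] Matrix (Fin d × Fin d) (Fin d × Fin d) ℂ :=
  LinearMap.toContinuousLinearMap
    { toFun := fun Φ => Matrix.of fun a b => Φ (Matrix.single a.2 b.2 1) a.1 b.1
      map_add' := fun _ _ => rfl
      map_smul' := fun _ _ => rfl }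

theorem choi_apply (Φ : SuperOp d) (a b : Fin d × Fin d) :
    choi d Φ a b = Φ (Matrix.single a.2 b.2 1) a.1 b.1 := rfl

theorem mul_single_mul_apply (A C : Mat d) (i j k l : Fin d) :
    (A * Matrix.single k l (1 : ℂ) * C : Mat d) i j = A i k * C l j := by
  rw [Matrix.mul_apply, Finset.sum_eq_single l]
  · rw [Matrix.mul_single_apply_same, mul_one]
  · intro b _ hb
    rw [Matrix.mul_single_apply_of_ne _ _ _ _ _ hb, zero_mul]
  · simp

theorem choi_mulBoth_apply (A B : Mat d) (a b : Fin d × Fin d) :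
    choi d (mulBoth A B.conjTranspose) a b = A a.1 a.2 * starRingEnd ℂ (B b.1 b.2) := by
  rw [choi_apply, mulBoth_apply, mul_single_mul_apply]
  rfl

theorem choi_injective : Function.Injective (choi d) := by
  intro Φ Ψ h
  refine ContinuousLinearMap.ext fun ρ => ?_
  rw [Matrix.matrix_eq_sum_single ρ]
  simp only [map_sum]
  refine Finset.sum_congr rfl fun i _ => Finset.sum_congr rfl fun j _ => ?_
  have e : Matrix.single i j (ρ i j) = ρ i j • Matrix.single i j (1 : ℂ) := by
    rw [Matrix.smul_single, smul_eq_mul, mul_one]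
  rw [e, map_smul, map_smul]
  congr 1
  ext k l
  exact congrFun (congrFun h (k, i)) (l, j)

/-- A map whose Choi matrix is positive semidefinite has a Kraus decomposition. -/
theorem exists_kraus {Φ : SuperOp d} (h : 0 ≤ choi d Φ) :
    ∃ V : Fin d × Fin d → Mat d, Φ = ∑ a, mulBoth (V a) (V a).conjTranspose := by
  obtain ⟨N, hN⟩ := CStarAlgebra.nonneg_iff_eq_star_mul_self.1 h
  refine ⟨fun c => Matrix.of fun i l => starRingEnd ℂ (N c (i, l)), choi_injective ?_⟩
  rw [hN, map_sum]
  ext a b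
  rw [Matrix.mul_apply, Matrix.sum_apply]
  refine Finset.sum_congr rfl fun c _ => ?_
  rw [choi_mulBoth_apply]
  simp

/-- The value at the identity of the dual map, `Φ ↦ Φ*(1)`. -/
def dualOne (d : ℕ) : SuperOp d →L[ℂ] Mat d :=
  LinearMap.toContinuousLinearMap
    { toFun := fun Φ => Matrix.of fun k l => ∑ i, Φ (Matrix.single l k 1) i i
      map_add' := fun Φ Ψ => by
        ext k l
        change ∑ i, (Φ (Matrix.single l k 1) i i + Ψ (Matrix.single l k 1) i i) = _ + _
        exact Finset.sum_add_distrib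
      map_smul' := fun c Φ => by
        ext k l
        change ∑ i, c * Φ (Matrix.single l k 1) i i = c * ∑ i, Φ (Matrix.single l k 1) i i
        exact (Finset.mul_sum _ _ _).symm }

theorem dualOne_mulBoth (A C : Mat d) : dualOne d (mulBoth A C) = C * A := by
  ext k l
  change ∑ i, (A * Matrix.single l k (1 : ℂ) * C : Mat d) i i = _
  rw [Matrix.mul_apply]
  exact Finset.sum_congr rfl fun i _ => by rw [mul_single_mul_apply, mul_comm]

/-- The linear map `Φ ↦ Φ - (1/2) {Φ*(1), ·}`, which sends completely positive maps to
generators. -/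
def dissipative (d : ℕ) : SuperOp d →L[ℂ] SuperOp d :=
  ContinuousLinearMap.id ℂ _ - (1 / 2 : ℂ) • ((leftMul d + rightMul d) ∘L dualOne d)

theorem dissipative_mulBoth (A B : Mat d) :
    dissipative d (mulBoth A B.conjTranspose) = dissipator A B := by
  change mulBoth A B.conjTranspose - (1 / 2 : ℂ) •
    (leftMul d (dualOne d (mulBoth A B.conjTranspose)) +
      rightMul d (dualOne d (mulBoth A B.conjTranspose))) = _
  rw [dualOne_mulBoth]
  rfl

/-- The standard form with an arbitrary finite index set of jump operators. -/
theorem IsLindbladian.of_fintype {ι : Type*} [Fintype ι] {H : Mat d} (hH : H.IsHermitian)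
    (V : ι → Mat d) : IsLindbladian ((-Complex.I) • adMap H + ∑ a, dissipator (V a) (V a)) := by
  refine ⟨H, Fintype.card ι, fun a => V ((Fintype.equivFin ι).symm a), hH, ?_⟩
  rw [Equiv.sum_comp (Fintype.equivFin ι).symm fun a => dissipator (V a) (V a)]

theorem mulBoth_conj_dissipator {a b : Mat d} (hba : b * a = 1) (hb : a.conjTranspose = b)
    (V : Mat d) : mulBoth a b * dissipator V V * mulBoth b a = dissipator (a * V * b) (a * V * b) := by
  have hbs : b.conjTranspose = a := by rw [← hb, Matrix.conjTranspose_conjTranspose]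
  have hV : (a * V * b).conjTranspose = a * V.conjTranspose * b := by
    rw [Matrix.conjTranspose_mul, Matrix.conjTranspose_mul, hb, hbs, mul_assoc]
  have hab : a * b = 1 := mul_eq_one_comm.1 hba
  have hK : a * V.conjTranspose * b * (a * V * b) = a * (V.conjTranspose * V) * b := by
    calc a * V.conjTranspose * b * (a * V * b) = a * V.conjTranspose * (b * a) * V * b := by
          simp only [mul_assoc]
      _ = _ := by rw [hba, mul_one]; simp only [mul_assoc]
  rw [dissipator, dissipator, hV, hK, mul_sub, sub_mul, mul_smul_comm, smul_mul_assoc, mul_add,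
    add_mul]
  simp only [mulBoth_mul_mulBoth]
  simp only [one_mul, mul_one, hab, mul_assoc]

end Kraus

namespace OpenSystem

variable {r d m : ℕ} {E : Type*} [NormedAddCommGroup E] [InnerProductSpace ℂ E] [CompleteSpace E]
variable {M : OpenSystem r d m E}

/-- The `n`-th term of the completely positive part of `D̄`, for given `μ`, `ν`. -/
def jumpTerm (M : OpenSystem r d m E) (μ ν : Fin m) (n : Fin r → ℤ) : SuperOp d :=
  ∑ w ∈ M.bohr, M.h μ ν (w + dotFreq M.Ω n) •
    mulBoth (M.Scomp ν n w) (M.Scomp μ n w).conjTranspose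

theorem summable_jumpTerm (hM : M.Assumptions) (μ ν : Fin m) : Summable (M.jumpTerm μ ν) := by
  refine (summable_halfFourier_smul_add (V := SuperOp d) hM
    (ContinuousLinearMap.mulLeftRight ℂ (Mat d)) (starConj d) μ ν).congr fun n => ?_
  rw [map_sum, ← Finset.sum_add_distrib]
  refine Finset.sum_congr rfl fun w _ => ?_
  change _ • mulBoth _ _ + starConj d (_ • mulBoth _ _) = _
  rw [starConj_smul, starConj_mulBoth, Matrix.conjTranspose_conjTranspose, ← add_smul, h_eq hM]

/-- The completely positive part of `D̄`. -/
def jump (M : OpenSystem r d m E) : SuperOp d := ∑ μ, ∑ ν, ∑' n, M.jumpTerm μ ν n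

theorem dissipative_jumpTerm (μ ν : Fin m) (n : Fin r → ℤ) :
    dissipative d (M.jumpTerm μ ν n) = M.dissTerm μ ν n := by
  rw [jumpTerm, map_sum, dissTerm]
  exact Finset.sum_congr rfl fun w _ => by rw [map_smul, dissipative_mulBoth]

/-- The dissipative part `D̄` is determined by its completely positive part. -/
theorem dissipative_jump (hM : M.Assumptions) : dissipative d M.jump = M.Dbar := by
  rw [jump, map_sum, Dbar]
  refine Finset.sum_congr rfl fun μ _ => ?_
  rw [map_sum]
  refine Finset.sum_congr rfl fun ν _ => ?_
  have h := (dissipative d).hasSum (summable_jumpTerm hM μ ν).hasSum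
  simp only [dissipative_jumpTerm] at h
  exact h.tsum_eq.symm

/-- The Choi matrix is a sum over `ω` of `B [h(ω + n · Ω)]ᵀ B†`, where the columns of `B` are the
matrices `S_{νnω}`. -/
theorem choi_sum_jumpTerm_nonneg (hM : M.Assumptions) (n : Fin r → ℤ) :
    0 ≤ ∑ μ, ∑ ν, choi d (M.jumpTerm μ ν n) := by
  have e : ∑ μ, ∑ ν, choi d (M.jumpTerm μ ν n) = ∑ w ∈ M.bohr,
      (Matrix.of fun (a : Fin d × Fin d) ν => M.Scomp ν n w a.1 a.2) *
        (Matrix.of fun μ ν => M.h μ ν (w + dotFreq M.Ω n)).transpose *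
        (Matrix.of fun (a : Fin d × Fin d) ν => M.Scomp ν n w a.1 a.2).conjTranspose := by
    ext a b
    simp only [jumpTerm, map_sum, map_smul, Matrix.sum_apply, Matrix.smul_apply,
      choi_mulBoth_apply, Matrix.mul_apply, Matrix.of_apply, Matrix.transpose_apply,
      Matrix.conjTranspose_apply, Finset.sum_mul, smul_eq_mul, RCLike.star_def]
    rw [Finset.sum_congr rfl fun μ _ => Finset.sum_comm, Finset.sum_comm]
    refine Finset.sum_congr rfl fun w _ => Finset.sum_congr rfl fun μ _ =>
      Finset.sum_congr rfl fun ν _ => ?_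
    ring
  rw [e]
  exact Finset.sum_nonneg fun w _ => Matrix.nonneg_iff_posSemidef.2
    ((posSemidef_h hM _).transpose.mul_mul_conjTranspose_same _)

theorem choi_jump_nonneg (hM : M.Assumptions) : 0 ≤ choi d M.jump := by
  have h : HasSum (fun n => ∑ μ, ∑ ν, choi d (M.jumpTerm μ ν n)) (choi d M.jump) := by
    rw [jump]
    simp only [map_sum]
    exact hasSum_sum fun μ _ => hasSum_sum fun ν _ =>
      (choi d).hasSum (summable_jumpTerm hM μ ν).hasSum
  exact h.nonneg (choi_sum_jumpTerm_nonneg hM)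

/-- The jump operators are Kraus operators of the completely positive part. -/
theorem exists_Dbar_eq (hM : M.Assumptions) :
    ∃ V : Fin d × Fin d → Mat d, M.Dbar = ∑ a, dissipator (V a) (V a) := by
  obtain ⟨V, hV⟩ := exists_kraus (choi_jump_nonneg hM)
  refine ⟨V, ?_⟩
  rw [← dissipative_jump hM, hV, map_sum]
  exact Finset.sum_congr rfl fun a _ => dissipative_mulBoth _ _

theorem isLindbladian_X (hM : M.Assumptions) : IsLindbladian M.X := by
  obtain ⟨V, hV⟩ := exists_Dbar_eq hM
  rw [X, hV]
  exact IsLindbladian.of_fintype (M.hermitian_Hbar.add (isHermitian_ΔH hM)) V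

theorem isLindbladian_L (hM : M.Assumptions) (t : ℝ) : IsLindbladian (M.L t) := by
  obtain ⟨V, hV⟩ := exists_Dbar_eq hM
  have h1 : M.Sigma t * M.Dbar * M.Sigmainv t =
      ∑ a, dissipator (M.p t * V a * (M.p t).conjTranspose)
        (M.p t * V a * (M.p t).conjTranspose) := by
    rw [hV, Finset.mul_sum, Finset.sum_mul]
    exact Finset.sum_congr rfl fun a _ =>
      mulBoth_conj_dissipator (conjTranspose_p_mul hM t) rfl (V a)
  have h2 : M.L t = (-Complex.I) • adMap (M.H t + M.Sigma t M.ΔH) +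
      M.Sigma t * M.Dbar * M.Sigmainv t := by
    rw [L, inverse_Sigma hM]
    rfl
  rw [h2, h1]
  refine IsLindbladian.of_fintype ((hM.hermitian_H t).add ?_) _
  have h3 := isHermitian_ΔH hM
  change (M.p t * M.ΔH * (M.p t).conjTranspose).conjTranspose =
    M.p t * M.ΔH * (M.p t).conjTranspose
  rw [Matrix.conjTranspose_mul, Matrix.conjTranspose_mul, Matrix.conjTranspose_conjTranspose,
    h3.eq, mul_assoc]

end OpenSystem

end

/-! ### Regularity and divisibility of the reduced dynamics -/

section

/-- A family of operators with bounded derivative is uniformly continuous. -/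
theorem uniformContinuousOn_of_hasDerivWithinAt_mul {𝔸 : Type*} [NormedRing 𝔸] [NormedAlgebra ℝ 𝔸]
    {L Λ : ℝ → 𝔸} {s : Set ℝ} (hs : Convex ℝ s) {C C' : ℝ} (hL : ∀ t, ‖L t‖ ≤ C)
    (hΛ : ∀ t ∈ s, ‖Λ t‖ ≤ C') (h : ∀ t ∈ s, HasDerivWithinAt Λ (L t * Λ t) s t) :
    UniformContinuousOn Λ s := by
  have hC : 0 ≤ C := (norm_nonneg _).trans (hL 0)
  refine (hs.lipschitzOnWith_of_nnnorm_hasDerivWithin_le (C := (C * C').toNNReal) h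
    fun t ht => ?_).uniformContinuousOn
  rw [← NNReal.coe_le_coe, coe_nnnorm]
  refine le_trans ?_ (Real.le_coe_toNNReal _)
  exact (norm_mul_le _ _).trans (mul_le_mul (hL t) (hΛ t ht) (norm_nonneg _) hC)

/-- If `P' = L P - P X`, then `P e^{tX}` satisfies the equation with generator `L`. -/
theorem hasDerivWithinAt_mul_exp_ofReal_smul {𝔸 : Type*} [NormedRing 𝔸] [NormedAlgebra ℂ 𝔸]
    [CompleteSpace 𝔸] {L P : ℝ → 𝔸} {X : 𝔸} {s : Set ℝ} {t : ℝ}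
    (hP : HasDerivWithinAt P (L t * P t - P t * X) s t) :
    HasDerivWithinAt (fun t => P t * NormedSpace.exp ((t : ℂ) • X))
      (L t * (P t * NormedSpace.exp ((t : ℂ) • X))) s t := by
  refine (hP.mul (hasDerivAt_exp_ofReal_smul X t).hasDerivWithinAt).congr_deriv ?_
  rw [sub_mul, mul_assoc, mul_assoc, sub_add_cancel]

theorem exp_ofReal_zero_smul {𝔸 : Type*} [NormedRing 𝔸] [NormedAlgebra ℂ 𝔸] (Y : 𝔸) :
    NormedSpace.exp (((0 : ℝ) : ℂ) • Y) = 1 := by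
  rw [Complex.ofReal_zero, zero_smul, NormedSpace.exp_zero]

theorem exp_sub_smul_mul {𝔸 : Type*} [NormedRing 𝔸] [NormedAlgebra ℂ 𝔸] [CompleteSpace 𝔸] (Y : 𝔸)
    (s u t : ℝ) :
    NormedSpace.exp (((t - u : ℝ) : ℂ) • Y) * NormedSpace.exp (((u - s : ℝ) : ℂ) • Y) =
      NormedSpace.exp (((t - s : ℝ) : ℂ) • Y) := by
  let := NormedAlgebra.restrictScalars ℚ ℂ 𝔸
  have hc : Commute (((t - u : ℝ) : ℂ) • Y) (((u - s : ℝ) : ℂ) • Y) :=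
    ((Commute.refl Y).smul_left _).smul_right _
  rw [← NormedSpace.exp_add_of_commute hc, ← add_smul]
  push_cast
  ring_nf

theorem IsQuasiperiodic.exists_norm_le {r : ℕ} {V : Type*} [NormedAddCommGroup V] {Ω : Fin r → ℝ}
    {A : ℝ → V} (h : IsQuasiperiodic Ω A) : ∃ C, ∀ t, ‖A t‖ ≤ C := by
  obtain ⟨F, hF, hA⟩ := h
  obtain ⟨C, hC⟩ := isCompact_univ.exists_bound_of_continuousOn hF.continuousOn
  exact ⟨C, fun t => by rw [hA]; exact hC _ (Set.mem_univ _)⟩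

theorem isTracePreserving_mulBoth_star {d : ℕ} {a : Mat d} (h : a.conjTranspose * a = 1) :
    IsTracePreserving (mulBoth a a.conjTranspose) := fun ρ => by
  rw [mulBoth_apply, Matrix.trace_mul_comm, ← mul_assoc, h, one_mul]

namespace OpenSystem

variable {r d m : ℕ} {E : Type*} [NormedAddCommGroup E] [InnerProductSpace ℂ E] [CompleteSpace E]
variable {M : OpenSystem r d m E}

theorem hasDerivWithinAt_reducedDynamics (hM : M.Assumptions) {t : ℝ} (ht : 0 ≤ t) :
    HasDerivWithinAt M.reducedDynamics (M.L t * M.reducedDynamics t) (Set.Ici 0) t := by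
  have h := hasDerivWithinAt_mul_exp_ofReal_smul (𝔸 := SuperOp d) (hasDerivWithinAt_Sigma hM ht)
  have e : M.reducedDynamics = fun t => M.Sigma t * NormedSpace.exp ((t : ℂ) • M.X) :=
    funext fun t => reducedDynamics_eq t
  rw [e]
  exact h

theorem isCompletelyPositive_reducedDynamics (hM : M.Assumptions) {t : ℝ} (ht : 0 ≤ t) :
    IsCompletelyPositive (M.reducedDynamics t) := by
  rw [reducedDynamics_eq]
  exact (isCompletelyPositive_mulBoth _).mul ((isLindbladian_X hM).isCompletelyPositive_exp ht)

theorem isTracePreserving_reducedDynamics (hM : M.Assumptions) (t : ℝ) :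
    IsTracePreserving (M.reducedDynamics t) := by
  rw [reducedDynamics_eq]
  exact (isTracePreserving_mulBoth_star (conjTranspose_p_mul hM t)).mul
    ((isLindbladian_X hM).isTracePreserving_exp t)

theorem uniformContinuousOn_reducedDynamics (hM : M.Assumptions) :
    UniformContinuousOn M.reducedDynamics (Set.Ici 0) := by
  obtain ⟨C, hC⟩ := IsQuasiperiodic.exists_norm_le (V := SuperOp d) (isQuasiperiodic_L hM)
  obtain ⟨C', hC'⟩ := exists_norm_le_of_isCompletelyPositive
    (Φ := fun t : Set.Ici (0 : ℝ) => M.reducedDynamics t)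
    (fun t => isCompletelyPositive_reducedDynamics hM t.2)
    (fun t => isTracePreserving_reducedDynamics hM t)
  have h := uniformContinuousOn_of_hasDerivWithinAt_mul (𝔸 := SuperOp d) (convex_Ici 0) hC
    (fun t ht => hC' ⟨t, ht⟩) (fun t ht => hasDerivWithinAt_reducedDynamics hM ht)
  exact h

/-- The propagator `Σ_t e^{(t-s)X} Σ_s⁻¹`. -/
def propagator (M : OpenSystem r d m E) (t s : ℝ) : SuperOp d :=
  M.Sigma t * NormedSpace.exp (((t - s : ℝ) : ℂ) • M.X) * M.Sigmainv s

theorem propagator_self (hM : M.Assumptions) (t : ℝ) : M.propagator t t = 1 := by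
  have h := exp_ofReal_zero_smul (𝔸 := SuperOp d) M.X
  rw [propagator, sub_self, h, mul_one, Sigma_mul_Sigmainv hM]

theorem propagator_mul_propagator (hM : M.Assumptions) (s u t : ℝ) :
    M.propagator t u * M.propagator u s = M.propagator t s := by
  simp only [propagator, mul_assoc]
  rw [← mul_assoc (M.Sigmainv u), Sigmainv_mul_Sigma hM, one_mul,
    ← mul_assoc (NormedSpace.exp _) (NormedSpace.exp _)]
  have h := exp_sub_smul_mul (𝔸 := SuperOp d) M.X s u t
  rw [h]

theorem propagator_mul_reducedDynamics (hM : M.Assumptions) (s t : ℝ) :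
    M.propagator t s * M.reducedDynamics s = M.reducedDynamics t := by
  have e (t : ℝ) : M.reducedDynamics t = M.propagator t 0 := by
    have h : M.Sigmainv 0 = 1 := by
      rw [← Sigma_mul_Sigmainv hM 0, Sigma_zero hM, one_mul]
    rw [propagator, h, mul_one, sub_zero, reducedDynamics_eq]
    rfl
  rw [e, e, propagator_mul_propagator hM]

theorem isCompletelyPositive_propagator (hM : M.Assumptions) {s t : ℝ} (h : s ≤ t) :
    IsCompletelyPositive (M.propagator t s) := by
  have h1 : M.Sigmainv s =
      mulBoth (M.p s).conjTranspose ((M.p s).conjTranspose).conjTranspose := by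
    rw [Matrix.conjTranspose_conjTranspose]
    rfl
  refine ((isCompletelyPositive_mulBoth _).mul
    ((isLindbladian_X hM).isCompletelyPositive_exp (sub_nonneg.2 h))).mul ?_
  rw [h1]
  exact isCompletelyPositive_mulBoth _

theorem reducedDynamics_zero (hM : M.Assumptions) : M.reducedDynamics 0 = 1 := by
  have h := exp_ofReal_zero_smul (𝔸 := SuperOp d) M.X
  rw [reducedDynamics_eq, h, Sigma_zero hM]
  rfl

end OpenSystem

end

end OpenQuantum

end

theorem theorem3 {r d m : ℕ} {E : Type*} [NormedAddCommGroup E] [InnerProductSpace ℂ E]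
    [CompleteSpace E] (M : OpenQuantum.OpenSystem r d m E) (hM : M.Assumptions) :
    -- the free evolution is the principal fundamental solution of the free von Neumann equation
    (M.U 0 = 1 ∧ ∀ t, 0 ≤ t → HasDerivWithinAt M.U (M.Z t ∘L M.U t) (Set.Ici 0) t) ∧
    -- the weak coupling dynamics exists
    (∃ Λ : ℝ → OpenQuantum.SuperOp d, M.IsReducedDynamics Λ) ∧
    -- the objects which enter the generators are well defined
    (∀ μ ν, MeasureTheory.Integrable (M.f μ ν)) ∧
    (∀ w, (Matrix.of fun μ ν => M.h μ ν w).PosSemidef) ∧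
    (∀ w, (Matrix.of fun μ ν => M.ζ μ ν w).IsHermitian) ∧
    (∀ μ ν, Summable (M.lambTerm μ ν)) ∧ (∀ μ ν, Summable (M.dissTerm μ ν)) ∧
    M.ΔH.IsHermitian ∧
    ∀ Λ : ℝ → OpenQuantum.SuperOp d, M.IsReducedDynamics Λ →
      -- regularity in time
      UniformContinuousOn Λ (Set.Ici 0) ∧ DifferentiableOn ℝ Λ (Set.Ici 0) ∧
      -- a quantum dynamical map, and CP-divisible
      (∀ t, 0 ≤ t → OpenQuantum.IsCompletelyPositive (Λ t) ∧
        OpenQuantum.IsTracePreserving (Λ t)) ∧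
      OpenQuantum.IsCPDivisible Λ ∧
      -- the Markovian master equation, with a quasiperiodic generator in standard form
      Λ 0 = 1 ∧ (∀ ρ₀, OpenQuantum.IsSolution M.L (fun t => Λ t ρ₀)) ∧
      OpenQuantum.IsQuasiperiodic M.Ω M.L ∧ (∀ t, OpenQuantum.IsLindbladian (M.L t)) ∧
      -- reducibility and the product form
      OpenQuantum.IsReducible M.Ω M.L ∧
      OpenQuantum.IsQuasiperiodic M.Ω M.Sigma ∧
      ∀ t : ℝ, 0 ≤ t → Λ t = M.Sigma t ∘L NormedSpace.exp ((t : ℂ) • M.X) := by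
  refine ⟨⟨M.U_zero hM, fun t ht => M.hasDerivWithinAt_U hM ht⟩,
    ⟨M.reducedDynamics, OpenQuantum.OpenSystem.isReducedDynamics hM⟩,
    OpenQuantum.OpenSystem.integrable_f hM, OpenQuantum.OpenSystem.posSemidef_h hM,
    OpenQuantum.OpenSystem.isHermitian_ζ hM, OpenQuantum.OpenSystem.summable_lambTerm hM,
    OpenQuantum.OpenSystem.summable_dissTerm hM, OpenQuantum.OpenSystem.isHermitian_ΔH hM,
    fun Λ hΛ => ?_⟩
  have e : Set.EqOn M.reducedDynamics Λ (Set.Ici 0) := fun t ht => (hΛ.eq hM ht).symm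
  refine ⟨(OpenQuantum.OpenSystem.uniformContinuousOn_reducedDynamics hM).congr e,
    fun t ht => ?_, fun t ht => ?_,
    ⟨M.propagator, fun t _ => OpenQuantum.OpenSystem.propagator_self hM t,
      fun s u t _ _ _ => OpenQuantum.OpenSystem.propagator_mul_propagator hM s u t,
      fun s t hs hst => ⟨?_, OpenQuantum.OpenSystem.isCompletelyPositive_propagator hM hst⟩⟩,
    ?_, fun ρ t ht => ?_, OpenQuantum.OpenSystem.isQuasiperiodic_L hM,
    OpenQuantum.OpenSystem.isLindbladian_L hM, OpenQuantum.OpenSystem.isReducible_L hM,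
    OpenQuantum.OpenSystem.isQuasiperiodic_Sigma hM, fun t ht => ?_⟩
  · have h := (OpenQuantum.OpenSystem.hasDerivWithinAt_reducedDynamics hM
      ht).congr_of_mem (fun s hs => (e hs).symm) ht
    exact h.differentiableWithinAt
  · rw [hΛ.eq hM ht]
    exact ⟨OpenQuantum.OpenSystem.isCompletelyPositive_reducedDynamics hM ht,
      OpenQuantum.OpenSystem.isTracePreserving_reducedDynamics hM t⟩
  · rw [hΛ.eq hM (hs.trans hst), hΛ.eq hM hs]
    exact (OpenQuantum.OpenSystem.propagator_mul_reducedDynamics hM s t).symm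
  · rw [hΛ.eq hM le_rfl, OpenQuantum.OpenSystem.reducedDynamics_zero hM]
  · have h := OpenQuantum.OpenSystem.isSolution_reducedDynamics hM ρ t ht
    have e' : ∀ s ∈ Set.Ici (0 : ℝ), Λ s ρ = M.reducedDynamics s ρ := fun s hs => by
      rw [hΛ.eq hM hs]
    change HasDerivWithinAt _ (M.L t (Λ t ρ)) _ _
    rw [e' t ht]
    exact h.congr_of_mem e' ht
  · rw [hΛ.eq hM ht]
    exact OpenQuantum.OpenSystem.reducedDynamics_eq t
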